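/- Let $n\ge 1$, $m\ge 0$, $k\in\mathbb R$, and let $\overline M(k)^{n+m}$ be the space form of constant curvature $k$: the sphere of radius $1/\sqrt k$ if $k>0$, Euclidean space $\mathbb R^{n+m}$ if $k=0$, hyperbolic space of curvature $k$ if $k<0$. Let $x:\mathcal M^n\to\overline M(k)^{n+m}$ be a smooth isometric immersion (with first fundamental form $I=\langle\cdot,\cdot\rangle$, second fundamental form $I\!I$ and shape operators $A_\xi$, $\langle A_\xi X,Y\rangle=\langle I\!I(X,Y),\xi\rangle$). Assume that the normal connection $\nabla^\perp$ is flat and that the index of relative nullity $\dim\{X\in T_p\mathcal M: I\!I(X,\cdot)=0\}$ is zero at every point $p$. Let $W=\sum_{j=1}^m A_{e_j}^2$ be the Obata operator, where $e_1,\dots,e_m$ is any orthonormal basis of the normal space, and let $I\!I\!I(X,Y)=\langle WX,Y\rangle$ be the third fundamental form. Then $W$ is independent of the basis and invertible, and $I\!I\!I$ is a Riemannian metric on $\mathcal M$. Let $\nabla$ and $\nabla^{(I\!I\!I)}$ be the Levi-Civita connections of $I$ and $I\!I\!I$ (which exist), and $R$, $R^{(I\!I\!I)}$ their curvature tensors,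 with $R(X,Y)Z=\nabla_X\nabla_YZ-\nabla_Y\nabla_XZ-\nabla_{[X,Y]}Z$. Let $\xi_1,\dots,\xi_m$ be any smooth orthonormal frame of the normal bundle over an open set $U\subset\mathcal M$, put $A_j=A_{\xi_j}$ and $$(\nabla_XA_j)Y=\nabla_X(A_jY)-A_j\nabla_XY-A_{\nabla^\perp_X\xi_j}Y$$ (the last term vanishes if the frame is parallel), and $$T(X,Y)=W^{-1}\sum_{j=1}^mA_j(\nabla_XA_j)Y,\qquad P(X,Y)Z=W^{-1}\sum_{j=1}^m\bigl(A_j\,(R(X,Y)A_j)+[\nabla_XA_j,\nabla_YA_j]\bigr)Z,$$ where $(R(X,Y)A_j)Z=R(X,Y)(A_jZ)-A_jR(X,Y)Z$. Then, on $U$, for all smooth vector fields $X,Y,Z,V$: (i) $\nabla^{(I\!I\!I)}_XY-\nabla_XY=T(X,Y)$. (ii) (Theorema Egregium) $$I\!I\!I\bigl(R^{(I\!I\!I)}(X,Y)Z-R(X,Y)Z,V\bigr)=I\!I\!I(P(X,Y)Z,V)+I\!I\!I(T(X,Z),T(Y,V))-I\!I\!I(T(X,V),T(Y,Z)).$$ (iii)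 The scalar curvature of $I\!I\!I$ is $$\mathcal R^{(I\!I\!I)}=k(n-1)\frac{\sigma_{n-1}(W)}{\det W}+\mathrm{tr}_{I\!I\!I}(A_H)-n+\|T\|^2_{I\!I\!I}-\|\mathrm{tr}_{I\!I\!I}T\|^2_{I\!I\!I}+\mathrm{tr}_{I\!I\!I}\,\mathrm{tr}_c P .$$ Here $H=\mathrm{tr}_I I\!I$ is the (unnormalized) mean curvature vector, $\sigma_{n-1}(W)$ is the $(n-1)$-st elementary symmetric polynomial of the eigenvalues of $W$, $(\mathrm{tr}_cP)(X,Y)=\mathrm{tr}(V\mapsto P(V,X)Y)$, and with an $I\!I\!I$-orthonormal basis $V_1,\dots,V_n$ of $T_p\mathcal M$: $\mathrm{tr}_{I\!I\!I}\beta=\sum_\mu\beta(V_\mu,V_\mu)$ for a bilinear form $\beta$, $\mathrm{tr}_{I\!I\!I}(A_H)=\sum_\mu\langle A_HV_\mu,V_\mu\rangle$, $\|T\|^2_{I\!I\!I}=\sum_{\mu,\nu}I\!I\!I(T(V_\mu,V_\nu),T(V_\mu,V_\nu))$. -/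

import Mathlib

open scoped Manifold ContDiff Topology
open Bundle

noncomputable section

/-! ## Linear algebra: metric contractions in the standard basis -/

/-- The standard basis vector `e_a` of `ℝⁿ`. -/
def stdVec {n : ℕ} (a : Fin n) : EuclideanSpace ℝ (Fin n) := EuclideanSpace.single a 1

/-- The inverse Gram matrix `(g^{ab})` of a bilinear form `g` on `ℝⁿ`. -/
def invGram {n : ℕ} (g : EuclideanSpace ℝ (Fin n) → EuclideanSpace ℝ (Fin n) → ℝ) :
    Matrix (Fin n) (Fin n) ℝ :=
  (Matrix.of fun a b => g (stdVec a) (stdVec b))⁻¹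

/-- Raising an index: for an inner product `g` and a linear functional `φ` this is the unique
vector `w` with `g(w, v) = φ(v)` for all `v`. -/
def raiseIndex {n : ℕ} (g : EuclideanSpace ℝ (Fin n) → EuclideanSpace ℝ (Fin n) → ℝ)
    (φ : EuclideanSpace ℝ (Fin n) → ℝ) : EuclideanSpace ℝ (Fin n) :=
  ∑ a, ∑ b, (invGram g a b * φ (stdVec b)) • stdVec a

lemma raiseIndex_add {n : ℕ} (g : EuclideanSpace ℝ (Fin n) → EuclideanSpace ℝ (Fin n) → ℝ)
    (φ ψ : EuclideanSpace ℝ (Fin n) → ℝ) :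
    raiseIndex g (fun v => φ v + ψ v) = raiseIndex g φ + raiseIndex g ψ := by
  simp only [raiseIndex, mul_add, add_smul, Finset.sum_add_distrib]

lemma raiseIndex_smul {n : ℕ} (g : EuclideanSpace ℝ (Fin n) → EuclideanSpace ℝ (Fin n) → ℝ)
    (c : ℝ) (φ : EuclideanSpace ℝ (Fin n) → ℝ) :
    raiseIndex g (fun v => c * φ v) = c • raiseIndex g φ := by
  simp only [raiseIndex, Finset.smul_sum, smul_smul]
  refine Finset.sum_congr rfl fun a _ => Finset.sum_congr rfl fun b _ => ?_
  congr 1; ring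

/-- The trace `tr_g β = ∑ g^{ab} β(e_a, e_b)` of a (possibly vector valued) bilinear form `β` with
respect to an inner product `g`, i.e. `∑ β(V_μ, V_μ)` for any `g`-orthonormal basis `(V_μ)`. -/
def metricTrace {n : ℕ} {F : Type*} [AddCommGroup F] [Module ℝ F]
    (g : EuclideanSpace ℝ (Fin n) → EuclideanSpace ℝ (Fin n) → ℝ)
    (β : EuclideanSpace ℝ (Fin n) → EuclideanSpace ℝ (Fin n) → F) : F :=
  ∑ a, ∑ b, invGram g a b • β (stdVec a) (stdVec b)

/-- The trace of a linear map `f : ℝⁿ → ℝⁿ`. -/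
def opTrace {n : ℕ} (f : EuclideanSpace ℝ (Fin n) → EuclideanSpace ℝ (Fin n)) : ℝ :=
  ∑ a, f (stdVec a) a

/-- The `j`-th elementary symmetric polynomial of the eigenvalues (counted with multiplicity). -/
def eigenEsymm {n : ℕ} (j : ℕ) (f : Module.End ℝ (EuclideanSpace ℝ (Fin n))) : ℝ :=
  (LinearMap.charpoly f).roots.esymm j

/-! ## Space forms -/

/-- The linear space `ℝ^N × ℝ` containing the space forms of dimension `N`. -/
abbrev Amb (N : ℕ) : Type := EuclideanSpace ℝ (Fin N) × ℝ

/-- The bilinear form `⟨y, y'⟩ + sign(k) t t'` on `ℝ^N × ℝ`: Euclidean for `k > 0`, Lorentzian for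
`k < 0`, and (on `ℝ^N × {0}`) the Euclidean product of `ℝ^N` for `k = 0`. -/
def ambForm {N : ℕ} (k : ℝ) (z w : Amb N) : ℝ :=
  inner ℝ z.1 w.1 + (SignType.sign k : ℝ) * (z.2 * w.2)

/-- The space form of dimension `N` and constant sectional curvature `k`: the round sphere of
radius `1/√k` in `ℝ^N × ℝ` for `k > 0`, the upper sheet of the hyperboloid `⟨z, z⟩ = 1/k` in
Minkowski space for `k < 0`, and `ℝ^N = ℝ^N × {0}` for `k = 0`. -/
def spaceForm (k : ℝ) (N : ℕ) : Set (Amb N) :=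
  {z | (k = 0 → z.2 = 0) ∧ (k ≠ 0 → ambForm k z z = 1 / k) ∧ (k < 0 → 0 < z.2)}

/-- `v` is tangent to the space form at its point `z`. -/
def IsTangentSpaceForm {N : ℕ} (k : ℝ) (z v : Amb N) : Prop :=
  (k = 0 → v.2 = 0) ∧ (k ≠ 0 → ambForm k z v = 0)

lemma ambForm_add_left {N : ℕ} (k : ℝ) (z z' w : Amb N) :
    ambForm k (z + z') w = ambForm k z w + ambForm k z' w := by
  simp only [ambForm, Prod.fst_add, Prod.snd_add, inner_add_left]; ring

lemma ambForm_smul_left {N : ℕ} (k c : ℝ) (z w : Amb N) :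
    ambForm k (c • z) w = c * ambForm k z w := by
  simp only [ambForm, Prod.smul_fst, Prod.smul_snd, real_inner_smul_left, smul_eq_mul]; ring

/-! ## Levi-Civita connections and curvature -/

section Intrinsic

variable {n : ℕ} {M : Type*} [TopologicalSpace M] [ChartedSpace (EuclideanSpace ℝ (Fin n)) M]

/-- Vector fields on `M` (no regularity included). -/
abbrev VField (n : ℕ) (M : Type*) [TopologicalSpace M]
    [ChartedSpace (EuclideanSpace ℝ (Fin n)) M] : Type _ :=
  Π p : M, TangentSpace (𝓡 n) p

/-- Smoothness of a vector field on a set. -/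
def VField.SmoothOn [IsManifold (𝓡 n) ∞ M] (X : VField n M) (U : Set M) : Prop :=
  ContMDiffOn (𝓡 n) (𝓡 n).tangent ∞ (fun p => (⟨p, X p⟩ : TangentBundle (𝓡 n) M)) U

/-- Differentiability of a vector field at a point. -/
def VField.DiffAt [IsManifold (𝓡 n) ∞ M] (X : VField n M) (p : M) : Prop :=
  MDifferentiableAt (𝓡 n) (𝓡 n).tangent (fun q => (⟨q, X q⟩ : TangentBundle (𝓡 n) M)) p

/-- Fields of bilinear forms on the tangent spaces. -/
abbrev FormField (n : ℕ) (M : Type*) [TopologicalSpace M]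
    [ChartedSpace (EuclideanSpace ℝ (Fin n)) M] : Type _ :=
  Π p : M, TangentSpace (𝓡 n) p → TangentSpace (𝓡 n) p → ℝ

/-- An affine connection on `M`. The term `D Y p (X p)` is `(∇_X Y)(p)`. -/
abbrev Connection (n : ℕ) (M : Type*) [TopologicalSpace M]
    [ChartedSpace (EuclideanSpace ℝ (Fin n)) M] [IsManifold (𝓡 n) ∞ M] : Type _ :=
  CovariantDerivative (𝓡 n) (EuclideanSpace ℝ (Fin n)) (fun p : M => TangentSpace (𝓡 n) p)

/-- `D` is the Levi-Civita connection of the metric `g`: it is torsion free and metric. -/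
structure IsLeviCivita [IsManifold (𝓡 n) ∞ M] (g : FormField n M) (D : Connection n M) :
    Prop where
  torsion_free : ∀ (X Y : VField n M) (p : M), X.DiffAt p → Y.DiffAt p →
    D Y p (X p) - D X p (Y p) = VectorField.mlieBracket (𝓡 n) X Y p
  metric : ∀ (X Y Z : VField n M) (p : M), Y.DiffAt p → Z.DiffAt p →
    mvfderiv (𝓡 n) (fun q => g q (Y q) (Z q)) p (X p) =
      g p (D Y p (X p)) (Z p) + g p (Y p) (D Z p (X p))

/-- The curvature `R(X,Y)Z = ∇_X∇_Y Z - ∇_Y∇_X Z - ∇_{[X,Y]} Z`. -/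
def curvature [IsManifold (𝓡 n) ∞ M] (D : Connection n M) (X Y Z : VField n M) : VField n M :=
  fun p => D (fun q => D Z q (Y q)) p (X p) - D (fun q => D Z q (X q)) p (Y p)
    - D Z p (VectorField.mlieBracket (𝓡 n) X Y p)

/-- A vector field which is smooth near `p` and takes the value `v` at `p`. -/
def extVec [IsManifold (𝓡 n) ∞ M] {p : M} (v : TangentSpace (𝓡 n) p) : VField n M :=
  FiberBundle.extend (E := fun q : M => TangentSpace (𝓡 n) q) (EuclideanSpace ℝ (Fin n)) v

/-- The Ricci contraction `tr_c S (u, v) = tr (w ↦ S(w, u) v)` at `p` of a tensor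
`S(X, Y) Z` that is given on vector fields. -/
def ricciContraction [IsManifold (𝓡 n) ∞ M]
    (S : VField n M → VField n M → VField n M → VField n M) (p : M)
    (u v : TangentSpace (𝓡 n) p) : ℝ :=
  opTrace fun w => S (extVec (p := p) w) (extVec u) (extVec v) p

/-- The scalar curvature of `(M, g)`, where `D` is the Levi-Civita connection of `g`. -/
def scalarCurvature [IsManifold (𝓡 n) ∞ M] (g : FormField n M) (D : Connection n M) (p : M) : ℝ :=
  metricTrace (g p) (ricciContraction (curvature D) p)

end Intrinsic

/-! ## Immersions into space forms -/

section Extrinsic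

variable {n m : ℕ} {M : Type*} [TopologicalSpace M] [ChartedSpace (EuclideanSpace ℝ (Fin n)) M]

/-- `x` is a smooth immersion of `M` into the space form of curvature `k`. -/
structure IsSpaceFormImmersion (k : ℝ) (x : M → Amb (n + m)) : Prop where
  smooth : ContMDiff (𝓡 n) 𝓘(ℝ, Amb (n + m)) ∞ x
  mem : ∀ p, x p ∈ spaceForm k (n + m)
  injective_mvfderiv : ∀ p, Function.Injective (mvfderiv (𝓡 n) x p)

/-- The first fundamental form, i.e. the induced metric on `M`. -/
def firstForm (k : ℝ) (x : M → Amb (n + m)) : FormField n M :=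
  fun p u v => ambForm k (mvfderiv (𝓡 n) x p u) (mvfderiv (𝓡 n) x p v)

/-- The vector `u` of `T_p M` for which `dx(u)` is the orthogonal projection of `w` to
`dx(T_p M)`. -/
def tangentPart (k : ℝ) (x : M → Amb (n + m)) (p : M) (w : Amb (n + m)) : TangentSpace (𝓡 n) p :=
  raiseIndex (firstForm k x p) fun v => ambForm k w (mvfderiv (𝓡 n) x p v)

/-- The component of `w` orthogonal to `dx(T_p M)`. -/
def normalPart (k : ℝ) (x : M → Amb (n + m)) (p : M) (w : Amb (n + m)) : Amb (n + m) :=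
  w - mvfderiv (𝓡 n) x p (tangentPart k x p w)

/-- The Levi-Civita connection of the space form along `x`: for a section `s` of the pull-back of
its tangent bundle, `∇̄_u s` is the component of `D_u s` tangent to the space form, and
this is `D_u s + k ⟨dx(u), s⟩ x`. -/
def ambCov (k : ℝ) (x : M → Amb (n + m)) (s : M → Amb (n + m)) (p : M)
    (u : TangentSpace (𝓡 n) p) : Amb (n + m) :=
  mvfderiv (𝓡 n) s p u + (k * ambForm k (mvfderiv (𝓡 n) x p u) (s p)) • x p

lemma normalPart_add (k : ℝ) (x : M → Amb (n + m)) (p : M) (w w' : Amb (n + m)) :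
    normalPart k x p (w + w') = normalPart k x p w + normalPart k x p w' := by
  have h : tangentPart k x p (w + w') = tangentPart k x p w + tangentPart k x p w' := by
    unfold tangentPart
    simp only [ambForm_add_left]
    exact raiseIndex_add _ _ _
  simp only [normalPart, h, map_add]
  abel

lemma normalPart_smul (k : ℝ) (x : M → Amb (n + m)) (p : M) (c : ℝ) (w : Amb (n + m)) :
    normalPart k x p (c • w) = c • normalPart k x p w := by
  have h : tangentPart k x p (c • w) = c • tangentPart k x p w := by
    unfold tangentPart
    simp only [ambForm_smul_left]
    exact raiseIndex_smul _ _ _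
  simp only [normalPart, h, map_smul, smul_sub]

lemma ambCov_add (k : ℝ) (x s : M → Amb (n + m)) (p : M) (u u' : TangentSpace (𝓡 n) p) :
    ambCov k x s p (u + u') = ambCov k x s p u + ambCov k x s p u' := by
  simp only [ambCov, map_add, ambForm_add_left, mul_add, add_smul]
  abel

lemma ambCov_smul (k : ℝ) (x s : M → Amb (n + m)) (p : M) (c : ℝ) (u : TangentSpace (𝓡 n) p) :
    ambCov k x s p (c • u) = c • ambCov k x s p u := by
  simp only [ambCov, map_smul, ambForm_smul_left, smul_add, smul_smul]
  congr 2; ring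

variable [IsManifold (𝓡 n) ∞ M]

/-- `η` lies in the normal space `N_p M ⊂ T_{x(p)} M̄`. -/
def IsNormalAt (k : ℝ) (x : M → Amb (n + m)) (p : M) (η : Amb (n + m)) : Prop :=
  IsTangentSpaceForm k (x p) η ∧ ∀ u : TangentSpace (𝓡 n) p,
    ambForm k η (mvfderiv (𝓡 n) x p u) = 0

/-- `ξ` is a smooth section over `U` of the normal bundle. -/
def IsNormalFieldOn (k : ℝ) (x : M → Amb (n + m)) (U : Set M) (ξ : M → Amb (n + m)) : Prop :=
  ContMDiffOn (𝓡 n) 𝓘(ℝ, Amb (n + m)) ∞ ξ U ∧ ∀ p ∈ U, IsNormalAt k x p (ξ p)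

/-- The normal connection `∇^⊥_u ξ = (∇̄_u ξ)^⊥`. -/
def normalCov (k : ℝ) (x : M → Amb (n + m)) (ξ : M → Amb (n + m)) (p : M)
    (u : TangentSpace (𝓡 n) p) : Amb (n + m) :=
  normalPart k x p (ambCov k x ξ p u)

/-- The normal bundle is flat: `R^⊥(X,Y)ξ = ∇^⊥_X ∇^⊥_Y ξ - ∇^⊥_Y ∇^⊥_X ξ - ∇^⊥_{[X,Y]} ξ = 0` for
all (local) smooth vector fields `X, Y` and normal fields `ξ`. -/
def IsNormallyFlat (k : ℝ) (x : M → Amb (n + m)) : Prop :=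
  ∀ (U : Set M), IsOpen U → ∀ (X Y : VField n M), X.SmoothOn U → Y.SmoothOn U →
    ∀ ξ : M → Amb (n + m), IsNormalFieldOn k x U ξ → ∀ p ∈ U,
      normalCov k x (fun q => normalCov k x ξ q (Y q)) p (X p)
        - normalCov k x (fun q => normalCov k x ξ q (X q)) p (Y p)
        - normalCov k x ξ p (VectorField.mlieBracket (𝓡 n) X Y p) = 0

/-- The second fundamental form `II(u,v) = (∇̄_u dx(V))^⊥`, where `V` extends `v`. -/
def secondForm (k : ℝ) (x : M → Amb (n + m)) (p : M) (u v : TangentSpace (𝓡 n) p) : Amb (n + m) :=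
  normalPart k x p (ambCov k x (fun q => mvfderiv (𝓡 n) x q (extVec v q)) p u)

/-- The Weingarten (shape) operator `A_η` of `T_p M`, given by `⟨A_η u, v⟩ = ⟨II(u,v), η⟩`. -/
def shapeOp (k : ℝ) (x : M → Amb (n + m)) (p : M) (η : Amb (n + m)) :
    Module.End ℝ (TangentSpace (𝓡 n) p) where
  toFun u := raiseIndex (firstForm k x p) fun v => ambForm k (secondForm k x p u v) η
  map_add' u u' := by
    simp only [secondForm, ambCov_add, normalPart_add, ambForm_add_left]
    exact raiseIndex_add _ _ _
  map_smul' c u := by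
    simp only [secondForm, ambCov_smul, normalPart_smul, ambForm_smul_left]
    exact raiseIndex_smul _ _ _

/-- The index of relative nullity at `p`: the dimension of `{u | II(u, v) = 0 for all v}`. -/
def relativeNullity (k : ℝ) (x : M → Amb (n + m)) (p : M) : ℕ :=
  Module.finrank ℝ (Submodule.span ℝ
    {u : TangentSpace (𝓡 n) p | ∀ v : TangentSpace (𝓡 n) p, secondForm k x p u v = 0})

/-- `e` is an orthonormal basis of the (`m`-dimensional) normal space at `p`. -/
def IsNormalBasisAt (k : ℝ) (x : M → Amb (n + m)) (p : M) (e : Fin m → Amb (n + m)) : Prop :=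
  (∀ j, IsNormalAt k x p (e j)) ∧ ∀ i j, ambForm k (e i) (e j) = if i = j then 1 else 0

/-- `ξ` is a smooth orthonormal frame of the normal bundle over `U`. -/
def IsNormalFrameOn (k : ℝ) (x : M → Amb (n + m)) (U : Set M) (ξ : Fin m → M → Amb (n + m)) :
    Prop :=
  (∀ j, IsNormalFieldOn k x U (ξ j)) ∧ ∀ p ∈ U, IsNormalBasisAt k x p fun j => ξ j p

/-- The Obata operator `W = ∑ A_{e_j}²`, for some orthonormal basis `(e_j)` of the normal space
(it does not depend on the basis). -/
def obata (k : ℝ) (x : M → Amb (n + m)) (p : M) : Module.End ℝ (TangentSpace (𝓡 n) p) :=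
  ∑ j, shapeOp k x p (Classical.epsilon (IsNormalBasisAt k x p) j) ^ 2

/-- The third fundamental form `III(u, v) = ⟨W u, v⟩`. -/
def thirdForm (k : ℝ) (x : M → Amb (n + m)) : FormField n M :=
  fun p u v => firstForm k x p (obata k x p u) v

/-- The mean curvature vector `H = tr_I II`. -/
def meanCurvature (k : ℝ) (x : M → Amb (n + m)) (p : M) : Amb (n + m) :=
  metricTrace (firstForm k x p) (secondForm k x p)

/-- The covariant derivative of the shape operators at a normal field `ξ`:
`(∇_X A_ξ) Y = ∇_X (A_ξ Y) - A_ξ ∇_X Y - A_{∇^⊥_X ξ} Y`.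
The last term vanishes if `ξ` is parallel in the normal connection. -/
def covShape (k : ℝ) (x : M → Amb (n + m)) (D : Connection n M) (ξ : M → Amb (n + m))
    (X Y : VField n M) : VField n M :=
  fun p => D (fun q => shapeOp k x q (ξ q) (Y q)) p (X p)
    - shapeOp k x p (ξ p) (D Y p (X p))
    - shapeOp k x p (normalCov k x ξ p (X p)) (Y p)

/-- `T(X,Y) = W⁻¹ ∑_j A_j (∇_X A_j) Y`. -/
def tensorT (k : ℝ) (x : M → Amb (n + m)) (D : Connection n M) (ξ : Fin m → M → Amb (n + m))
    (X Y : VField n M) : VField n M :=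
  fun p => Ring.inverse (obata k x p)
    (∑ j, shapeOp k x p (ξ j p) (covShape k x D (ξ j) X Y p))

/-- The curvature of `∇` acting on the field of shape operators `A_ξ`:
`(R(X,Y) A_ξ) Z = R(X,Y)(A_ξ Z) - A_ξ (R(X,Y) Z)`. -/
def curvatureShape (k : ℝ) (x : M → Amb (n + m)) (D : Connection n M) (ξ : M → Amb (n + m))
    (X Y Z : VField n M) : VField n M :=
  fun p => curvature D X Y (fun q => shapeOp k x q (ξ q) (Z q)) p
    - shapeOp k x p (ξ p) (curvature D X Y Z p)

/-- `P(X,Y)Z = W⁻¹ ∑_j (A_j (R(X,Y) A_j) + [∇_X A_j, ∇_Y A_j]) Z`. -/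
def tensorP (k : ℝ) (x : M → Amb (n + m)) (D : Connection n M) (ξ : Fin m → M → Amb (n + m))
    (X Y Z : VField n M) : VField n M :=
  fun p => Ring.inverse (obata k x p)
    (∑ j, (shapeOp k x p (ξ j p) (curvatureShape k x D (ξ j) X Y Z p)
      + (covShape k x D (ξ j) X (covShape k x D (ξ j) Y Z) p
        - covShape k x D (ξ j) Y (covShape k x D (ξ j) X Z) p)))

/-- The value `T_p(u, v)` of the tensor `T` on tangent vectors at `p`. -/
def tensorTAt (k : ℝ) (x : M → Amb (n + m)) (D : Connection n M) (ξ : Fin m → M → Amb (n + m))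
    (p : M) (u v : TangentSpace (𝓡 n) p) : TangentSpace (𝓡 n) p :=
  tensorT k x D ξ (extVec u) (extVec v) p

end Extrinsic

end

/-! Let `E = Hom(NM, TM)` carry the metric and the connection induced by `I`, `∇` and `∇^⊥`; in an
orthonormal normal frame its sections are `m`-tuples of vector fields. Everything rests on the
bundle map `α : TM → E`, `Y ↦ (A_j Y)_j`. Since the `A_j` are self-adjoint, `III(Y, Z) = ⟨αY, αZ⟩`,
and zero relative nullity makes `α` injective. Hence `III` is a Riemannian metric, `α` is isometric
onto a subbundle, and `s ↦ W⁻¹ ∑ A_j s_j` is the orthogonal projection onto that subbundle followed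
by `α⁻¹`.

Projecting the connection of `E` gives `frameConn`. It is metric for `III` because the connection of
`E` is metric (`tupleConn_metric`), and torsion free because the Codazzi equation reads `∇_X(αY) -
∇_Y(αX) = α[X,Y]` (`tupleConn_torsion`). By uniqueness (`leviCivita_unique_at`) it is the
Levi-Civita connection of `III`. Expanding `∇_X(A_j Y) = (∇_X A_j)Y + A_j ∇_X Y` and using `∑ A_j² =
W` gives (i).

Part (ii) is the Gauss equation of the subbundle `α(TM) ⊂ E` (`thirdForm_curvature`). Flatness of
`∇^⊥` makes the curvature of `E` act as `R` in each component (`tupleConn_curvature`). The second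
fundamental form of the subbundle is the part of `((∇_X A_j)Z)_j` orthogonal to it, so it
contributes pairings of derivatives of the `A_j` minus pairings of `T`
(`sum_tupleConn_sub_thirdForm`). Since `∇_X A_j` is self-adjoint, the former are the commutators in
`P` (`thirdForm_tensorP`).

Part (iii) is the `III`-contraction of (ii), where `T` is symmetric as a difference of torsion-free
connections (`scalar_contraction`). By the Gauss equation of `x` the Ricci tensor of `I` is `k(n-1)
I + ⟨A_H ·, ·⟩ - III`, and `tr_III I = tr W⁻¹ = σ_{n-1}(W)/det W`.

The structure equations come from one identity, the commutator of derivatives along two fields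
(`mvfderiv_mlieBracket`), applied to the position `x`, to `dx(Z)` and to a normal field. -/

set_option linter.unusedSectionVars false

noncomputable section

/-! ### Derivatives of vector-valued functions along vector fields. -/

section Calculus

lemma two_le_infty : (2 : ℕ∞ω) ≤ ∞ := by
  exact WithTop.coe_le_coe.2 (le_top : ((2 : ℕ) : ℕ∞) ≤ ⊤)

variable {n : ℕ} {M : Type*} [TopologicalSpace M] [ChartedSpace (EuclideanSpace ℝ (Fin n)) M]
  [IsManifold (𝓡 n) ∞ M] {F : Type*} [NormedAddCommGroup F] [NormedSpace ℝ F]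

lemma VField.SmoothOn.contMDiffAt {X : VField n M} {U : Set M} (hX : X.SmoothOn U) (hU : IsOpen U)
    {p : M} (hp : p ∈ U) :
    ContMDiffAt (𝓡 n) (𝓡 n).tangent ∞ (fun q => (⟨q, X q⟩ : TangentBundle (𝓡 n) M)) p :=
  ContMDiffOn.contMDiffAt hX (hU.mem_nhds hp)

lemma VField.SmoothOn.diffAt {X : VField n M} {U : Set M} (hX : X.SmoothOn U) (hU : IsOpen U)
    {p : M} (hp : p ∈ U) : X.DiffAt p :=
  (hX.contMDiffAt hU hp).mdifferentiableAt (by simp)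

/-- The derivative of a smooth function along a smooth vector field is smooth. -/
lemma contMDiffOn_mvfderiv_apply {f : M → F} {X : VField n M} {U : Set M} (hU : IsOpen U)
    (hf : ContMDiffOn (𝓡 n) 𝓘(ℝ, F) ∞ f U) (hX : X.SmoothOn U) :
    ContMDiffOn (𝓡 n) 𝓘(ℝ, F) ∞ (fun q => mvfderiv (𝓡 n) f q (X q)) U := by
  have h := hf.contMDiffOn_tangentMapWithin (m := ∞) le_rfl hU.uniqueMDiffOn
  have h2 := (contMDiff_snd_tangentBundle_modelSpace (n := ∞) F 𝓘(ℝ, F)).comp_contMDiffOn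
    (h.comp hX fun q hq => hq)
  refine h2.congr fun q hq => ?_
  simp only [Function.comp, tangentMapWithin]
  rw [mfderivWithin_of_isOpen hU hq]
  rfl

/-- The tangent map of `f` is smooth, so composing it with a section that is merely differentiable
at `p` is harmless. This weak regularity matters because the axioms of a connection and of
`IsLeviCivita` are imposed for fields differentiable at a single point. -/
lemma mdifferentiableAt_mvfderiv_apply {f : M → F} {X : VField n M} {U : Set M} (hU : IsOpen U)
    (hf : ContMDiffOn (𝓡 n) 𝓘(ℝ, F) ∞ f U) {p : M} (hp : p ∈ U) (hX : X.DiffAt p) :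
    MDifferentiableAt (𝓡 n) 𝓘(ℝ, F) (fun q => mvfderiv (𝓡 n) f q (X q)) p := by
  have h := hf.contMDiffOn_tangentMapWithin (m := ∞) le_rfl hU.uniqueMDiffOn
  have hopen : IsOpen (TotalSpace.proj ⁻¹' U : Set (TangentBundle (𝓡 n) M)) :=
    hU.preimage (FiberBundle.continuous_proj _ _)
  have h1 : MDifferentiableAt (𝓡 n).tangent 𝓘(ℝ, F).tangent
      (tangentMapWithin (𝓡 n) 𝓘(ℝ, F) f U) (⟨p, X p⟩ : TangentBundle (𝓡 n) M) :=
    (h.contMDiffAt (hopen.mem_nhds hp)).mdifferentiableAt (by simp)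
  have h2 := (contMDiff_snd_tangentBundle_modelSpace (n := ∞) F 𝓘(ℝ, F)).mdifferentiable (by simp)
    (tangentMapWithin (𝓡 n) 𝓘(ℝ, F) f U (⟨p, X p⟩ : TangentBundle (𝓡 n) M))
  have h3 := h2.comp p (h1.comp p hX)
  refine h3.congr_of_eventuallyEq ?_
  filter_upwards [hU.mem_nhds hp] with q hq
  simp only [Function.comp, tangentMapWithin]
  rw [mfderivWithin_of_isOpen hU hq]
  rfl

lemma mvfderiv_congr {f g : M → F} {p : M} (h : f =ᶠ[𝓝 p] g) :
    mvfderiv (𝓡 n) f p = mvfderiv (𝓡 n) g p := by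
  ext v
  simp only [mvfderiv, ContinuousLinearMap.comp_apply]
  rw [h.mfderiv_eq]
  rw [h.self_of_nhds]

/-- In the preferred chart at `p`, the differential at `p` is the Fréchet derivative. -/
lemma mvfderiv_eq_fderiv_extChartAt {f : M → F} {p : M}
    (hf : MDifferentiableAt (𝓡 n) 𝓘(ℝ, F) f p) (v : TangentSpace (𝓡 n) p) :
    mvfderiv (𝓡 n) f p v =
      fderiv ℝ (f ∘ (extChartAt (𝓡 n) p).symm) (extChartAt (𝓡 n) p p) v := by
  rw [hf.mvfderiv]
  simp only [writtenInExtChartAt, extChartAt_model_space_eq_id, PartialEquiv.refl_coe,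
    Function.id_comp, ModelWithCorners.range_eq_univ, fderivWithin_univ]
  rfl

/-- The local representative of a vector field in the preferred chart at `p`. -/
def chartField (X : VField n M) (p : M) : EuclideanSpace ℝ (Fin n) → EuclideanSpace ℝ (Fin n) :=
  VectorField.mpullbackWithin 𝓘(ℝ, EuclideanSpace ℝ (Fin n)) (𝓡 n) (extChartAt (𝓡 n) p).symm X
    (Set.range (𝓡 n))

lemma chartField_apply_self (X : VField n M) (p : M) :
    chartField X p (extChartAt (𝓡 n) p p) = X p := by
  have h := mfderivWithin_extChartAt_symm_inverse_apply (I := 𝓡 n)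
    (X ((extChartAt (𝓡 n) p).symm (extChartAt (𝓡 n) p p)))
  unfold chartField
  rw [VectorField.mpullbackWithin_apply]
  -- The point `(extChartAt p).symm (extChartAt p p)` also enters the type of the vector, so it is
  -- generalized to `q` before being replaced by `p`.
  have key : ∀ q, q = p → ((mfderivWithin 𝓘(ℝ, EuclideanSpace ℝ (Fin n)) (𝓡 n)
      (extChartAt (𝓡 n) p).symm (Set.range (𝓡 n)) (extChartAt (𝓡 n) p p)).inverse :
        EuclideanSpace ℝ (Fin n) →L[ℝ] EuclideanSpace ℝ (Fin n)) (X q) = X p := by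
    rintro q rfl
    exact mfderivWithin_extChartAt_symm_inverse_apply (I := 𝓡 n) (X q)
  exact key _ (extChartAt_to_inv p)

lemma differentiableAt_chartField {X : VField n M} {p : M} (hX : X.DiffAt p) :
    DifferentiableAt ℝ (chartField X p) (extChartAt (𝓡 n) p p) := by
  have : IsManifold (𝓡 n) 2 M := IsManifold.of_le (m := 2) (n := ∞) two_le_infty
  have h : DifferentiableWithinAt ℝ (chartField X p)
      ((extChartAt (𝓡 n) p).symm ⁻¹' Set.univ ∩ Set.range (𝓡 n)) (extChartAt (𝓡 n) p p) :=
    (mdifferentiableWithinAt_univ.2 hX).differentiableWithinAt_mpullbackWithin_vectorField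
  rwa [Set.preimage_univ, Set.univ_inter, ModelWithCorners.range_eq_univ,
    differentiableWithinAt_univ] at h

/-- The bracket is computed in the chart and carried back by the derivative of the chart, which is
the identity at the centre. -/
lemma mlieBracket_eq_lieBracket_chartField (X Y : VField n M) (p : M) :
    VectorField.mlieBracket (𝓡 n) X Y p =
      VectorField.lieBracket ℝ (chartField X p) (chartField Y p) (extChartAt (𝓡 n) p p) := by
  have : IsManifold (𝓡 n) 1 M := IsManifold.of_le (m := 1) (n := ∞) (by simp)
  have key : ∀ (L : EuclideanSpace ℝ (Fin n) →L[ℝ] EuclideanSpace ℝ (Fin n))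
      (v : EuclideanSpace ℝ (Fin n)), L = ContinuousLinearMap.id ℝ _ → L.inverse v = v := by
    rintro L v rfl
    rw [ContinuousLinearMap.inverse_id]
    rfl
  refine (key (mfderiv (𝓡 n) 𝓘(ℝ, EuclideanSpace ℝ (Fin n)) (extChartAt (𝓡 n) p) p)
    (VectorField.lieBracketWithin ℝ (chartField X p) (chartField Y p)
      ((extChartAt (𝓡 n) p).symm ⁻¹' Set.univ ∩ Set.range (𝓡 n)) (extChartAt (𝓡 n) p p))
    (mfderiv_extChartAt_self (I := 𝓡 n) (x := p))).trans ?_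
  rw [Set.preimage_univ, Set.univ_inter, ModelWithCorners.range_eq_univ,
    VectorField.lieBracketWithin_univ]

/-- Chain rule: the derivative of the inverse chart carries `chartField X p` to `X`. It is needed at
all points near `p`, since the result is differentiated again. -/
lemma mvfderiv_apply_eq_chartField {f : M → F} {X : VField n M} {p : M}
    {y : EuclideanSpace ℝ (Fin n)} (hy : y ∈ (extChartAt (𝓡 n) p).target)
    (hf : MDifferentiableAt (𝓡 n) 𝓘(ℝ, F) f ((extChartAt (𝓡 n) p).symm y)) :
    mvfderiv (𝓡 n) f ((extChartAt (𝓡 n) p).symm y) (X ((extChartAt (𝓡 n) p).symm y)) =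
      fderiv ℝ (f ∘ (extChartAt (𝓡 n) p).symm) y (chartField X p y) := by
  have : IsManifold (𝓡 n) 1 M := IsManifold.of_le (m := 1) (n := ∞) (by simp)
  have h1 : MDifferentiableAt 𝓘(ℝ, EuclideanSpace ℝ (Fin n)) (𝓡 n) (extChartAt (𝓡 n) p).symm y := by
    have := mdifferentiableWithinAt_extChartAt_symm (I := 𝓡 n) hy
    simpa [ModelWithCorners.range_eq_univ, mdifferentiableWithinAt_univ] using this
  have h2 := mfderiv_comp_apply y hf h1 (chartField X p y)
  rw [mfderiv_eq_fderiv] at h2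
  refine Eq.trans ?_ h2.symm
  have h3 := (isInvertible_mfderivWithin_extChartAt_symm (I := 𝓡 n) hy)
  have h4 : mfderiv 𝓘(ℝ, EuclideanSpace ℝ (Fin n)) (𝓡 n) (extChartAt (𝓡 n) p).symm y
      (chartField X p y) = X ((extChartAt (𝓡 n) p).symm y) := by
    unfold chartField
    rw [VectorField.mpullbackWithin_apply, ← mfderivWithin_univ,
      ← ModelWithCorners.range_eq_univ (𝓡 n)]
    exact h3.self_apply_inverse _
  rw [h4]
  rfl

/-- The commutator of the derivatives along two vector fields is the derivative along their
Lie bracket. -/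
lemma mvfderiv_mlieBracket {f : M → F} {X Y : VField n M} {U : Set M} (hU : IsOpen U)
    (hf : ContMDiffOn (𝓡 n) 𝓘(ℝ, F) ∞ f U) {p : M} (hp : p ∈ U) (hX : X.DiffAt p)
    (hY : Y.DiffAt p) :
    mvfderiv (𝓡 n) (fun q => mvfderiv (𝓡 n) f q (Y q)) p (X p)
      - mvfderiv (𝓡 n) (fun q => mvfderiv (𝓡 n) f q (X q)) p (Y p)
      = mvfderiv (𝓡 n) f p (VectorField.mlieBracket (𝓡 n) X Y p) := by
  set y₀ := extChartAt (𝓡 n) p p with hy₀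
  set G : EuclideanSpace ℝ (Fin n) → F := f ∘ (extChartAt (𝓡 n) p).symm with hG
  have hfp : ContMDiffAt (𝓡 n) 𝓘(ℝ, F) ∞ f p := hf.contMDiffAt (hU.mem_nhds hp)
  have hGs : ContDiffAt ℝ ∞ G y₀ := by
    have := (contMDiffAt_iff.1 hfp).2
    rwa [ModelWithCorners.range_eq_univ, contDiffWithinAt_univ] at this
  have hcont : Filter.Tendsto (extChartAt (𝓡 n) p).symm (𝓝 y₀) (𝓝 p) := by
    have := continuousAt_extChartAt_symm (I := 𝓡 n) p
    rwa [ContinuousAt, extChartAt_to_inv] at this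
  have key : ∀ Z : VField n M, (fun q => mvfderiv (𝓡 n) f q (Z q)) ∘ (extChartAt (𝓡 n) p).symm
      =ᶠ[𝓝 y₀] fun y => fderiv ℝ G y (chartField Z p y) := by
    intro Z
    filter_upwards [extChartAt_target_mem_nhds (I := 𝓡 n) p, hcont (hU.mem_nhds hp)] with y hy hyU
    exact mvfderiv_apply_eq_chartField hy
      ((hf.contMDiffAt (hU.mem_nhds hyU)).mdifferentiableAt (by simp))
  have hG2 : DifferentiableAt ℝ (fderiv ℝ G) y₀ :=
    (hGs.fderiv_right (m := 1) two_le_infty).differentiableAt (by simp)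
  -- Product rule in the chart. After antisymmetrization the Hessian term drops out by symmetry and
  -- the remaining terms form the Lie bracket of the local representatives.
  have main : ∀ Z : VField n M, Z.DiffAt p → ∀ v : TangentSpace (𝓡 n) p,
      mvfderiv (𝓡 n) (fun q => mvfderiv (𝓡 n) f q (Z q)) p v =
        fderiv ℝ (fderiv ℝ G) y₀ v (Z p) + fderiv ℝ G y₀ (fderiv ℝ (chartField Z p) y₀ v) := by
    intro Z hZ v
    rw [mvfderiv_eq_fderiv_extChartAt (mdifferentiableAt_mvfderiv_apply hU hf hp hZ) v,
      (key Z).fderiv_eq, fderiv_clm_apply hG2 (differentiableAt_chartField hZ)]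
    rw [← chartField_apply_self Z p, ← hy₀]
    exact add_comm _ _
  have hsymm : IsSymmSndFDerivAt ℝ G y₀ := hGs.isSymmSndFDerivAt (by simpa using two_le_infty)
  rw [main Y hY, main X hX, mvfderiv_eq_fderiv_extChartAt (hfp.mdifferentiableAt (by simp)),
    mlieBracket_eq_lieBracket_chartField, VectorField.lieBracket, chartField_apply_self,
    chartField_apply_self, map_sub, hsymm (X p) (Y p)]
  abel

end Calculus

/-! ### Smooth vector fields and local frames. -/

section Fields

variable {n : ℕ} {M : Type*} [TopologicalSpace M] [ChartedSpace (EuclideanSpace ℝ (Fin n)) M]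
  [IsManifold (𝓡 n) ∞ M]

lemma VField.SmoothOn.mono {X : VField n M} {U V : Set M} (hX : X.SmoothOn U) (h : V ⊆ U) :
    X.SmoothOn V := ContMDiffOn.mono hX h

lemma VField.SmoothOn.sub {X Y : VField n M} {U : Set M} (hX : X.SmoothOn U) (hY : Y.SmoothOn U) :
    VField.SmoothOn (fun q => X q - Y q) U := ContMDiffOn.sub_section hX hY

lemma VField.SmoothOn.neg {X : VField n M} {U : Set M} (hX : X.SmoothOn U) :
    VField.SmoothOn (fun q => - X q) U := ContMDiffOn.neg_section hX

lemma VField.SmoothOn.smul {f : M → ℝ} {X : VField n M} {U : Set M}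
    (hf : ContMDiffOn (𝓡 n) 𝓘(ℝ, ℝ) ∞ f U) (hX : X.SmoothOn U) :
    VField.SmoothOn (fun q => f q • X q) U := ContMDiffOn.smul_section hf hX

lemma VField.SmoothOn.sum {ι : Type*} {s : Finset ι} {X : ι → VField n M} {U : Set M}
    (hX : ∀ i, (X i).SmoothOn U) :
    VField.SmoothOn (fun q => ∑ i ∈ s, X i q) U := ContMDiffOn.sum_section fun i _ => hX i

lemma VField.SmoothOn.congr {X Y : VField n M} {U : Set M} (hX : X.SmoothOn U)
    (h : ∀ q ∈ U, Y q = X q) : Y.SmoothOn U :=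
  ContMDiffOn.congr hX fun q hq => by rw [h q hq]

/-- Smoothness on a set may be checked locally. -/
lemma VField.SmoothOn.of_locally {X : VField n M} {U : Set M}
    (h : ∀ p ∈ U, ∃ V, IsOpen V ∧ p ∈ V ∧ X.SmoothOn V) : X.SmoothOn U := fun p hp => by
  obtain ⟨V, hV, hpV, hXV⟩ := h p hp
  exact (hXV.contMDiffAt hV hpV).contMDiffWithinAt

lemma VField.DiffAt.smul {f : M → ℝ} {X : VField n M} {p : M}
    (hf : MDifferentiableAt (𝓡 n) 𝓘(ℝ, ℝ) f p) (hX : X.DiffAt p) :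
    VField.DiffAt (fun q => f q • X q) p := MDifferentiableAt.smul_section hf hX

lemma VField.DiffAt.neg {X : VField n M} {p : M} (hX : X.DiffAt p) :
    VField.DiffAt (fun q => - X q) p := mdifferentiableAt_neg_section hX

lemma VField.DiffAt.sum {ι : Type*} {s : Finset ι} {X : ι → VField n M} {p : M}
    (hX : ∀ i, (X i).DiffAt p) :
    VField.DiffAt (fun q => ∑ i ∈ s, X i q) p := MDifferentiableAt.sum_section fun i _ => hX i

lemma VField.DiffAt.congr {X Y : VField n M} {p : M} (hX : X.DiffAt p)
    (h : ∀ᶠ q in 𝓝 p, Y q = X q) : Y.DiffAt p := by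
  refine MDifferentiableAt.congr_of_eventuallyEq hX ?_
  filter_upwards [h] with q hq
  rw [hq]

/-- The domain of the preferred trivialization of the tangent bundle at `p`. -/
def extDomain (n : ℕ) {M : Type*} [TopologicalSpace M] [ChartedSpace (EuclideanSpace ℝ (Fin n)) M]
    [IsManifold (𝓡 n) ∞ M] (p : M) : Set M :=
  (trivializationAt (EuclideanSpace ℝ (Fin n)) (fun q : M => TangentSpace (𝓡 n) q) p).baseSet

lemma isOpen_extDomain (p : M) : IsOpen (extDomain n p) := Trivialization.open_baseSet _

lemma mem_extDomain (p : M) : p ∈ extDomain n p := FiberBundle.mem_baseSet_trivializationAt' p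

@[simp] lemma extVec_self {p : M} (v : TangentSpace (𝓡 n) p) : extVec v p = v :=
  FiberBundle.extend_apply_self _ v

/-- The field is constant in the preferred trivialization at `p`. -/
lemma smoothOn_extVec {p : M} (v : TangentSpace (𝓡 n) p) : (extVec v).SmoothOn (extDomain n p) := by
  unfold VField.SmoothOn extDomain
  refine (Trivialization.contMDiffOn_section_baseSet_iff _).2 ?_
  refine (contMDiffOn_const (c := (trivializationAt (EuclideanSpace ℝ (Fin n))
    (fun q : M => TangentSpace (𝓡 n) q) p ⟨p, v⟩).2)).congr fun q hq => ?_
  rw [extVec, FiberBundle.extend, Trivialization.apply_mk_symm _ hq]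

lemma extVec_diffAt {p : M} (v : TangentSpace (𝓡 n) p) : (extVec v).DiffAt p :=
  (smoothOn_extVec v).diffAt (isOpen_extDomain p) (mem_extDomain p)

/-- For `q` near `p`, the map `v ↦ (extVec v)(q)` is a linear isomorphism. -/
def extEquiv {p q : M} (hq : q ∈ extDomain n p) : TangentSpace (𝓡 n) p ≃ₗ[ℝ] TangentSpace (𝓡 n) q :=
  ((trivializationAt (EuclideanSpace ℝ (Fin n)) (fun q : M => TangentSpace (𝓡 n) q) p).linearEquivAt
    ℝ p (mem_extDomain p)).trans
  ((trivializationAt (EuclideanSpace ℝ (Fin n)) (fun q : M => TangentSpace (𝓡 n) q) p).linearEquivAt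
    ℝ q hq).symm

lemma extEquiv_apply {p q : M} (hq : q ∈ extDomain n p) (v : TangentSpace (𝓡 n) p) :
    extEquiv hq v = extVec v q := rfl

/-- The local frame around `p` extending the standard basis. -/
def stdFrame (p : M) (a : Fin n) : VField n M :=
  extVec (p := p) (stdVec a : EuclideanSpace ℝ (Fin n))

lemma smoothOn_stdFrame (p : M) (a : Fin n) : (stdFrame p a).SmoothOn (extDomain n p) :=
  smoothOn_extVec _

def stdBasis (p : M) : Module.Basis (Fin n) ℝ (TangentSpace (𝓡 n) p) :=
  (EuclideanSpace.basisFun (Fin n) ℝ).toBasis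

lemma stdBasis_apply (p : M) (a : Fin n) :
    stdBasis p a = (stdVec a : EuclideanSpace ℝ (Fin n)) := by
  have h : (EuclideanSpace.basisFun (Fin n) ℝ).toBasis a = stdVec a := by
    rw [OrthonormalBasis.coe_toBasis, EuclideanSpace.basisFun_apply]
    rfl
  exact h

/-- The vectors of this basis vary smoothly with `q`, so Gram matrices taken in it are smooth on
`extDomain n p`. -/
def frameBasis {p q : M} (hq : q ∈ extDomain n p) :
    Module.Basis (Fin n) ℝ (TangentSpace (𝓡 n) q) :=
  (stdBasis p).map (extEquiv hq)

lemma frameBasis_apply {p q : M} (hq : q ∈ extDomain n p) (a : Fin n) :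
    frameBasis hq a = stdFrame p a q := by
  rw [frameBasis, Module.Basis.map_apply, extEquiv_apply, stdBasis_apply]
  rfl

/-- The entries of the inverse of a smooth matrix are smooth. -/
lemma contMDiffOn_inv_apply {ι : Type*} [Fintype ι] [DecidableEq ι] {A : M → Matrix ι ι ℝ} {U : Set M}
    (hA : ∀ a b, ContMDiffOn (𝓡 n) 𝓘(ℝ, ℝ) ∞ (fun q => A q a b) U)
    (hdet : ∀ q ∈ U, (A q).det ≠ 0) (a b : ι) :
    ContMDiffOn (𝓡 n) 𝓘(ℝ, ℝ) ∞ (fun q => (A q)⁻¹ a b) U := by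
  have det_smooth : ∀ B : M → Matrix ι ι ℝ,
      (∀ a b, ContMDiffOn (𝓡 n) 𝓘(ℝ, ℝ) ∞ (fun q => B q a b) U) →
      ContMDiffOn (𝓡 n) 𝓘(ℝ, ℝ) ∞ (fun q => (B q).det) U := by
    intro B hB
    simp only [Matrix.det_apply']
    refine contMDiffOn_finsetSum fun σ _ => contMDiffOn_const.mul ?_
    exact contMDiffOn_finsetProd fun i _ => hB _ _
  -- Cramer's rule: the inverse is the adjugate divided by the determinant, and each adjugate entry
  -- is the determinant of the matrix with one row replaced by a constant row.
  have hadj : ContMDiffOn (𝓡 n) 𝓘(ℝ, ℝ) ∞ (fun q => (A q).adjugate a b) U := by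
    simp only [Matrix.adjugate_apply]
    refine det_smooth _ fun i j => ?_
    by_cases h : i = b
    · subst h; simpa using contMDiffOn_const
    · simpa [Matrix.updateRow_ne h] using hA i j
  refine ((det_smooth A hA).inv₀ hdet |>.mul hadj).congr fun q hq => ?_
  simp [Matrix.inv_def, Ring.inverse_eq_inv']

end Fields

/-! ### Inner products given as bare functions, and contractions with them. -/

section InnerProducts

/-- `g` is an inner product on the real vector space `V`. -/
structure IsInnerProduct {V : Type*} [AddCommGroup V] [Module ℝ V] (g : V → V → ℝ) : Prop where
  symm : ∀ u v, g u v = g v u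
  add_left : ∀ u u' v, g (u + u') v = g u v + g u' v
  smul_left : ∀ (c : ℝ) u v, g (c • u) v = c * g u v
  pos : ∀ u, u ≠ 0 → 0 < g u u

namespace IsInnerProduct

variable {V : Type*} [AddCommGroup V] [Module ℝ V] {g : V → V → ℝ} (hg : IsInnerProduct g)
include hg

lemma add_right (u v v' : V) : g u (v + v') = g u v + g u v' := by
  rw [hg.symm, hg.add_left, hg.symm v, hg.symm v']

lemma smul_right (c : ℝ) (u v : V) : g u (c • v) = c * g u v := by
  rw [hg.symm, hg.smul_left, hg.symm v]

/-- An inner product as a bilinear map. -/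
def toBilin : V →ₗ[ℝ] V →ₗ[ℝ] ℝ :=
  LinearMap.mk₂ ℝ g hg.add_left hg.smul_left hg.add_right hg.smul_right

lemma zero_left (v : V) : g 0 v = 0 := LinearMap.map_zero₂ hg.toBilin v
lemma neg_left (u v : V) : g (-u) v = - g u v := LinearMap.map_neg₂ hg.toBilin u v
lemma sub_left (u u' v : V) : g (u - u') v = g u v - g u' v := LinearMap.map_sub₂ hg.toBilin u u' v
lemma sub_right (u v v' : V) : g u (v - v') = g u v - g u v' := (hg.toBilin u).map_sub v v'

lemma sum_left {ι : Type*} (s : Finset ι) (f : ι → V) (v : V) :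
    g (∑ i ∈ s, f i) v = ∑ i ∈ s, g (f i) v := LinearMap.map_sum₂ hg.toBilin s f v

lemma sum_right {ι : Type*} (s : Finset ι) (f : ι → V) (v : V) :
    g v (∑ i ∈ s, f i) = ∑ i ∈ s, g v (f i) := map_sum (hg.toBilin v) f s

lemma self_eq_zero {u : V} (h : g u u = 0) : u = 0 := by
  by_contra hu
  exact (hg.pos u hu).ne' h

lemma nonneg (u : V) : 0 ≤ g u u := by
  by_cases hu : u = 0
  · rw [hu, hg.zero_left]
  · exact (hg.pos u hu).le

lemma ext_left {u u' : V} (h : ∀ v, g u v = g u' v) : u = u' := by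
  rw [← sub_eq_zero]
  apply hg.self_eq_zero
  rw [hg.sub_left, h, sub_self]

variable {ι : Type*} [Fintype ι] [DecidableEq ι] (b : Module.Basis ι ℝ V)

/-- A vector in the kernel of the Gram matrix gives a nontrivial combination of the basis of length
zero. -/
lemma det_gram_ne_zero : (Matrix.of fun i j => g (b i) (b j)).det ≠ 0 := by
  intro h
  obtain ⟨v, hv, hv0⟩ := Matrix.exists_mulVec_eq_zero_iff.2 h
  have hz : g (∑ i, v i • b i) (∑ i, v i • b i) = 0 := by
    rw [hg.sum_left]
    refine Finset.sum_eq_zero fun i _ => ?_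
    rw [hg.smul_left, hg.sum_right]
    have := congrFun hv0 i
    simp only [Matrix.mulVec, dotProduct, Matrix.of_apply, Pi.zero_apply] at this
    simp only [hg.smul_right]
    rw [show ∑ j, v j * g (b i) (b j) = 0 by simpa only [mul_comm] using this, mul_zero]
  have h0 := hg.self_eq_zero hz
  exact hv (funext fun i => Fintype.linearIndependent_iff.1 b.linearIndependent v h0 i)

/-- The vector representing a linear functional. -/
lemma sum_inv_gram_left (φ : V →ₗ[ℝ] ℝ) (v : V) :
    g (∑ i, ∑ j, ((Matrix.of fun i j => g (b i) (b j))⁻¹ i j * φ (b j)) • b i) v = φ v := by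
  set G := (Matrix.of fun i j => g (b i) (b j)) with hG
  have hGG : G⁻¹ * G = 1 := Matrix.nonsing_inv_mul _ (isUnit_iff_ne_zero.2 (hg.det_gram_ne_zero b))
  have hsymm : ∀ i j, G i j = G j i := fun i j => hg.symm _ _
  have hT : (G⁻¹).transpose = G⁻¹ := by
    rw [Matrix.transpose_nonsing_inv]
    congr 1
    ext i j
    exact hsymm j i
  have key : hg.toBilin (∑ i, ∑ j, (G⁻¹ i j * φ (b j)) • b i) = φ := by
    refine b.ext fun l => ?_
    change g _ (b l) = _
    simp only [hg.sum_left, hg.smul_left]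
    rw [Finset.sum_comm]
    have h1 : ∀ j, ∑ i, G⁻¹ i j * φ (b j) * g (b i) (b l) = if j = l then φ (b j) else 0 := by
      intro j
      have h2 := congrFun (congrFun hGG j) l
      rw [Matrix.mul_apply, Matrix.one_apply] at h2
      calc ∑ i, G⁻¹ i j * φ (b j) * g (b i) (b l)
          = φ (b j) * ∑ i, G⁻¹ j i * G i l := by
            rw [Finset.mul_sum]
            refine Finset.sum_congr rfl fun i _ => ?_
            rw [← congrFun (congrFun hT i) j, Matrix.transpose_apply, hG, Matrix.of_apply]
            ring
        _ = _ := by rw [h2]; split_ifs <;> simp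
    simp [h1]
  exact LinearMap.congr_fun key v

omit [DecidableEq ι] in
lemma inv_gram_symm [DecidableEq ι] (i j : ι) :
    (Matrix.of fun i j => g (b i) (b j))⁻¹ i j = (Matrix.of fun i j => g (b i) (b j))⁻¹ j i := by
  rw [← Matrix.transpose_apply (Matrix.of fun i j => g (b i) (b j))⁻¹, Matrix.transpose_nonsing_inv]
  have h : (Matrix.of fun i j => g (b i) (b j)).transpose = Matrix.of fun i j => g (b i) (b j) := by
    ext i j
    exact hg.symm _ _
  rw [h]

end IsInnerProduct

/-! ### Contractions in the standard basis -/

variable {n : ℕ} {g : EuclideanSpace ℝ (Fin n) → EuclideanSpace ℝ (Fin n) → ℝ}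

lemma stdVec_toBasis (a : Fin n) :
    (EuclideanSpace.basisFun (Fin n) ℝ).toBasis a = stdVec a := by
  rw [OrthonormalBasis.coe_toBasis, EuclideanSpace.basisFun_apply]
  rfl

lemma invGram_eq_basis (g : EuclideanSpace ℝ (Fin n) → EuclideanSpace ℝ (Fin n) → ℝ) :
    invGram g = (Matrix.of fun i j => g ((EuclideanSpace.basisFun (Fin n) ℝ).toBasis i)
      ((EuclideanSpace.basisFun (Fin n) ℝ).toBasis j))⁻¹ := by
  simp only [invGram, stdVec_toBasis]

lemma sum_smul_stdVec (v : EuclideanSpace ℝ (Fin n)) : ∑ a, v a • stdVec a = v := by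
  simpa [stdVec_toBasis] using (EuclideanSpace.basisFun (Fin n) ℝ).toBasis.sum_repr v

lemma stdVec_apply (a b : Fin n) : stdVec a b = if b = a then (1 : ℝ) else 0 := by
  simp [stdVec]

namespace IsInnerProduct

variable (hg : IsInnerProduct g)
include hg

lemma raiseIndex_left (φ : EuclideanSpace ℝ (Fin n) →ₗ[ℝ] ℝ) (v : EuclideanSpace ℝ (Fin n)) :
    g (raiseIndex g φ) v = φ v := by
  have := hg.sum_inv_gram_left (EuclideanSpace.basisFun (Fin n) ℝ).toBasis φ v
  rwa [← invGram_eq_basis, show (∑ i, ∑ j, (invGram g i j *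
    φ ((EuclideanSpace.basisFun (Fin n) ℝ).toBasis j)) •
      (EuclideanSpace.basisFun (Fin n) ℝ).toBasis i) = raiseIndex g φ by
        simp only [raiseIndex, stdVec_toBasis]] at this

lemma invGram_symm (a b : Fin n) : invGram g a b = invGram g b a := by
  rw [invGram_eq_basis]
  exact hg.inv_gram_symm _ a b

lemma raiseIndex_self (v : EuclideanSpace ℝ (Fin n)) : raiseIndex g (g v) = v :=
  hg.ext_left fun w => hg.raiseIndex_left (hg.toBilin v) w

lemma coord_eq (v : EuclideanSpace ℝ (Fin n)) (a : Fin n) :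
    v a = ∑ b, invGram g a b * g v (stdVec b) := by
  conv_lhs => rw [← hg.raiseIndex_self v]
  simp [raiseIndex, stdVec_apply]

/-- The left side does not involve `g`, so the same trace can be evaluated with `I` or with `III`;
the scalar curvature needs both. -/
lemma opTrace_eq (f : EuclideanSpace ℝ (Fin n) → EuclideanSpace ℝ (Fin n)) :
    opTrace f = ∑ a, ∑ b, invGram g a b * g (f (stdVec a)) (stdVec b) := by
  simp only [opTrace, hg.coord_eq (f _)]

lemma contract (φ ψ : EuclideanSpace ℝ (Fin n) →ₗ[ℝ] ℝ) :
    ∑ a, ∑ b, invGram g a b * (φ (stdVec a) * ψ (stdVec b)) =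
      g (raiseIndex g φ) (raiseIndex g ψ) := by
  rw [hg.raiseIndex_left, raiseIndex]
  simp only [map_sum, map_smul, smul_eq_mul]
  refine Finset.sum_congr rfl fun a _ => Finset.sum_congr rfl fun b _ => ?_
  ring

lemma contract_self (u v : EuclideanSpace ℝ (Fin n)) :
    ∑ a, ∑ b, invGram g a b * (g u (stdVec a) * g v (stdVec b)) = g u v := by
  have := hg.contract (hg.toBilin u) (hg.toBilin v)
  refine this.trans ?_
  change g (raiseIndex g (g u)) (raiseIndex g (g v)) = _
  rw [hg.raiseIndex_self, hg.raiseIndex_self]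

/-- Serves to turn `∑ ⟨A_j u, A_j v⟩` into a contraction in which the summation over `j` can be
carried out by Parseval in the normal space. -/
lemma sum_contract {ι : Type*} [Fintype ι] (u v : ι → EuclideanSpace ℝ (Fin n)) :
    ∑ j, g (u j) (v j) = metricTrace g fun a b => ∑ j, g (u j) a * g (v j) b := by
  rw [Finset.sum_congr rfl fun j _ => (hg.contract_self (u j) (v j)).symm]
  simp only [metricTrace, smul_eq_mul, Finset.mul_sum]
  rw [Finset.sum_comm]
  exact Finset.sum_congr rfl fun a _ => Finset.sum_comm

lemma metricTrace_self : metricTrace g g = n := by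
  have h := hg.opTrace_eq id
  simp only [id] at h
  have h2 : opTrace (id : EuclideanSpace ℝ (Fin n) → _) = n := by
    simp [opTrace, stdVec_apply]
  rw [metricTrace, ← h2, h]
  rfl

end IsInnerProduct

section Trace

variable {F : Type*} [AddCommGroup F] [Module ℝ F]
  (g : EuclideanSpace ℝ (Fin n) → EuclideanSpace ℝ (Fin n) → ℝ)

lemma metricTrace_add (β γ : EuclideanSpace ℝ (Fin n) → EuclideanSpace ℝ (Fin n) → F) :
    metricTrace g (fun u v => β u v + γ u v) = metricTrace g β + metricTrace g γ := by
  simp only [metricTrace, smul_add, Finset.sum_add_distrib]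

lemma metricTrace_sub (β γ : EuclideanSpace ℝ (Fin n) → EuclideanSpace ℝ (Fin n) → F) :
    metricTrace g (fun u v => β u v - γ u v) = metricTrace g β - metricTrace g γ := by
  simp only [metricTrace, smul_sub, Finset.sum_sub_distrib]

lemma metricTrace_const_mul (c : ℝ) (β : EuclideanSpace ℝ (Fin n) → EuclideanSpace ℝ (Fin n) → ℝ) :
    metricTrace g (fun u v => c * β u v) = c * metricTrace g β := by
  simp only [metricTrace, smul_eq_mul, Finset.mul_sum]
  refine Finset.sum_congr rfl fun a _ => Finset.sum_congr rfl fun b _ => ?_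
  ring

end Trace

end InnerProducts

/-! ### Symmetric functions of the eigenvalues of a positive self-adjoint operator. -/

section Diagonalization

/-- For an operator `W` that is self-adjoint and positive definite for some inner product, the
quotient `σ_{n-1}(W) / det W` is the trace of `W⁻¹`. -/
lemma esymm_div_det_eq_trace {V : Type*} [AddCommGroup V] [Module ℝ V] [FiniteDimensional ℝ V]
    {g : V → V → ℝ} (hg : IsInnerProduct g) (W W' : Module.End ℝ V)
    (hW : ∀ u v, g (W u) v = g u (W v)) (hpos : ∀ u, u ≠ 0 → 0 < g (W u) u)
    (hinv : ∀ u, W (W' u) = u) {n : ℕ} (hn : 1 ≤ n) (hV : Module.finrank ℝ V = n) :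
    (LinearMap.charpoly W).roots.esymm (n - 1) / LinearMap.det W = LinearMap.trace ℝ V W' := by
  let core : InnerProductSpace.Core ℝ V :=
    { inner := g
      conj_inner_symm := fun u v => by simp [hg.symm u v]
      re_inner_nonneg := fun u => by simpa using hg.nonneg u
      add_left := hg.add_left
      smul_left := fun u v c => by simpa using hg.smul_left c u v
      definite := fun u h => hg.self_eq_zero h }
  let _ : NormedAddCommGroup V := core.toNormedAddCommGroup
  let _ : InnerProductSpace ℝ V := InnerProductSpace.ofCore core.toCore
  have hsym : LinearMap.IsSymmetric W := fun u v => hW u v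
  let b := hsym.eigenvectorBasis hV
  let ev := hsym.eigenvalues hV
  have hWb : ∀ i, W (b i) = ev i • b i := fun i => hsym.apply_eigenvectorBasis hV i
  have hb0 : ∀ i, b i ≠ 0 := fun i => b.toBasis.ne_zero i |> fun h => by simpa using h
  have hev : ∀ i, ev i ≠ 0 := by
    intro i h0
    have := hpos (b i) (hb0 i)
    rw [hWb, h0, zero_smul, hg.zero_left] at this
    exact lt_irrefl _ this
  have hinj : Function.Injective W := by
    intro u v huv
    by_contra hne
    have := hpos (u - v) (sub_ne_zero.2 hne)
    rw [map_sub, huv, sub_self, hg.zero_left] at this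
    exact lt_irrefl _ this
  have hW'b : ∀ i, W' (b i) = (ev i)⁻¹ • b i := by
    intro i
    apply hinj
    rw [hinv, map_smul, hWb, smul_smul, inv_mul_cancel₀ (hev i), one_smul]
  have hmat' : LinearMap.toMatrix b.toBasis b.toBasis W' = Matrix.diagonal fun i => (ev i)⁻¹ := by
    ext i j
    rw [LinearMap.toMatrix_apply, OrthonormalBasis.coe_toBasis, hW'b, map_smul,
      ← OrthonormalBasis.coe_toBasis, Module.Basis.repr_self, Matrix.diagonal_apply]
    by_cases h : i = j
    · subst h; simp
    · simp [h]
  have htr : LinearMap.trace ℝ V W' = ∑ i, (ev i)⁻¹ := by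
    rw [LinearMap.trace_eq_matrix_trace ℝ b.toBasis, hmat', Matrix.trace_diagonal]
  have hdet : LinearMap.det W = ∏ i, ev i := hsym.det_eq_prod_eigenvalues hV
  have hchar : (LinearMap.charpoly W).roots = Finset.univ.val.map ev :=
    hsym.roots_charpoly_eq_eigenvalues hV
  rw [hchar, hdet, htr, Finset.esymm_map_val, Finset.sum_div]
  symm
  -- Each set of `n - 1` indices omits exactly one index `i`; the product of the other eigenvalues
  -- divided by the determinant is `(ev i)⁻¹`.
  refine Finset.sum_nbij (fun i => Finset.univ.erase i) ?_ ?_ ?_ ?_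
  · intro i _
    simp [Finset.mem_powersetCard, Finset.card_erase_of_mem]
  · intro i _ j _ hij
    by_contra hne
    have : i ∈ Finset.univ.erase j := by simp [hne]
    rw [← show Finset.univ.erase i = Finset.univ.erase j from hij] at this
    simp at this
  · intro t ht
    obtain ⟨-, hc⟩ := Finset.mem_powersetCard.1 ht
    have : (tᶜ).card = 1 := by
      rw [Finset.card_compl, hc, Fintype.card_fin]; omega
    obtain ⟨i, hi⟩ := Finset.card_eq_one.1 this
    refine ⟨i, by simp, ?_⟩
    change Finset.univ.erase i = t
    rw [← compl_compl t, hi]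
    ext j; simp
  · intro i _
    rw [← Finset.mul_prod_erase _ _ (Finset.mem_univ i)]
    have := hev i
    have h2 : ∏ j ∈ Finset.univ.erase i, ev j ≠ 0 := Finset.prod_ne_zero_iff.2 fun j _ => hev j
    field_simp

end Diagonalization

/-! ### The ambient bilinear form and its positivity on space forms. -/

section AmbientForm

variable {N : ℕ} (k : ℝ)

lemma ambForm_comm (z w : Amb N) : ambForm k z w = ambForm k w z := by
  simp only [ambForm, real_inner_comm, mul_comm]

lemma ambForm_add_right (z w w' : Amb N) : ambForm k z (w + w') = ambForm k z w + ambForm k z w' := by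
  rw [ambForm_comm, ambForm_add_left, ambForm_comm, ambForm_comm k w']

lemma ambForm_smul_right (c : ℝ) (z w : Amb N) : ambForm k z (c • w) = c * ambForm k z w := by
  rw [ambForm_comm, ambForm_smul_left, ambForm_comm]

/-- The ambient form as a continuous bilinear map. -/
def ambL : Amb N →L[ℝ] Amb N →L[ℝ] ℝ :=
  (LinearMap.mk₂ ℝ (ambForm k) (ambForm_add_left k) (ambForm_smul_left k) (ambForm_add_right k)
    (ambForm_smul_right k)).toContinuousBilinearMap

lemma ambL_apply (z w : Amb N) : ambL k z w = ambForm k z w := rfl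

lemma ambForm_sub_left (z z' w : Amb N) :
    ambForm k (z - z') w = ambForm k z w - ambForm k z' w := by simp [← ambL_apply]
lemma ambForm_sub_right (z w w' : Amb N) :
    ambForm k z (w - w') = ambForm k z w - ambForm k z w' := by simp [← ambL_apply]
lemma ambForm_sum_left {ι : Type*} (s : Finset ι) (f : ι → Amb N) (w : Amb N) :
    ambForm k (∑ i ∈ s, f i) w = ∑ i ∈ s, ambForm k (f i) w := by simp [← ambL_apply]
lemma ambForm_sum_right {ι : Type*} (s : Finset ι) (f : ι → Amb N) (w : Amb N) :
    ambForm k w (∑ i ∈ s, f i) = ∑ i ∈ s, ambForm k w (f i) := by simp [← ambL_apply]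

variable {k}

lemma IsTangentSpaceForm.add {z v w : Amb N} (hv : IsTangentSpaceForm k z v)
    (hw : IsTangentSpaceForm k z w) : IsTangentSpaceForm k z (v + w) :=
  ⟨fun h => by simp [hv.1 h, hw.1 h], fun h => by rw [ambForm_add_right, hv.2 h, hw.2 h, add_zero]⟩

lemma IsTangentSpaceForm.smul {z v : Amb N} (c : ℝ) (hv : IsTangentSpaceForm k z v) :
    IsTangentSpaceForm k z (c • v) :=
  ⟨fun h => by simp [hv.1 h], fun h => by rw [ambForm_smul_right, hv.2 h, mul_zero]⟩

lemma IsTangentSpaceForm.sub {z v w : Amb N} (hv : IsTangentSpaceForm k z v)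
    (hw : IsTangentSpaceForm k z w) : IsTangentSpaceForm k z (v - w) := by
  simpa [sub_eq_add_neg] using hv.add (hw.smul (-1))

lemma ambForm_self_of_mem {z : Amb N} (hz : z ∈ spaceForm k N) (hk : k ≠ 0) :
    ambForm k z z = 1 / k := hz.2.1 hk

/-- The factor `k` absorbs the flat case, in which tangent vectors need not be orthogonal to the
position vector. -/
lemma k_mul_ambForm_of_tangent {z v : Amb N} (hv : IsTangentSpaceForm k z v) :
    k * ambForm k z v = 0 := by
  by_cases hk : k = 0
  · simp [hk]
  · rw [hv.2 hk, mul_zero]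

/-- The ambient form is positive definite on the tangent spaces of the space form. -/
lemma ambForm_pos_of_tangent {z v : Amb N} (hz : z ∈ spaceForm k N)
    (hv : IsTangentSpaceForm k z v) (hv0 : v ≠ 0) : 0 < ambForm k v v := by
  have h1 : v.1 ≠ 0 → 0 < inner ℝ v.1 v.1 := fun h => real_inner_self_pos.2 h
  have hne : v.1 ≠ 0 ∨ v.2 ≠ 0 := by
    by_contra! h
    exact hv0 (Prod.ext h.1 h.2)
  rcases lt_trichotomy k 0 with hk | hk | hk
  · have hzz := hz.2.1 hk.ne
    have hzv := hv.2 hk.ne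
    have hz2 := hz.2.2 hk
    simp only [ambForm, sign_neg hk, SignType.coe_neg, SignType.coe_one] at hzz hzv ⊢
    have hkk : 1 / k < 0 := one_div_neg.2 hk
    -- Hyperbolic case: `⟨z.1, v.1⟩ = z.2 v.2` and `|z.1|² < z.2²`, so Cauchy-Schwarz gives `z.2²
    -- v.2² < z.2² |v.1|²`, which means that `v` is spacelike.
    have cs := real_inner_mul_inner_self_le z.1 v.1
    have hv1 : v.1 ≠ 0 := by
      intro h
      rw [h, inner_zero_right] at hzv
      have : v.2 = 0 := by
        have : z.2 * v.2 = 0 := by linarith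
        exact (mul_eq_zero.1 this).resolve_left hz2.ne'
      exact hne.elim (fun h' => h' h) (fun h' => h' this)
    have hp := h1 hv1
    have e1 : inner ℝ z.1 v.1 = z.2 * v.2 := by linarith
    rw [e1] at cs
    have e2 : inner ℝ z.1 z.1 < z.2 * z.2 := by linarith
    have : z.2 * v.2 * (z.2 * v.2) < z.2 * z.2 * inner ℝ v.1 v.1 :=
      cs.trans_lt (mul_lt_mul_of_pos_right e2 hp)
    have hzz2 : 0 < z.2 * z.2 := mul_pos hz2 hz2
    by_contra hcon
    nlinarith
  · have : v.2 = 0 := hv.1 hk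
    have hv1 : v.1 ≠ 0 := hne.resolve_right (fun h => h this)
    simpa [ambForm, hk] using h1 hv1
  · simp only [ambForm, sign_pos hk, SignType.coe_one, one_mul]
    rcases hne with h | h
    · have := h1 h
      nlinarith [mul_self_nonneg v.2]
    · have : 0 ≤ inner ℝ v.1 v.1 := real_inner_self_nonneg
      have := mul_self_pos.2 h
      linarith

end AmbientForm

/-! ### Differentiation of the ambient form. -/

section AmbientCalculus

variable {n N : ℕ} {M : Type*} [TopologicalSpace M] [ChartedSpace (EuclideanSpace ℝ (Fin n)) M]
  [IsManifold (𝓡 n) ∞ M] (k : ℝ)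

lemma ContMDiffOn.ambForm {f h : M → Amb N} {U : Set M} {r : ℕ∞ω}
    (hf : ContMDiffOn (𝓡 n) 𝓘(ℝ, Amb N) r f U) (hh : ContMDiffOn (𝓡 n) 𝓘(ℝ, Amb N) r h U) :
    ContMDiffOn (𝓡 n) 𝓘(ℝ, ℝ) r (fun q => _root_.ambForm k (f q) (h q)) U :=
  ContMDiffOn.clm_apply (((ambL k).contDiff.contMDiff).comp_contMDiffOn hf) hh

lemma MDifferentiableAt.ambForm {f h : M → Amb N} {p : M}
    (hf : MDifferentiableAt (𝓡 n) 𝓘(ℝ, Amb N) f p) (hh : MDifferentiableAt (𝓡 n) 𝓘(ℝ, Amb N) h p) :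
    MDifferentiableAt (𝓡 n) 𝓘(ℝ, ℝ) (fun q => _root_.ambForm k (f q) (h q)) p :=
  MDifferentiableAt.clm_apply
    (((ambL k).contDiff (n := 1)).contMDiff.mdifferentiable one_ne_zero _ |>.comp p hf) hh

lemma MDifferentiableAt.comp_extChartAt_symm {F : Type*} [NormedAddCommGroup F] [NormedSpace ℝ F]
    {f : M → F} {p : M} (hf : MDifferentiableAt (𝓡 n) 𝓘(ℝ, F) f p) :
    DifferentiableAt ℝ (f ∘ (extChartAt (𝓡 n) p).symm) (extChartAt (𝓡 n) p p) := by
  have := (mdifferentiableAt_iff _ _).1 hf |>.2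
  rwa [ModelWithCorners.range_eq_univ, differentiableWithinAt_univ] at this

lemma mvfderiv_ambForm {f h : M → Amb N} {p : M}
    (hf : MDifferentiableAt (𝓡 n) 𝓘(ℝ, Amb N) f p) (hh : MDifferentiableAt (𝓡 n) 𝓘(ℝ, Amb N) h p)
    (u : TangentSpace (𝓡 n) p) :
    mvfderiv (𝓡 n) (fun q => ambForm k (f q) (h q)) p u =
      ambForm k (mvfderiv (𝓡 n) f p u) (h p) + ambForm k (f p) (mvfderiv (𝓡 n) h p u) := by
  rw [mvfderiv_eq_fderiv_extChartAt (hf.ambForm k hh), mvfderiv_eq_fderiv_extChartAt hf,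
    mvfderiv_eq_fderiv_extChartAt hh]
  have h1 := (ambL k).fderiv_of_bilinear hf.comp_extChartAt_symm hh.comp_extChartAt_symm
  have h2 := congrArg (fun L : EuclideanSpace ℝ (Fin n) →L[ℝ] ℝ => L u) h1
  refine h2.trans ?_
  simp only [ContinuousLinearMap.precompR_apply, Function.comp_apply, extChartAt_to_inv]
  exact add_comm _ _

end AmbientCalculus

/-! ### Orthonormal bases for a given inner product. -/

section Orthonormal

variable {V : Type*} [AddCommGroup V] [Module ℝ V] [FiniteDimensional ℝ V] {g : V → V → ℝ} {m : ℕ}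

lemma IsInnerProduct.exists_orthonormal (hg : IsInnerProduct g) (hV : Module.finrank ℝ V = m) :
    ∃ e : Fin m → V, ∀ i j, g (e i) (e j) = if i = j then 1 else 0 := by
  let core : InnerProductSpace.Core ℝ V :=
    { inner := g
      conj_inner_symm := fun u v => by simp [hg.symm u v]
      re_inner_nonneg := fun u => by simpa using hg.nonneg u
      add_left := hg.add_left
      smul_left := fun u v c => by simpa using hg.smul_left c u v
      definite := fun u h => hg.self_eq_zero h }
  let _ : NormedAddCommGroup V := core.toNormedAddCommGroup
  let _ : InnerProductSpace ℝ V := InnerProductSpace.ofCore core.toCore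
  let b := (stdOrthonormalBasis ℝ V).reindex (finCongr hV)
  exact ⟨b, fun i j => orthonormal_iff_ite.1 b.orthonormal i j⟩

/-- The expansion of a vector in an orthonormal basis. -/
lemma IsInnerProduct.sum_orthonormal (hg : IsInnerProduct g) (hV : Module.finrank ℝ V = m)
    {e : Fin m → V} (he : ∀ i j, g (e i) (e j) = if i = j then 1 else 0) (v : V) :
    ∑ j, g v (e j) • e j = v := by
  have hli : LinearIndependent ℝ e := by
    rw [Fintype.linearIndependent_iff]
    intro c hc i
    have := congrArg (fun w => g w (e i)) hc
    simpa [hg.sum_left, hg.smul_left, he, hg.zero_left] using this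
  let b := basisOfLinearIndependentOfCardEqFinrank' e hli (by simp [hV])
  have hb : ⇑b = e := coe_basisOfLinearIndependentOfCardEqFinrank' _ _ _
  have hv := b.sum_repr v
  rw [hb] at hv
  have hc : ∀ j, g v (e j) = b.repr v j := by
    intro j
    conv_lhs => rw [← hv]
    simp [hg.sum_left, hg.smul_left, he]
  simp only [hc, hv]

end Orthonormal

/-! ### Tangent and normal spaces of the immersion at a point. -/

section Pointwise

variable {n m : ℕ} {M : Type*} [TopologicalSpace M] [ChartedSpace (EuclideanSpace ℝ (Fin n)) M]
  [IsManifold (𝓡 n) ∞ M] {k : ℝ} {x : M → Amb (n + m)} (hx : IsSpaceFormImmersion k x)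
include hx

namespace IsSpaceFormImmersion

lemma mdifferentiableAt (p : M) : MDifferentiableAt (𝓡 n) 𝓘(ℝ, Amb (n + m)) x p :=
  hx.smooth.mdifferentiable (by simp) p

lemma tangent_mvfderiv (p : M) (u : TangentSpace (𝓡 n) p) :
    IsTangentSpaceForm k (x p) (mvfderiv (𝓡 n) x p u) := by
  constructor
  · intro hk
    -- With parameter `1` the form is Euclidean, and pairing with `(0, 1)` reads off the last
    -- coordinate, which vanishes along `x` when `k = 0`.
    have h1 := mvfderiv_ambForm 1 (mdifferentiableAt_const (c := ((0, 1) : Amb (n + m))))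
      (hx.mdifferentiableAt p) u
    have h2 : (fun q => ambForm 1 ((0, 1) : Amb (n + m)) (x q)) = fun _ => (0 : ℝ) := by
      ext q
      simp [ambForm, (hx.mem q).1 hk]
    rw [h2, mvfderiv_const, mvfderiv_const] at h1
    simpa [ambForm] using h1.symm
  · intro hk
    have h1 := mvfderiv_ambForm k (hx.mdifferentiableAt p) (hx.mdifferentiableAt p) u
    have h2 : (fun q => ambForm k (x q) (x q)) = fun _ => 1 / k := by
      ext q
      exact ambForm_self_of_mem (hx.mem q) hk
    rw [h2, mvfderiv_const, ambForm_comm k _ (x p)] at h1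
    have : (0 : ℝ) = 2 * ambForm k (x p) (mvfderiv (𝓡 n) x p u) := by
      rw [two_mul]
      exact h1
    linarith

lemma isInner (p : M) : IsInnerProduct (firstForm k x p) where
  symm u v := ambForm_comm k _ _
  add_left u u' v := by simp only [firstForm, map_add, ambForm_add_left]
  smul_left c u v := by simp only [firstForm, map_smul, ambForm_smul_left]
  pos u hu := ambForm_pos_of_tangent (hx.mem p) (hx.tangent_mvfderiv p u) fun h =>
    hu (hx.injective_mvfderiv p (h.trans (map_zero _).symm))

/-- Functionals on the tangent space are represented by `raiseIndex`. -/
lemma firstForm_raiseIndex (p : M) (φ : TangentSpace (𝓡 n) p →ₗ[ℝ] ℝ) (v : TangentSpace (𝓡 n) p) :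
    firstForm k x p (raiseIndex (firstForm k x p) φ) v = φ v :=
  (hx.isInner p).raiseIndex_left φ v

lemma firstForm_tangentPart (p : M) (w : Amb (n + m)) (v : TangentSpace (𝓡 n) p) :
    firstForm k x p (tangentPart k x p w) v = ambForm k w (mvfderiv (𝓡 n) x p v) :=
  hx.firstForm_raiseIndex p ((ambL k w).toLinearMap ∘ₗ (mvfderiv (𝓡 n) x p).toLinearMap) v

lemma ambForm_tangentPart (p : M) (w : Amb (n + m)) (v : TangentSpace (𝓡 n) p) :
    ambForm k (mvfderiv (𝓡 n) x p (tangentPart k x p w)) (mvfderiv (𝓡 n) x p v) =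
      ambForm k w (mvfderiv (𝓡 n) x p v) := hx.firstForm_tangentPart p w v

lemma eq_tangentPart {p : M} {w : Amb (n + m)} {u : TangentSpace (𝓡 n) p}
    (h : ∀ v, firstForm k x p u v = ambForm k w (mvfderiv (𝓡 n) x p v)) :
    tangentPart k x p w = u :=
  (hx.isInner p).ext_left fun v => (hx.firstForm_tangentPart p w v).trans (h v).symm

/-- The tangential projection as a linear map. -/
def tangentPartL (p : M) : Amb (n + m) →ₗ[ℝ] TangentSpace (𝓡 n) p where
  toFun := tangentPart k x p
  map_add' w w' := hx.eq_tangentPart fun v => by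
    rw [(hx.isInner p).add_left, hx.firstForm_tangentPart, hx.firstForm_tangentPart,
      ambForm_add_left]
  map_smul' c w := hx.eq_tangentPart fun v => by
    rw [RingHom.id_apply, (hx.isInner p).smul_left, hx.firstForm_tangentPart, ambForm_smul_left]

lemma tangentPart_add (p : M) (w w' : Amb (n + m)) :
    tangentPart k x p (w + w') = tangentPart k x p w + tangentPart k x p w' :=
  (hx.tangentPartL p).map_add w w'
lemma tangentPart_sub (p : M) (w w' : Amb (n + m)) :
    tangentPart k x p (w - w') = tangentPart k x p w - tangentPart k x p w' :=
  (hx.tangentPartL p).map_sub w w'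
lemma tangentPart_neg (p : M) (w : Amb (n + m)) :
    tangentPart k x p (-w) = - tangentPart k x p w := (hx.tangentPartL p).map_neg w
lemma tangentPart_smul (p : M) (c : ℝ) (w : Amb (n + m)) :
    tangentPart k x p (c • w) = c • tangentPart k x p w := (hx.tangentPartL p).map_smul c w

lemma tangentPart_mvfderiv (p : M) (v : TangentSpace (𝓡 n) p) :
    tangentPart k x p (mvfderiv (𝓡 n) x p v) = v := hx.eq_tangentPart fun _ => rfl

lemma tangentPart_eq_zero {p : M} {w : Amb (n + m)}
    (h : ∀ v, ambForm k w (mvfderiv (𝓡 n) x p v) = 0) : tangentPart k x p w = 0 :=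
  hx.eq_tangentPart fun v => by rw [h, (hx.isInner p).zero_left]

/-- The factor `k` is essential: for `k = 0` the position vector can have a tangential part. Every
multiple of `x` in the structure equations carries this factor. -/
lemma tangentPart_position (p : M) (c : ℝ) : tangentPart k x p ((k * c) • x p) = 0 :=
  hx.tangentPart_eq_zero fun v => by
    rw [ambForm_smul_left, mul_right_comm, k_mul_ambForm_of_tangent (hx.tangent_mvfderiv p v),
      zero_mul]

lemma normalPart_ambForm (p : M) (w : Amb (n + m)) (v : TangentSpace (𝓡 n) p) :
    ambForm k (normalPart k x p w) (mvfderiv (𝓡 n) x p v) = 0 := by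
  rw [normalPart, ambForm_sub_left, hx.ambForm_tangentPart, sub_self]

lemma normalPart_mvfderiv (p : M) (v : TangentSpace (𝓡 n) p) :
    normalPart k x p (mvfderiv (𝓡 n) x p v) = 0 := by
  rw [normalPart, hx.tangentPart_mvfderiv, sub_self]

end IsSpaceFormImmersion

omit hx in
lemma normalPart_sub (k : ℝ) (x : M → Amb (n + m)) (p : M) (w w' : Amb (n + m)) :
    normalPart k x p (w - w') = normalPart k x p w - normalPart k x p w' := by
  have h : w - w' = w + (-1 : ℝ) • w' := by rw [neg_one_smul, sub_eq_add_neg]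
  rw [h, normalPart_add, normalPart_smul, neg_one_smul, sub_eq_add_neg]

omit hx in
lemma mvfderiv_tangentPart_add_normalPart (k : ℝ) (x : M → Amb (n + m)) (p : M)
    (w : Amb (n + m)) :
    mvfderiv (𝓡 n) x p (tangentPart k x p w) + normalPart k x p w = w := by
  rw [normalPart, add_sub_cancel]

omit hx in
/-- The conormal functionals, whose common kernel is the normal space. -/
def conormal (k : ℝ) (x : M → Amb (n + m)) (p : M) : Amb (n + m) →ₗ[ℝ] ℝ × (TangentSpace (𝓡 n) p →ₗ[ℝ] ℝ) :=
  LinearMap.prod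
    (if k = 0 then LinearMap.snd ℝ _ _ else (ambL k (x p)).toLinearMap)
    (LinearMap.mk₂ ℝ (fun w (u : TangentSpace (𝓡 n) p) => ambForm k w (mvfderiv (𝓡 n) x p u))
      (fun _ _ _ => ambForm_add_left k _ _ _) (fun _ _ _ => ambForm_smul_left k _ _ _)
      (fun _ _ _ => by rw [map_add, ambForm_add_right])
      (fun _ _ _ => by rw [map_smul, ambForm_smul_right, smul_eq_mul]))

namespace IsSpaceFormImmersion

lemma isNormalAt_normalPart {p : M} {w : Amb (n + m)} (hw : IsTangentSpaceForm k (x p) w) :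
    IsNormalAt k x p (normalPart k x p w) :=
  ⟨hw.sub (hx.tangent_mvfderiv p _), hx.normalPart_ambForm p w⟩

lemma tangentPart_of_normal {p : M} {η : Amb (n + m)} (hη : IsNormalAt k x p η) :
    tangentPart k x p η = 0 := hx.tangentPart_eq_zero hη.2

lemma normalPart_of_normal {p : M} {η : Amb (n + m)} (hη : IsNormalAt k x p η) :
    normalPart k x p η = η := by
  rw [normalPart, hx.tangentPart_of_normal hη, map_zero, sub_zero]

lemma mem_ker_conormal {p : M} {η : Amb (n + m)} :
    η ∈ LinearMap.ker (conormal k x p) ↔ IsNormalAt k x p η := by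
  rw [LinearMap.mem_ker, conormal, LinearMap.prod_apply, Function.prod_apply, Prod.mk_eq_zero,
    IsNormalAt, IsTangentSpaceForm, LinearMap.ext_iff]
  by_cases hk : k = 0
  · simp [hk]
  · simp [hk, ambL_apply]

/-- Independence of the `n + 1` conditions defining the normal space; rank-nullity in dimension `n +
m + 1` then leaves dimension `m`. -/
lemma conormal_surjective (p : M) : Function.Surjective (conormal k x p) := by
  rintro ⟨c, φ⟩
  set u : TangentSpace (𝓡 n) p := raiseIndex (firstForm k x p) φ
  have hu : ∀ v, ambForm k (mvfderiv (𝓡 n) x p u) (mvfderiv (𝓡 n) x p v) = φ v :=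
    hx.firstForm_raiseIndex p φ
  have ht := hx.tangent_mvfderiv p
  by_cases hk : k = 0
  · refine ⟨(0, c) + mvfderiv (𝓡 n) x p u, ?_⟩
    refine Prod.ext ?_ (LinearMap.ext fun v => ?_)
    · simp [conormal, hk, (ht u).1 hk]
    · change ambForm k ((0, c) + mvfderiv (𝓡 n) x p u) (mvfderiv (𝓡 n) x p v) = φ v
      rw [ambForm_add_left, hu]
      simp [ambForm, hk]
  -- The coefficient `k * c` compensates `⟨x, x⟩ = 1/k`.
  · refine ⟨(k * c) • x p + mvfderiv (𝓡 n) x p u, ?_⟩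
    refine Prod.ext ?_ (LinearMap.ext fun v => ?_)
    · simp only [conormal, hk, if_false, LinearMap.prod_apply]
      change ambForm k (x p) ((k * c) • x p + mvfderiv (𝓡 n) x p u) = c
      rw [ambForm_add_right, ambForm_smul_right, (ht u).2 hk, ambForm_self_of_mem (hx.mem p) hk]
      field_simp
      simp
    · change ambForm k ((k * c) • x p + mvfderiv (𝓡 n) x p u) (mvfderiv (𝓡 n) x p v) = φ v
      rw [ambForm_add_left, hu, ambForm_smul_left, (ht v).2 hk, mul_zero, zero_add]

lemma finrank_normal (p : M) : Module.finrank ℝ (LinearMap.ker (conormal k x p)) = m := by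
  have h := LinearMap.finrank_range_add_finrank_ker (conormal k x p)
  have h0 : Module.finrank ℝ (TangentSpace (𝓡 n) p) = n :=
    finrank_euclideanSpace_fin
  have : FiniteDimensional ℝ (TangentSpace (𝓡 n) p) :=
    inferInstanceAs (FiniteDimensional ℝ (EuclideanSpace ℝ (Fin n)))
  have h1 : Module.finrank ℝ (TangentSpace (𝓡 n) p →ₗ[ℝ] ℝ) = n := by
    rw [Module.finrank_linearMap, h0, Module.finrank_self, mul_one]
  rw [LinearMap.range_eq_top.2 (hx.conormal_surjective p), finrank_top, Module.finrank_prod, h1,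
    Module.finrank_prod, Module.finrank_self, finrank_euclideanSpace_fin] at h
  omega

lemma isInner_normal (p : M) : IsInnerProduct
    fun η ζ : LinearMap.ker (conormal k x p) => ambForm k (η : Amb (n + m)) ζ where
  symm _ _ := ambForm_comm k _ _
  add_left _ _ _ := ambForm_add_left k _ _ _
  smul_left _ _ _ := ambForm_smul_left k _ _ _
  pos u hu := ambForm_pos_of_tangent (hx.mem p) (hx.mem_ker_conormal.1 u.2).1
    fun h => hu (Subtype.ext h)

/-- Guarantees that the choice by `Classical.epsilon` in `obata` is an orthonormal basis. -/
lemma exists_normalBasis (p : M) : ∃ e, IsNormalBasisAt k x p e := by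
  obtain ⟨e, he⟩ := (hx.isInner_normal p).exists_orthonormal (hx.finrank_normal p)
  exact ⟨fun j => e j, fun j => hx.mem_ker_conormal.1 (e j).2, he⟩

/-- The expansion of a normal vector in an orthonormal basis of the normal space. -/
lemma sum_normalBasis {p : M} {e : Fin m → Amb (n + m)} (he : IsNormalBasisAt k x p e)
    {η : Amb (n + m)} (hη : IsNormalAt k x p η) : ∑ j, ambForm k η (e j) • e j = η := by
  have h := (hx.isInner_normal p).sum_orthonormal (hx.finrank_normal p)
    (e := fun j => ⟨e j, hx.mem_ker_conormal.2 (he.1 j)⟩) he.2 ⟨η, hx.mem_ker_conormal.2 hη⟩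
  simpa using congrArg Subtype.val h

lemma parseval {p : M} {e : Fin m → Amb (n + m)} (he : IsNormalBasisAt k x p e)
    {η : Amb (n + m)} (hη : IsNormalAt k x p η) (ζ : Amb (n + m)) :
    ∑ j, ambForm k η (e j) * ambForm k ζ (e j) = ambForm k η ζ := by
  conv_rhs => rw [← hx.sum_normalBasis he hη, ambForm_sum_left]
  simp only [ambForm_smul_left, ambForm_comm k ζ]

end IsSpaceFormImmersion

end Pointwise

/-! ### The induced connection, the second fundamental form and the shape operators. -/

section Immersion

variable {n m : ℕ} {M : Type*} [TopologicalSpace M] [ChartedSpace (EuclideanSpace ℝ (Fin n)) M]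
  [IsManifold (𝓡 n) ∞ M] {k : ℝ} {x : M → Amb (n + m)}

/-- The induced connection: the tangential part of the derivative of `dx(Y)`. -/
def inducedConn (k : ℝ) (x : M → Amb (n + m)) (Y : VField n M) (p : M) (u : TangentSpace (𝓡 n) p) :
    TangentSpace (𝓡 n) p :=
  tangentPart k x p (mvfderiv (𝓡 n) (fun q => mvfderiv (𝓡 n) x q (Y q)) p u)

lemma inducedConn_congr {Y Y' : VField n M} {p : M} (h : ∀ᶠ q in 𝓝 p, Y q = Y' q)
    (u : TangentSpace (𝓡 n) p) : inducedConn k x Y p u = inducedConn k x Y' p u := by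
  unfold inducedConn
  rw [mvfderiv_congr (f := fun q => mvfderiv (𝓡 n) x q (Y q))
    (g := fun q => mvfderiv (𝓡 n) x q (Y' q)) (h.mono fun q hq => by simp only [hq])]

variable (hx : IsSpaceFormImmersion k x)
include hx

namespace IsSpaceFormImmersion

lemma smooth_mvfderiv_apply {Y : VField n M} {U : Set M} (hU : IsOpen U) (hY : Y.SmoothOn U) :
    ContMDiffOn (𝓡 n) 𝓘(ℝ, Amb (n + m)) ∞ (fun q => mvfderiv (𝓡 n) x q (Y q)) U :=
  contMDiffOn_mvfderiv_apply hU hx.smooth.contMDiffOn hY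

lemma mdiff_mvfderiv_apply {Y : VField n M} {p : M} (hY : Y.DiffAt p) :
    MDifferentiableAt (𝓡 n) 𝓘(ℝ, Amb (n + m)) (fun q => mvfderiv (𝓡 n) x q (Y q)) p :=
  mdifferentiableAt_mvfderiv_apply isOpen_univ hx.smooth.contMDiffOn (Set.mem_univ p) hY

/-- The inverse Gram matrix of `I` in the frame `stdFrame p`. -/
lemma exists_tangentPart_eq_sum (p : M) : ∃ G : M → Matrix (Fin n) (Fin n) ℝ,
    (∀ a b, ContMDiffOn (𝓡 n) 𝓘(ℝ, ℝ) ∞ (fun q => G q a b) (extDomain n p)) ∧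
    ∀ q ∈ extDomain n p, ∀ w, tangentPart k x q w =
      ∑ a, ∑ b, (G q a b * ambForm k w (mvfderiv (𝓡 n) x q (stdFrame p b q))) • stdFrame p a q := by
  refine ⟨fun q => (Matrix.of fun a b => firstForm k x q (stdFrame p a q) (stdFrame p b q))⁻¹,
    ?_, ?_⟩
  · refine contMDiffOn_inv_apply (fun a b => ?_) fun q hq => ?_
    · exact ContMDiffOn.ambForm k
        (hx.smooth_mvfderiv_apply (isOpen_extDomain p) (smoothOn_stdFrame p a))
        (hx.smooth_mvfderiv_apply (isOpen_extDomain p) (smoothOn_stdFrame p b))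
    · have := (hx.isInner q).det_gram_ne_zero (frameBasis hq)
      simpa only [frameBasis_apply] using this
  · intro q hq w
    refine hx.eq_tangentPart fun v => ?_
    have := (hx.isInner q).sum_inv_gram_left (frameBasis hq)
      ((ambL k w).toLinearMap ∘ₗ (mvfderiv (𝓡 n) x q).toLinearMap) v
    simp only [frameBasis_apply] at this
    exact this

/-- The definition of `tangentPart` uses the standard basis of each fibre, which depends on the
preferred chart at that point and need not vary continuously. Smoothness is visible only after
rewriting the projection in a local smooth frame. -/
lemma smoothOn_tangentPart {w : M → Amb (n + m)} {U : Set M} (hU : IsOpen U)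
    (hw : ContMDiffOn (𝓡 n) 𝓘(ℝ, Amb (n + m)) ∞ w U) :
    VField.SmoothOn (fun q => tangentPart k x q (w q)) U := by
  refine VField.SmoothOn.of_locally fun p hp => ?_
  obtain ⟨G, hG, hGw⟩ := hx.exists_tangentPart_eq_sum p
  have hV := hU.inter (isOpen_extDomain (n := n) p)
  refine ⟨U ∩ extDomain n p, hV, ⟨hp, mem_extDomain p⟩, ?_⟩
  refine VField.SmoothOn.congr (VField.SmoothOn.sum (s := Finset.univ) fun a =>
    VField.SmoothOn.sum (s := Finset.univ) fun b => VField.SmoothOn.smul ?_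
      ((smoothOn_stdFrame p a).mono Set.inter_subset_right)) fun q hq => hGw q hq.2 (w q)
  exact ((hG a b).mono Set.inter_subset_right).mul (ContMDiffOn.ambForm k
    (hw.mono Set.inter_subset_left)
    (hx.smooth_mvfderiv_apply hV ((smoothOn_stdFrame p b).mono Set.inter_subset_right)))

lemma diffAt_tangentPart {w : M → Amb (n + m)} {p : M}
    (hw : MDifferentiableAt (𝓡 n) 𝓘(ℝ, Amb (n + m)) w p) :
    VField.DiffAt (fun q => tangentPart k x q (w q)) p := by
  obtain ⟨G, hG, hGw⟩ := hx.exists_tangentPart_eq_sum p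
  have hmem := (isOpen_extDomain (n := n) p).mem_nhds (mem_extDomain p)
  refine VField.DiffAt.congr (VField.DiffAt.sum (s := Finset.univ) fun a =>
    VField.DiffAt.sum (s := Finset.univ) fun b => VField.DiffAt.smul ?_
      ((smoothOn_stdFrame p a).diffAt (isOpen_extDomain p) (mem_extDomain p)))
    (Filter.eventually_of_mem hmem fun q hq => hGw q hq (w q))
  exact (((hG a b).contMDiffAt hmem).mdifferentiableAt (by simp)).mul
    (MDifferentiableAt.ambForm k hw (hx.mdiff_mvfderiv_apply
      ((smoothOn_stdFrame p b).diffAt (isOpen_extDomain p) (mem_extDomain p))))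

/-! ### The induced connection -/

lemma smoothOn_inducedConn {X Y : VField n M} {U : Set M} (hU : IsOpen U) (hX : X.SmoothOn U)
    (hY : Y.SmoothOn U) : VField.SmoothOn (fun q => inducedConn k x Y q (X q)) U :=
  hx.smoothOn_tangentPart hU (contMDiffOn_mvfderiv_apply hU (hx.smooth_mvfderiv_apply hU hY) hX)

lemma inducedConn_add {Y Y' : VField n M} {p : M} (hY : Y.DiffAt p) (hY' : Y'.DiffAt p)
    (u : TangentSpace (𝓡 n) p) :
    inducedConn k x (fun q => Y q + Y' q) p u = inducedConn k x Y p u + inducedConn k x Y' p u := by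
  simp only [inducedConn, map_add]
  rw [mvfderiv_fun_add (hx.mdiff_mvfderiv_apply hY) (hx.mdiff_mvfderiv_apply hY'),
    ← hx.tangentPart_add]
  rfl

lemma inducedConn_smul {f : M → ℝ} {Y : VField n M} {p : M}
    (hf : MDifferentiableAt (𝓡 n) 𝓘(ℝ, ℝ) f p) (hY : Y.DiffAt p) (u : TangentSpace (𝓡 n) p) :
    inducedConn k x (fun q => f q • Y q) p u =
      f p • inducedConn k x Y p u + mvfderiv (𝓡 n) f p u • Y p := by
  simp only [inducedConn, map_smul]
  rw [mvfderiv_fun_smul hf (hx.mdiff_mvfderiv_apply hY), ← hx.tangentPart_smul]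
  conv_rhs => rw [← hx.tangentPart_mvfderiv p (Y p), ← hx.tangentPart_smul, ← hx.tangentPart_add]
  rfl

lemma inducedConn_neg {Y : VField n M} {p : M} (u : TangentSpace (𝓡 n) p) :
    inducedConn k x (fun q => - Y q) p u = - inducedConn k x Y p u := by
  simp only [inducedConn, map_neg]
  rw [mvfderiv_fun_neg, ← hx.tangentPart_neg]
  rfl

lemma inducedConn_sub {Y Y' : VField n M} {p : M} (hY : Y.DiffAt p) (hY' : Y'.DiffAt p)
    (u : TangentSpace (𝓡 n) p) :
    inducedConn k x (fun q => Y q - Y' q) p u = inducedConn k x Y p u - inducedConn k x Y' p u := by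
  simp only [sub_eq_add_neg]
  rw [hx.inducedConn_add hY hY'.neg, hx.inducedConn_neg]

lemma inducedConn_sum {ι : Type*} (s : Finset ι) {Y : ι → VField n M} {p : M}
    (hY : ∀ i, (Y i).DiffAt p) (u : TangentSpace (𝓡 n) p) :
    inducedConn k x (fun q => ∑ i ∈ s, Y i q) p u = ∑ i ∈ s, inducedConn k x (Y i) p u := by
  classical
  induction s using Finset.induction_on with
  | empty =>
    simp only [Finset.sum_empty, inducedConn, map_zero, mvfderiv_const]
    exact (hx.tangentPartL p).map_zero
  | insert i s hi ih =>
    simp only [Finset.sum_insert hi]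
    rw [hx.inducedConn_add (hY i) (VField.DiffAt.sum hY), ih]

lemma inducedConn_add_dir (Y : VField n M) {p : M} (u u' : TangentSpace (𝓡 n) p) :
    inducedConn k x Y p (u + u') = inducedConn k x Y p u + inducedConn k x Y p u' := by
  simp only [inducedConn, map_add, hx.tangentPart_add]

lemma inducedConn_smul_dir (Y : VField n M) {p : M} (c : ℝ) (u : TangentSpace (𝓡 n) p) :
    inducedConn k x Y p (c • u) = c • inducedConn k x Y p u := by
  simp only [inducedConn, map_smul, hx.tangentPart_smul]

/-- The commutator identity applied to `x` itself, whose right side is already tangent. -/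
lemma inducedConn_torsion {X Y : VField n M} {p : M} (hX : X.DiffAt p) (hY : Y.DiffAt p) :
    inducedConn k x Y p (X p) - inducedConn k x X p (Y p) =
      VectorField.mlieBracket (𝓡 n) X Y p := by
  have := mvfderiv_mlieBracket isOpen_univ hx.smooth.contMDiffOn (Set.mem_univ p) hX hY
  rw [inducedConn, inducedConn, ← hx.tangentPart_sub, this, hx.tangentPart_mvfderiv]

lemma inducedConn_metric {Y Z : VField n M} {p : M} (hY : Y.DiffAt p) (hZ : Z.DiffAt p)
    (u : TangentSpace (𝓡 n) p) :
    mvfderiv (𝓡 n) (fun q => firstForm k x q (Y q) (Z q)) p u =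
      firstForm k x p (inducedConn k x Y p u) (Z p) +
        firstForm k x p (Y p) (inducedConn k x Z p u) := by
  rw [(hx.isInner p).symm (Y p), inducedConn, inducedConn, hx.firstForm_tangentPart,
    hx.firstForm_tangentPart]
  have := mvfderiv_ambForm k (hx.mdiff_mvfderiv_apply hY) (hx.mdiff_mvfderiv_apply hZ) u
  rw [ambForm_comm k (mvfderiv (𝓡 n) (fun q => mvfderiv (𝓡 n) x q (Z q)) p u)]
  exact this

/-! ### The second fundamental form -/

lemma tangentPart_ambCov (s : M → Amb (n + m)) (p : M) (u : TangentSpace (𝓡 n) p) :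
    tangentPart k x p (ambCov k x s p u) = tangentPart k x p (mvfderiv (𝓡 n) s p u) := by
  rw [ambCov, hx.tangentPart_add, hx.tangentPart_position, add_zero]

/-- Differentiating `⟨x, s⟩ = 0` gives `⟨x, D_u s⟩ = -⟨dx(u), s⟩`; the correction term of `ambCov`
cancels this because `⟨x, x⟩ = 1/k`. -/
lemma tangent_ambCov {s : M → Amb (n + m)} {p : M}
    (hs : MDifferentiableAt (𝓡 n) 𝓘(ℝ, Amb (n + m)) s p)
    (ht : ∀ᶠ q in 𝓝 p, IsTangentSpaceForm k (x q) (s q)) (u : TangentSpace (𝓡 n) p) :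
    IsTangentSpaceForm k (x p) (ambCov k x s p u) := by
  constructor
  · intro hk
    have h1 := mvfderiv_ambForm 1 (mdifferentiableAt_const (c := ((0, 1) : Amb (n + m)))) hs u
    rw [mvfderiv_congr (g := fun _ => (0 : ℝ)) (ht.mono fun q hq => by simp [ambForm, hq.1 hk]),
      mvfderiv_const, mvfderiv_const] at h1
    have h2 : (mvfderiv (𝓡 n) s p u).2 = 0 := by simpa [ambForm] using h1.symm
    simp [ambCov, hk, h2]
  · intro hk
    have h1 := mvfderiv_ambForm k (hx.mdifferentiableAt p) hs u
    rw [mvfderiv_congr (g := fun _ => (0 : ℝ)) (ht.mono fun q hq => hq.2 hk), mvfderiv_const,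
      zero_apply] at h1
    rw [ambCov, ambForm_add_right, ambForm_smul_right, ambForm_self_of_mem (hx.mem p) hk,
      mul_right_comm, mul_one_div_cancel hk, one_mul, add_comm]
    exact h1.symm

/-- The two sides differ by the normal part of `dx([X,Y])`, since the multiples of `x` are
symmetric. Each side differentiates only one of the fields, so this gives both symmetry and
tensoriality of `II`. -/
lemma normalPart_ambCov_swap {X Y : VField n M} {p : M} (hX : X.DiffAt p) (hY : Y.DiffAt p) :
    normalPart k x p (ambCov k x (fun q => mvfderiv (𝓡 n) x q (Y q)) p (X p)) =
      normalPart k x p (ambCov k x (fun q => mvfderiv (𝓡 n) x q (X q)) p (Y p)) := by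
  have h := mvfderiv_mlieBracket isOpen_univ hx.smooth.contMDiffOn (Set.mem_univ p) hX hY
  rw [← sub_eq_zero, ← normalPart_sub, ambCov, ambCov,
    ambForm_comm k (mvfderiv (𝓡 n) x p (Y p)), add_sub_add_right_eq_sub, h, hx.normalPart_mvfderiv]

lemma secondForm_comm (p : M) (u v : TangentSpace (𝓡 n) p) :
    secondForm k x p u v = secondForm k x p v u := by
  have := hx.normalPart_ambCov_swap (extVec_diffAt u) (extVec_diffAt v)
  rwa [extVec_self, extVec_self] at this

/-- The second fundamental form is tensorial. -/
lemma secondForm_eq {Y : VField n M} {p : M} (hY : Y.DiffAt p) (u : TangentSpace (𝓡 n) p) :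
    normalPart k x p (ambCov k x (fun q => mvfderiv (𝓡 n) x q (Y q)) p u) =
      secondForm k x p u (Y p) := by
  -- After the exchange only the extension of `u` is differentiated, and `Y` enters through its
  -- value at `p`.
  rw [hx.secondForm_comm]
  have := hx.normalPart_ambCov_swap (extVec_diffAt u) hY
  rwa [extVec_self] at this

omit hx in
lemma _root_.secondForm_add_left (p : M) (u u' v : TangentSpace (𝓡 n) p) :
    secondForm k x p (u + u') v = secondForm k x p u v + secondForm k x p u' v := by
  simp only [secondForm, ambCov_add, normalPart_add]

omit hx in
lemma _root_.secondForm_smul_left (p : M) (c : ℝ) (u v : TangentSpace (𝓡 n) p) :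
    secondForm k x p (c • u) v = c • secondForm k x p u v := by
  simp only [secondForm, ambCov_smul, normalPart_smul]

lemma secondForm_add_right (p : M) (u v v' : TangentSpace (𝓡 n) p) :
    secondForm k x p u (v + v') = secondForm k x p u v + secondForm k x p u v' := by
  rw [hx.secondForm_comm, secondForm_add_left, hx.secondForm_comm p v, hx.secondForm_comm p v']

lemma secondForm_smul_right (p : M) (c : ℝ) (u v : TangentSpace (𝓡 n) p) :
    secondForm k x p u (c • v) = c • secondForm k x p u v := by
  rw [hx.secondForm_comm, secondForm_smul_left, hx.secondForm_comm p v]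

lemma isNormalAt_secondForm (p : M) (u v : TangentSpace (𝓡 n) p) :
    IsNormalAt k x p (secondForm k x p u v) :=
  hx.isNormalAt_normalPart (hx.tangent_ambCov (hx.mdiff_mvfderiv_apply (extVec_diffAt v))
    (Filter.Eventually.of_forall fun q => hx.tangent_mvfderiv q _) u)

/-- The Gauss formula. -/
lemma gauss_formula {Y : VField n M} {p : M} (hY : Y.DiffAt p) (u : TangentSpace (𝓡 n) p) :
    mvfderiv (𝓡 n) (fun q => mvfderiv (𝓡 n) x q (Y q)) p u =
      mvfderiv (𝓡 n) x p (inducedConn k x Y p u) + secondForm k x p u (Y p)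
        - (k * firstForm k x p u (Y p)) • x p := by
  have := mvfderiv_tangentPart_add_normalPart k x p
    (ambCov k x (fun q => mvfderiv (𝓡 n) x q (Y q)) p u)
  rw [hx.tangentPart_ambCov, hx.secondForm_eq hY, ambCov] at this
  rw [eq_sub_iff_add_eq]
  exact this.symm

/-! ### Shape operators -/

lemma firstForm_shapeOp (p : M) (η : Amb (n + m)) (u v : TangentSpace (𝓡 n) p) :
    firstForm k x p (shapeOp k x p η u) v = ambForm k (secondForm k x p u v) η :=
  hx.firstForm_raiseIndex p
    { toFun := fun v => ambForm k (secondForm k x p u v) η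
      map_add' := fun v v' => by rw [hx.secondForm_add_right, ambForm_add_left]
      map_smul' := fun c v => by
        rw [hx.secondForm_smul_right, ambForm_smul_left, RingHom.id_apply, smul_eq_mul] } v

lemma shapeOp_symm (p : M) (η : Amb (n + m)) (u v : TangentSpace (𝓡 n) p) :
    firstForm k x p (shapeOp k x p η u) v = firstForm k x p u (shapeOp k x p η v) := by
  rw [hx.firstForm_shapeOp, (hx.isInner p).symm u, hx.firstForm_shapeOp, hx.secondForm_comm]

lemma shapeOp_eq {p : M} {η : Amb (n + m)} {u w : TangentSpace (𝓡 n) p}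
    (h : ∀ v, firstForm k x p w v = ambForm k (secondForm k x p u v) η) :
    shapeOp k x p η u = w :=
  (hx.isInner p).ext_left fun v => (hx.firstForm_shapeOp p η u v).trans (h v).symm

lemma shapeOp_sum {ι : Type*} (s : Finset ι) (p : M) (c : ι → ℝ) (η : ι → Amb (n + m))
    (u : TangentSpace (𝓡 n) p) :
    shapeOp k x p (∑ i ∈ s, c i • η i) u = ∑ i ∈ s, c i • shapeOp k x p (η i) u :=
  hx.shapeOp_eq fun v => by
    simp only [(hx.isInner p).sum_left, (hx.isInner p).smul_left, hx.firstForm_shapeOp,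
      ambForm_sum_right, ambForm_smul_right]

/-- The Weingarten formula. -/
lemma weingarten {ξ : M → Amb (n + m)} {p : M}
    (hξ : MDifferentiableAt (𝓡 n) 𝓘(ℝ, Amb (n + m)) ξ p)
    (hn : ∀ᶠ q in 𝓝 p, IsNormalAt k x q (ξ q)) (u : TangentSpace (𝓡 n) p) :
    tangentPart k x p (mvfderiv (𝓡 n) ξ p u) = - shapeOp k x p (ξ p) u := by
  refine hx.eq_tangentPart fun v => ?_
  -- The relation `⟨ξ, dx(V)⟩ = 0` is differentiated, with `V` an extension of `v`.
  have h1 := mvfderiv_ambForm k hξ (hx.mdiff_mvfderiv_apply (extVec_diffAt v)) u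
  rw [mvfderiv_congr (g := fun _ => (0 : ℝ)) (hn.mono fun q hq => hq.2 _), mvfderiv_const,
    hx.gauss_formula (extVec_diffAt v), extVec_self, zero_apply] at h1
  have hp := hn.self_of_nhds
  rw [ambForm_sub_right, ambForm_add_right, hp.2, ambForm_smul_right, mul_right_comm,
    ambForm_comm k (ξ p) (x p), k_mul_ambForm_of_tangent hp.1] at h1
  rw [(hx.isInner p).neg_left, hx.firstForm_shapeOp, ambForm_comm k (secondForm k x p u v)]
  linarith

/-- The definition of `shapeOp` involves an extension chosen separately at each point. This
expression exhibits its regularity in the point. -/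
lemma shapeOp_eq_neg_tangentPart {ξ : M → Amb (n + m)} {U : Set M} (hU : IsOpen U)
    (hξ : IsNormalFieldOn k x U ξ) {q : M} (hq : q ∈ U) (u : TangentSpace (𝓡 n) q) :
    shapeOp k x q (ξ q) u = - tangentPart k x q (mvfderiv (𝓡 n) ξ q u) := by
  rw [hx.weingarten ((hξ.1.contMDiffAt (hU.mem_nhds hq)).mdifferentiableAt (by simp))
    (Filter.eventually_of_mem (hU.mem_nhds hq) hξ.2), neg_neg]

lemma smoothOn_shapeOp {ξ : M → Amb (n + m)} {U : Set M} (hU : IsOpen U)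
    (hξ : IsNormalFieldOn k x U ξ) {Y : VField n M} (hY : Y.SmoothOn U) :
    VField.SmoothOn (fun q => shapeOp k x q (ξ q) (Y q)) U :=
  (hx.smoothOn_tangentPart hU (contMDiffOn_mvfderiv_apply hU hξ.1 hY)).neg.congr fun _ hq =>
    hx.shapeOp_eq_neg_tangentPart hU hξ hq _

lemma diffAt_shapeOp {ξ : M → Amb (n + m)} {U : Set M} (hU : IsOpen U)
    (hξ : IsNormalFieldOn k x U ξ) {Y : VField n M} {p : M} (hp : p ∈ U) (hY : Y.DiffAt p) :
    VField.DiffAt (fun q => shapeOp k x q (ξ q) (Y q)) p :=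
  (hx.diffAt_tangentPart (mdifferentiableAt_mvfderiv_apply hU hξ.1 hp hY)).neg.congr
    (Filter.eventually_of_mem (hU.mem_nhds hp) fun _ hq =>
      hx.shapeOp_eq_neg_tangentPart hU hξ hq _)

lemma normalCov_eq {ξ : M → Amb (n + m)} {p : M} (hξ : IsNormalAt k x p (ξ p))
    (u : TangentSpace (𝓡 n) p) :
    normalCov k x ξ p u = normalPart k x p (mvfderiv (𝓡 n) ξ p u) := by
  rw [normalCov, ambCov, ambForm_comm, hξ.2, mul_zero, zero_smul, add_zero]

lemma isNormalAt_normalCov {ξ : M → Amb (n + m)} {p : M}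
    (hξ : MDifferentiableAt (𝓡 n) 𝓘(ℝ, Amb (n + m)) ξ p)
    (hn : ∀ᶠ q in 𝓝 p, IsNormalAt k x q (ξ q)) (u : TangentSpace (𝓡 n) p) :
    IsNormalAt k x p (normalCov k x ξ p u) :=
  hx.isNormalAt_normalPart (hx.tangent_ambCov hξ (hn.mono fun _ hq => hq.1) u)

lemma normalCov_eq_add {ξ : M → Amb (n + m)} {U : Set M} (hU : IsOpen U)
    (hξ : IsNormalFieldOn k x U ξ) {q : M} (hq : q ∈ U) (u : TangentSpace (𝓡 n) q) :
    normalCov k x ξ q u =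
      mvfderiv (𝓡 n) ξ q u + mvfderiv (𝓡 n) x q (shapeOp k x q (ξ q) u) := by
  rw [hx.normalCov_eq (hξ.2 q hq), hx.shapeOp_eq_neg_tangentPart hU hξ hq, map_neg,
    ← sub_eq_add_neg, normalPart]

end IsSpaceFormImmersion

end Immersion

/-- Has the shape of the right side of the Gauss formula, which is differentiated once more for the
Gauss equation. -/
lemma mvfderiv_add_sub_smul {n : ℕ} {M : Type*} [TopologicalSpace M]
    [ChartedSpace (EuclideanSpace ℝ (Fin n)) M] {F : Type*} [NormedAddCommGroup F]
    [NormedSpace ℝ F] {f g y : M → F} {c : M → ℝ} {p : M}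
    (hf : MDifferentiableAt (𝓡 n) 𝓘(ℝ, F) f p) (hg : MDifferentiableAt (𝓡 n) 𝓘(ℝ, F) g p)
    (hc : MDifferentiableAt (𝓡 n) 𝓘(ℝ, ℝ) c p) (hy : MDifferentiableAt (𝓡 n) 𝓘(ℝ, F) y p)
    (u : TangentSpace (𝓡 n) p) :
    mvfderiv (𝓡 n) (fun q => f q + g q - c q • y q) p u =
      mvfderiv (𝓡 n) f p u + mvfderiv (𝓡 n) g p u
        - (c p • mvfderiv (𝓡 n) y p u + mvfderiv (𝓡 n) c p u • y p) := by
  have h := mvfderiv_sub (hf.add hg) (hc.smul hy)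
  rw [mvfderiv_add hf hg, mvfderiv_smul hc hy] at h
  exact congrArg (fun L : TangentSpace (𝓡 n) p →L[ℝ] F => L u) h

/-! ### Structure equations of the immersion and positivity of the third fundamental form. -/

section Structure

variable {n m : ℕ} {M : Type*} [TopologicalSpace M] [ChartedSpace (EuclideanSpace ℝ (Fin n)) M]
  [IsManifold (𝓡 n) ∞ M] {k : ℝ} {x : M → Amb (n + m)} (hx : IsSpaceFormImmersion k x)
include hx

namespace IsSpaceFormImmersion

/-! ### The equations of Codazzi and Gauss -/

lemma mdiff_normalCov {ξ : M → Amb (n + m)} {U : Set M} (hU : IsOpen U)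
    (hξ : IsNormalFieldOn k x U ξ) {p : M} (hp : p ∈ U) {Y : VField n M} (hY : Y.DiffAt p) :
    MDifferentiableAt (𝓡 n) 𝓘(ℝ, Amb (n + m)) (fun q => normalCov k x ξ q (Y q)) p :=
  ((mdifferentiableAt_mvfderiv_apply hU hξ.1 hp hY).add
    (hx.mdiff_mvfderiv_apply (hx.diffAt_shapeOp hU hξ hp hY))).congr_of_eventuallyEq
    (Filter.eventually_of_mem (hU.mem_nhds hp) fun _ hq => hx.normalCov_eq_add hU hξ hq _)

lemma isNormalAt_normalCov_of_mem {ξ : M → Amb (n + m)} {U : Set M} (hU : IsOpen U)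
    (hξ : IsNormalFieldOn k x U ξ) {p : M} (hp : p ∈ U) (u : TangentSpace (𝓡 n) p) :
    IsNormalAt k x p (normalCov k x ξ p u) :=
  hx.isNormalAt_normalCov ((hξ.1.contMDiffAt (hU.mem_nhds hp)).mdifferentiableAt (by simp))
    (Filter.eventually_of_mem (hU.mem_nhds hp) hξ.2) u

/-- From `D_Y ξ = ∇^⊥_Y ξ - dx(A_ξ Y)`: the first summand is normal and is treated by the Weingarten
formula, the second by the definition of the induced connection. Antisymmetrization yields Codazzi.
-/
lemma tangentPart_mvfderiv_mvfderiv_normal {ξ : M → Amb (n + m)} {U : Set M} (hU : IsOpen U)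
    (hξ : IsNormalFieldOn k x U ξ) {p : M} (hp : p ∈ U) {Y : VField n M} (hY : Y.DiffAt p)
    (u : TangentSpace (𝓡 n) p) :
    tangentPart k x p (mvfderiv (𝓡 n) (fun q => mvfderiv (𝓡 n) ξ q (Y q)) p u) =
      - shapeOp k x p (normalCov k x ξ p (Y p)) u
        - inducedConn k x (fun q => shapeOp k x q (ξ q) (Y q)) p u := by
  have hmem := hU.mem_nhds hp
  have h1 : (fun q => mvfderiv (𝓡 n) ξ q (Y q)) =ᶠ[𝓝 p] fun q => normalCov k x ξ q (Y q)
      - mvfderiv (𝓡 n) x q (shapeOp k x q (ξ q) (Y q)) :=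
    Filter.eventually_of_mem hmem fun q hq => by
      simp only [hx.normalCov_eq_add hU hξ hq, add_sub_cancel_right]
  have h2 := hx.weingarten (hx.mdiff_normalCov hU hξ hp hY) (Filter.eventually_of_mem hmem
    fun q hq => hx.isNormalAt_normalCov_of_mem hU hξ hq (Y q)) u
  rw [mvfderiv_congr h1, mvfderiv_fun_sub (hx.mdiff_normalCov hU hξ hp hY)
    (hx.mdiff_mvfderiv_apply (hx.diffAt_shapeOp hU hξ hp hY)), inducedConn, ← h2,
    ← hx.tangentPart_sub]
  rfl

/-- The Codazzi equation. -/
lemma codazzi {ξ : M → Amb (n + m)} {U : Set M} (hU : IsOpen U)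
    (hξ : IsNormalFieldOn k x U ξ) {p : M} (hp : p ∈ U) {X Y : VField n M} (hX : X.DiffAt p)
    (hY : Y.DiffAt p) :
    inducedConn k x (fun q => shapeOp k x q (ξ q) (Y q)) p (X p)
        - shapeOp k x p (normalCov k x ξ p (X p)) (Y p)
      - (inducedConn k x (fun q => shapeOp k x q (ξ q) (X q)) p (Y p)
        - shapeOp k x p (normalCov k x ξ p (Y p)) (X p))
      = shapeOp k x p (ξ p) (VectorField.mlieBracket (𝓡 n) X Y p) := by
  have h := mvfderiv_mlieBracket hU hξ.1 hp hX hY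
  have h2 := congrArg (tangentPart k x p) h
  rw [hx.tangentPart_sub, hx.tangentPart_mvfderiv_mvfderiv_normal hU hξ hp hY,
    hx.tangentPart_mvfderiv_mvfderiv_normal hU hξ hp hX] at h2
  rw [hx.shapeOp_eq_neg_tangentPart hU hξ hp, ← h2]
  abel

lemma mdiff_firstForm {Y Z : VField n M} {p : M} (hY : Y.DiffAt p) (hZ : Z.DiffAt p) :
    MDifferentiableAt (𝓡 n) 𝓘(ℝ, ℝ) (fun q => firstForm k x q (Y q) (Z q)) p :=
  MDifferentiableAt.ambForm k (hx.mdiff_mvfderiv_apply hY) (hx.mdiff_mvfderiv_apply hZ)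

/-- The derivative of the Gauss formula. The `II` term gives a shape operator by Weingarten; in the
position term only the derivative of `x` has a tangential part. -/
lemma tangentPart_mvfderiv_mvfderiv_tangent {Y Z : VField n M} {U : Set M} (hU : IsOpen U)
    (hY : Y.SmoothOn U) (hZ : Z.SmoothOn U) {p : M} (hp : p ∈ U) (u : TangentSpace (𝓡 n) p) :
    tangentPart k x p (mvfderiv (𝓡 n) (fun q =>
        mvfderiv (𝓡 n) (fun r => mvfderiv (𝓡 n) x r (Z r)) q (Y q)) p u) =
      inducedConn k x (fun q => inducedConn k x Z q (Y q)) p u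
        - shapeOp k x p (secondForm k x p (Y p) (Z p)) u
        - (k * firstForm k x p (Y p) (Z p)) • u := by
  have hmem := hU.mem_nhds hp
  have hYp := hY.diffAt hU hp
  have hZp := hZ.diffAt hU hp
  have hD : VField.DiffAt (fun q => inducedConn k x Z q (Y q)) p :=
    (hx.smoothOn_inducedConn hU hY hZ).diffAt hU hp
  have hdD := hx.mdiff_mvfderiv_apply hD
  have hkg : MDifferentiableAt (𝓡 n) 𝓘(ℝ, ℝ) (fun q => k * firstForm k x q (Y q) (Z q)) p :=
    mdifferentiableAt_const.mul (hx.mdiff_firstForm hYp hZp)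
  have hkx := hkg.smul (hx.mdifferentiableAt p)
  have h1 : ∀ q ∈ U, mvfderiv (𝓡 n) (fun r => mvfderiv (𝓡 n) x r (Z r)) q (Y q) =
      mvfderiv (𝓡 n) x q (inducedConn k x Z q (Y q)) + secondForm k x q (Y q) (Z q)
        - (k * firstForm k x q (Y q) (Z q)) • x q := fun q hq =>
    hx.gauss_formula (hZ.diffAt hU hq) (Y q)
  -- Since `II` is defined by pointwise extensions, its differentiability is read off from the other
  -- terms of the Gauss formula.
  have hS : MDifferentiableAt (𝓡 n) 𝓘(ℝ, Amb (n + m)) (fun q => secondForm k x q (Y q) (Z q)) p := by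
    have h0 := ((contMDiffOn_mvfderiv_apply hU (hx.smooth_mvfderiv_apply hU hZ) hY).contMDiffAt
      hmem).mdifferentiableAt (by simp)
    refine ((h0.sub hdD).add hkx).congr_of_eventuallyEq (Filter.eventually_of_mem hmem
      fun q hq => ?_)
    change _ = mvfderiv (𝓡 n) (fun r => mvfderiv (𝓡 n) x r (Z r)) q (Y q) - _ +
      (k * firstForm k x q (Y q) (Z q)) • x q
    rw [h1 q hq]
    abel
  have hw := hx.weingarten hS (Filter.Eventually.of_forall
    fun q => hx.isNormalAt_secondForm q (Y q) (Z q)) u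
  rw [mvfderiv_congr (Filter.eventually_of_mem hmem h1)]
  have e1 : mvfderiv (𝓡 n) (fun q => k * firstForm k x q (Y q) (Z q)) p u =
      k * mvfderiv (𝓡 n) (fun q => firstForm k x q (Y q) (Z q)) p u := by
    rw [mvfderiv_fun_mul mdifferentiableAt_const (hx.mdiff_firstForm hYp hZp), mvfderiv_const]
    simp
  rw [mvfderiv_add_sub_smul hdD hS hkg (hx.mdifferentiableAt p), e1, hx.tangentPart_sub, hx.tangentPart_add, hw, hx.tangentPart_add, hx.tangentPart_position,
    hx.tangentPart_smul, hx.tangentPart_mvfderiv, inducedConn]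
  abel

/-- The Gauss equation. -/
lemma gauss_equation {X Y Z : VField n M} {U : Set M} (hU : IsOpen U)
    (hX : X.SmoothOn U) (hY : Y.SmoothOn U) (hZ : Z.SmoothOn U) {p : M} (hp : p ∈ U) :
    inducedConn k x (fun q => inducedConn k x Z q (Y q)) p (X p)
      - inducedConn k x (fun q => inducedConn k x Z q (X q)) p (Y p)
      - inducedConn k x Z p (VectorField.mlieBracket (𝓡 n) X Y p) =
    shapeOp k x p (secondForm k x p (Y p) (Z p)) (X p)
      - shapeOp k x p (secondForm k x p (X p) (Z p)) (Y p)
      + ((k * firstForm k x p (Y p) (Z p)) • X p - (k * firstForm k x p (X p) (Z p)) • Y p) := by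
  have h := mvfderiv_mlieBracket hU (hx.smooth_mvfderiv_apply hU hZ) hp (hX.diffAt hU hp)
    (hY.diffAt hU hp)
  have h2 := congrArg (tangentPart k x p) h
  rw [hx.tangentPart_sub, hx.tangentPart_mvfderiv_mvfderiv_tangent hU hY hZ hp,
    hx.tangentPart_mvfderiv_mvfderiv_tangent hU hX hZ hp] at h2
  conv_lhs => enter [2]; rw [inducedConn, ← h2]
  abel

/-! ### The Obata operator and the third fundamental form -/

/-- Two Parseval identities, one in the tangent space and one in the normal space. The right side
contains no normal basis, which is why `W` and `III` do not depend on one. -/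
lemma sum_shapeOp_eq_contract {p : M} {e : Fin m → Amb (n + m)} (he : IsNormalBasisAt k x p e)
    (u v : TangentSpace (𝓡 n) p) :
    ∑ j, firstForm k x p (shapeOp k x p (e j) u) (shapeOp k x p (e j) v) =
      metricTrace (firstForm k x p) fun a b =>
        ambForm k (secondForm k x p u a) (secondForm k x p v b) := by
  have key : ∀ a b : TangentSpace (𝓡 n) p,
      ∑ j, firstForm k x p (shapeOp k x p (e j) u) a * firstForm k x p (shapeOp k x p (e j) v) b =
        ambForm k (secondForm k x p u a) (secondForm k x p v b) := fun a b => by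
    simp only [hx.firstForm_shapeOp]
    exact hx.parseval he (hx.isNormalAt_secondForm p u a) _
  refine ((hx.isInner p).sum_contract (fun j => shapeOp k x p (e j) u)
    (fun j => shapeOp k x p (e j) v)).trans ?_
  exact congrArg (metricTrace (firstForm k x p)) (funext fun a => funext fun b => key a b)

lemma firstForm_sum_sq (p : M) (e : Fin m → Amb (n + m)) (u v : TangentSpace (𝓡 n) p) :
    firstForm k x p ((∑ j, shapeOp k x p (e j) ^ 2) u) v =
      ∑ j, firstForm k x p (shapeOp k x p (e j) u) (shapeOp k x p (e j) v) := by
  rw [LinearMap.sum_apply, (hx.isInner p).sum_left]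
  refine Finset.sum_congr rfl fun j _ => ?_
  rw [pow_two, Module.End.mul_apply, hx.shapeOp_symm]

lemma thirdForm_eq_metricTrace (p : M) (u v : TangentSpace (𝓡 n) p) :
    thirdForm k x p u v = metricTrace (firstForm k x p) fun a b =>
        ambForm k (secondForm k x p u a) (secondForm k x p v b) := by
  rw [thirdForm, obata, hx.firstForm_sum_sq,
    hx.sum_shapeOp_eq_contract (Classical.epsilon_spec (hx.exists_normalBasis p))]

lemma thirdForm_eq_sum {p : M} {e : Fin m → Amb (n + m)} (he : IsNormalBasisAt k x p e)
    (u v : TangentSpace (𝓡 n) p) :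
    thirdForm k x p u v =
      ∑ j, firstForm k x p (shapeOp k x p (e j) u) (shapeOp k x p (e j) v) := by
  rw [hx.thirdForm_eq_metricTrace, hx.sum_shapeOp_eq_contract he]

lemma obata_eq_sum {p : M} {e : Fin m → Amb (n + m)} (he : IsNormalBasisAt k x p e) :
    obata k x p = ∑ j, shapeOp k x p (e j) ^ 2 := by
  refine LinearMap.ext fun u => (hx.isInner p).ext_left fun v => ?_
  rw [hx.firstForm_sum_sq, ← hx.thirdForm_eq_sum he, thirdForm]

/-- `III(u, u) = ∑ |A_j u|²` vanishes only if all `A_j u` do, which means `II(u, ·) = 0`, and this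
is excluded by zero relative nullity. -/
lemma isInner_third {p : M} (hν : relativeNullity k x p = 0) :
    IsInnerProduct (thirdForm k x p) := by
  obtain ⟨e, he⟩ := hx.exists_normalBasis p
  refine ⟨fun u v => ?_, fun u u' v => ?_, fun c u v => ?_, fun u hu => ?_⟩
  · simp only [hx.thirdForm_eq_sum he, (hx.isInner p).symm]
  · simp only [thirdForm, map_add, (hx.isInner p).add_left]
  · simp only [thirdForm, map_smul, (hx.isInner p).smul_left]
  · rw [hx.thirdForm_eq_sum he]
    refine lt_of_le_of_ne (Finset.sum_nonneg fun j _ => (hx.isInner p).nonneg _) fun h => hu ?_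
    have h0 := (Finset.sum_eq_zero_iff_of_nonneg
      (fun j _ => (hx.isInner p).nonneg _)).1 h.symm
    have h1 : ∀ v, secondForm k x p u v = 0 := fun v => by
      rw [← hx.sum_normalBasis he (hx.isNormalAt_secondForm p u v)]
      refine Finset.sum_eq_zero fun j hj => ?_
      rw [← hx.firstForm_shapeOp, (hx.isInner p).self_eq_zero (h0 j hj), (hx.isInner p).zero_left,
        zero_smul]
    have : FiniteDimensional ℝ (TangentSpace (𝓡 n) p) :=
      inferInstanceAs (FiniteDimensional ℝ (EuclideanSpace ℝ (Fin n)))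
    have h2 := Submodule.finrank_eq_zero.1 hν
    have h3 : u ∈ Submodule.span ℝ {u : TangentSpace (𝓡 n) p |
      ∀ v : TangentSpace (𝓡 n) p, secondForm k x p u v = 0} := Submodule.subset_span h1
    rwa [h2, Submodule.mem_bot] at h3

lemma isUnit_obata {p : M} (hν : relativeNullity k x p = 0) : IsUnit (obata k x p) := by
  have : FiniteDimensional ℝ (TangentSpace (𝓡 n) p) :=
    inferInstanceAs (FiniteDimensional ℝ (EuclideanSpace ℝ (Fin n)))
  rw [LinearMap.isUnit_iff_ker_eq_bot, LinearMap.ker_eq_bot']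
  intro u hu
  apply (hx.isInner_third hν).self_eq_zero
  rw [thirdForm, hu, (hx.isInner p).zero_left]

/-- Removes `W⁻¹` from pairings with `III`; with self-adjointness of the `A_j` it shows that `s ↦
W⁻¹ ∑ A_j s_j` is adjoint to `v ↦ (A_j v)_j`. -/
lemma thirdForm_inverse {p : M} (hν : relativeNullity k x p = 0) (u v : TangentSpace (𝓡 n) p) :
    thirdForm k x p (Ring.inverse (obata k x p) u) v = firstForm k x p u v := by
  rw [thirdForm, ← Module.End.mul_apply, Ring.mul_inverse_cancel _ (hx.isUnit_obata hν),
    Module.End.one_apply]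

end IsSpaceFormImmersion

end Structure

/-! ### Normal frames and their connection forms. -/

section NormalFrames

variable {n m : ℕ} {M : Type*} [TopologicalSpace M] [ChartedSpace (EuclideanSpace ℝ (Fin n)) M]
  [IsManifold (𝓡 n) ∞ M] {k : ℝ} {x : M → Amb (n + m)}

/-! ### Local orthonormal frames of the normal bundle -/

lemma IsNormalAt.smul {p : M} {η : Amb (n + m)} (c : ℝ) (hη : IsNormalAt k x p η) :
    IsNormalAt k x p (c • η) :=
  ⟨hη.1.smul c, fun u => by rw [ambForm_smul_left, hη.2, mul_zero]⟩

lemma IsNormalAt.sub {p : M} {η ζ : Amb (n + m)} (hη : IsNormalAt k x p η)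
    (hζ : IsNormalAt k x p ζ) : IsNormalAt k x p (η - ζ) :=
  ⟨hη.1.sub hζ.1, fun u => by rw [ambForm_sub_left, hη.2, hζ.2, sub_zero]⟩

lemma IsNormalFieldOn.mono {ξ : M → Amb (n + m)} {U V : Set M} (hξ : IsNormalFieldOn k x U ξ)
    (h : V ⊆ U) : IsNormalFieldOn k x V ξ :=
  ⟨hξ.1.mono h, fun q hq => hξ.2 q (h hq)⟩

lemma IsNormalFieldOn.smul {ξ : M → Amb (n + m)} {U : Set M} {c : M → ℝ}
    (hc : ContMDiffOn (𝓡 n) 𝓘(ℝ, ℝ) ∞ c U) (hξ : IsNormalFieldOn k x U ξ) :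
    IsNormalFieldOn k x U fun q => c q • ξ q :=
  ⟨hc.smul hξ.1, fun q hq => (hξ.2 q hq).smul _⟩

lemma IsNormalFieldOn.sub {ξ ζ : M → Amb (n + m)} {U : Set M}
    (hξ : IsNormalFieldOn k x U ξ) (hζ : IsNormalFieldOn k x U ζ) :
    IsNormalFieldOn k x U fun q => ξ q - ζ q :=
  ⟨hξ.1.sub hζ.1, fun q hq => (hξ.2 q hq).sub (hζ.2 q hq)⟩

/-- Gram-Schmidt orthonormalization of a family of normal fields that is orthonormal at a point. -/
lemma exists_orthonormal_initial {p : M} {V : Set M} (hV : IsOpen V) (hp : p ∈ V)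
    {f : Fin m → M → Amb (n + m)} (hf : ∀ j, IsNormalFieldOn k x V (f j))
    (h1 : ∀ i j, ambForm k (f i p) (f j p) = if i = j then 1 else 0) (r : ℕ) (hr : r ≤ m) :
    ∃ (V' : Set M) (f' : Fin m → M → Amb (n + m)), IsOpen V' ∧ p ∈ V' ∧ V' ⊆ V ∧
      (∀ j, IsNormalFieldOn k x V' (f' j)) ∧
      (∀ i j, ambForm k (f' i p) (f' j p) = if i = j then 1 else 0) ∧
      ∀ q ∈ V', ∀ i j : Fin m, (i : ℕ) < r → ambForm k (f' i q) (f' j q) = if i = j then 1 else 0 := by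
  induction r with
  | zero => exact ⟨V, f, hV, hp, le_rfl, hf, h1, fun q _ i j h => absurd h (Nat.not_lt_zero _)⟩
  | succ r ih =>
    obtain ⟨V', f', hV', hp', hsub, hf', h1', hq'⟩ := ih (Nat.le_of_succ_le hr)
    set a : Fin m := ⟨r, hr⟩ with ha
    set ρ : M → ℝ := fun q => ambForm k (f' a q) (f' a q) with hρ
    have hρs : ContMDiffOn (𝓡 n) 𝓘(ℝ, ℝ) ∞ ρ V' := ContMDiffOn.ambForm k (hf' a).1 (hf' a).1
    have hρp : ρ p = 1 := by simp [hρ, h1']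
    -- Field number `r` has unit length at `p`, so it can be normalized on a neighbourhood of `p`.
    set V'' : Set M := V' ∩ ρ ⁻¹' Set.Ioi 0 with hV''
    have hopen : IsOpen V'' := hρs.continuousOn.isOpen_inter_preimage hV' isOpen_Ioi
    have hsub' : V'' ⊆ V' := Set.inter_subset_left
    set c : M → ℝ := fun q => (Real.sqrt (ρ q))⁻¹ with hc
    have hcs : ContMDiffOn (𝓡 n) 𝓘(ℝ, ℝ) ∞ c V'' := fun q hq => by
      have h0 : ContDiffAt ℝ ∞ (fun t : ℝ => (Real.sqrt t)⁻¹) (ρ q) :=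
        (Real.contDiffAt_sqrt (ne_of_gt hq.2)).inv (Real.sqrt_ne_zero'.2 hq.2)
      exact h0.contMDiffAt.comp_contMDiffWithinAt q ((hρs.mono hsub') q hq)
    have hcc : ∀ q ∈ V'', c q * (c q * ρ q) = 1 := fun q hq => by
      have h0 : Real.sqrt (ρ q) ≠ 0 := Real.sqrt_ne_zero'.2 hq.2
      have h2 := Real.mul_self_sqrt (le_of_lt hq.2)
      rw [hc]
      field_simp
      rw [pow_two, h2]
    have hcp : c p = 1 := by simp [hc, hρp]
    set g : M → Amb (n + m) := fun q => c q • f' a q with hg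
    have hgN : IsNormalFieldOn k x V'' g := ((hf' a).mono hsub').smul hcs
    have hgg : ∀ q ∈ V'', ambForm k (g q) (g q) = 1 := fun q hq => by
      rw [hg, ambForm_smul_left, ambForm_smul_right]
      exact hcc q hq
    have hgp : g p = f' a p := by simp [hg, hcp]
    -- Field `r` is normalized and its component is removed from all the others. For indices below
    -- `r` this component is zero, and at `p` the family is unchanged, so the induction hypotheses
    -- persist.
    refine ⟨V'', fun j q => if j = a then g q else f' j q - ambForm k (f' j q) (g q) • g q,
      hopen, ⟨hp', by simp [hρp]⟩, hsub'.trans hsub, fun j => ?_, fun i j => ?_,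
      fun q hq i j hi => ?_⟩
    · by_cases hj : j = a
      · simpa [hj] using hgN
      · simpa [hj] using ((hf' j).mono hsub').sub
          (hgN.smul (ContMDiffOn.ambForm k ((hf' j).mono hsub').1 hgN.1))
    · have h3 : ∀ j, (if j = a then g p else f' j p - ambForm k (f' j p) (g p) • g p) = f' j p := by
        intro j
        split_ifs with hj
        · rw [hgp, hj]
        · rw [hgp, h1', if_neg hj, zero_smul, sub_zero]
      simp only [h3, h1']
    · have hlt : ∀ i : Fin m, (i : ℕ) < r → i ≠ a := fun i hi h => by simp [h, ha] at hi
      have hig : ∀ i : Fin m, (i : ℕ) < r → ambForm k (f' i q) (g q) = 0 := fun i hi => by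
        rw [hg, ambForm_smul_right, hq' q hq.1 i a hi, if_neg (hlt i hi), mul_zero]
      rcases Nat.lt_succ_iff_lt_or_eq.1 hi with hi | hi
      · by_cases hj : j = a
        · simp [hj, hlt i hi, hig i hi]
        · simp [hj, hlt i hi, hig i hi, ambForm_sub_right, ambForm_smul_right, hq' q hq.1 i j hi]
      · have hia : i = a := Fin.ext hi
        by_cases hj : j = a
        · simp [hj, hia, hgg q hq]
        · simp [hj, hia, ambForm_sub_right, ambForm_smul_right, hgg q hq, Ne.symm hj]
          rw [ambForm_comm, sub_self]

variable (hx : IsSpaceFormImmersion k x)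
include hx

namespace IsSpaceFormImmersion

/-- The constant vector `e` is projected first to the tangent space of the space form and then to
the normal space of the immersion; neither projection changes it at `p`. -/
lemma exists_normalFieldOn {p : M} {e : Amb (n + m)} (he : IsNormalAt k x p e) :
    ∃ η : M → Amb (n + m), IsNormalFieldOn k x Set.univ η ∧ η p = e := by
  have hs : ContMDiffOn (𝓡 n) 𝓘(ℝ, Amb (n + m)) ∞ (fun q => e - (k * ambForm k e (x q)) • x q)
      Set.univ :=
    contMDiffOn_const.sub (((contMDiffOn_const (c := k)).mul (ContMDiffOn.ambForm k
      contMDiffOn_const hx.smooth.contMDiffOn)).smul hx.smooth.contMDiffOn)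
  refine ⟨fun q => normalPart k x q (e - (k * ambForm k e (x q)) • x q), ⟨?_, fun q _ => ?_⟩, ?_⟩
  · exact hs.sub (hx.smooth_mvfderiv_apply isOpen_univ (hx.smoothOn_tangentPart isOpen_univ hs))
  · refine hx.isNormalAt_normalPart ⟨fun hk => ?_, fun hk => ?_⟩
    · simp [hk, he.1.1 hk]
    · rw [ambForm_sub_right, ambForm_smul_right, ambForm_self_of_mem (hx.mem q) hk,
        ambForm_comm k e]
      field_simp
      ring
  · have h0 : k * ambForm k e (x p) = 0 := by
      rw [ambForm_comm]
      exact k_mul_ambForm_of_tangent he.1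
    simp only [h0, zero_smul, sub_zero]
    exact hx.normalPart_of_normal he

lemma exists_normalFrame (p : M) : ∃ (V : Set M) (ξ : Fin m → M → Amb (n + m)),
    IsOpen V ∧ p ∈ V ∧ IsNormalFrameOn k x V ξ := by
  obtain ⟨e, he, horth⟩ := hx.exists_normalBasis p
  choose η hη hηp using fun j => hx.exists_normalFieldOn (he j)
  obtain ⟨V, f, hV, hp, -, hf, -, ho⟩ := exists_orthonormal_initial isOpen_univ (Set.mem_univ p) hη
    (fun i j => by rw [hηp, hηp, horth]) m le_rfl
  exact ⟨V, f, hV, hp, hf, fun q hq => ⟨fun j => (hf j).2 q hq, fun i j => ho q hq i j i.2⟩⟩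

end IsSpaceFormImmersion

/-! ### The connection forms of an orthonormal normal frame -/

omit hx in
/-- The connection forms `ω_ij(u) = ⟨∇^⊥_u ξ_j, ξ_i⟩` of a normal frame. -/
def connForm (k : ℝ) (ξ : Fin m → M → Amb (n + m)) (i j : Fin m) (p : M)
    (u : TangentSpace (𝓡 n) p) : ℝ :=
  ambForm k (mvfderiv (𝓡 n) (ξ j) p u) (ξ i p)

variable {U : Set M} (hU : IsOpen U) {ξ : Fin m → M → Amb (n + m)} (hξ : IsNormalFrameOn k x U ξ)

omit hx in
include hU hξ in
lemma mdifferentiableAt_frame {p : M} (hp : p ∈ U) (j : Fin m) :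
    MDifferentiableAt (𝓡 n) 𝓘(ℝ, Amb (n + m)) (ξ j) p :=
  ((hξ.1 j).1.contMDiffAt (hU.mem_nhds hp)).mdifferentiableAt (by simp)

-- Derivative of the constant functions `⟨ξ_j, ξ_i⟩`.
omit hx in
include hU hξ in
lemma connForm_antisymm {p : M} (hp : p ∈ U) (i j : Fin m) (u : TangentSpace (𝓡 n) p) :
    connForm k ξ i j p u = - connForm k ξ j i p u := by
  have h := mvfderiv_ambForm k (mdifferentiableAt_frame hU hξ hp j)
    (mdifferentiableAt_frame hU hξ hp i) u
  have h2 : (fun q => ambForm k (ξ j q) (ξ i q)) =ᶠ[𝓝 p] fun _ => if j = i then (1 : ℝ) else 0 :=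
    Filter.eventually_of_mem (hU.mem_nhds hp) fun q hq => (hξ.2 q hq).2 j i
  rw [mvfderiv_congr h2, mvfderiv_const] at h
  rw [connForm, connForm, ambForm_comm k (mvfderiv (𝓡 n) (ξ i) p u)]
  simp only [zero_apply] at h
  linarith

omit hx in
include hU hξ in
lemma smoothOn_connForm (i j : Fin m) {X : VField n M} (hX : X.SmoothOn U) :
    ContMDiffOn (𝓡 n) 𝓘(ℝ, ℝ) ∞ (fun q => connForm k ξ i j q (X q)) U :=
  ContMDiffOn.ambForm k (contMDiffOn_mvfderiv_apply hU (hξ.1 j).1 hX) (hξ.1 i).1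

include hU hξ in
lemma normalCov_frame {p : M} (hp : p ∈ U) (j : Fin m) (u : TangentSpace (𝓡 n) p) :
    normalCov k x (ξ j) p u = ∑ i, connForm k ξ i j p u • ξ i p := by
  rw [← hx.sum_normalBasis (hξ.2 p hp) (hx.isNormalAt_normalCov_of_mem hU (hξ.1 j) hp u)]
  refine Finset.sum_congr rfl fun i _ => ?_
  rw [hx.normalCov_eq_add hU (hξ.1 j) hp, ambForm_add_left, ambForm_comm k (mvfderiv (𝓡 n) x p _),
    ((hξ.1 i).2 p hp).2, add_zero, connForm]

include hU hξ in
lemma shapeOp_normalCov_frame {p : M} (hp : p ∈ U) (j : Fin m) (u v : TangentSpace (𝓡 n) p) :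
    shapeOp k x p (normalCov k x (ξ j) p u) v =
      ∑ i, connForm k ξ i j p u • shapeOp k x p (ξ i p) v := by
  rw [normalCov_frame hx hU hξ hp, hx.shapeOp_sum]

end NormalFrames

/-! ### The connection on tuples and its projection to the tangent bundle. -/

section FrameConnection

variable {n m : ℕ} {M : Type*} [TopologicalSpace M] [ChartedSpace (EuclideanSpace ℝ (Fin n)) M]
  [IsManifold (𝓡 n) ∞ M] {k : ℝ} {x : M → Amb (n + m)}

lemma mvfderiv_sum_apply {F : Type*} {ι : Type} [NormedAddCommGroup F] [NormedSpace ℝ F] (s : Finset ι)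
    {f : ι → M → F} {p : M} (hf : ∀ i, MDifferentiableAt (𝓡 n) 𝓘(ℝ, F) (f i) p)
    (u : TangentSpace (𝓡 n) p) :
    mvfderiv (𝓡 n) (fun q => ∑ i ∈ s, f i q) p u = ∑ i ∈ s, mvfderiv (𝓡 n) (f i) p u := by
  classical
  induction s using Finset.induction_on with
  | empty => simp [mvfderiv_const]
  | insert i s hi ih =>
    have hs : MDifferentiableAt (𝓡 n) 𝓘(ℝ, F) (fun q => ∑ i ∈ s, f i q) p := by
      have h0 : MDifferentiableAt (𝓡 n) 𝓘(ℝ, F) (∑ i ∈ s, f i) p :=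
        MDifferentiableAt.sum fun i _ => hf i
      rwa [Finset.sum_fn] at h0
    simp only [Finset.sum_insert hi]
    rw [mvfderiv_fun_add (hf i) hs, add_apply, ih]

/-- The pointwise uniqueness of the Levi-Civita connection: two operators that satisfy the torsion
and metric identities at `p` with the same right hand sides agree at `p`. -/
lemma leviCivita_unique_at {p : M} {g : TangentSpace (𝓡 n) p → TangentSpace (𝓡 n) p → ℝ}
    (hg : IsInnerProduct g) {d d' : VField n M → TangentSpace (𝓡 n) p → TangentSpace (𝓡 n) p}
    (htor : ∀ X Y : VField n M, X.DiffAt p → Y.DiffAt p →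
      d Y (X p) - d X (Y p) = d' Y (X p) - d' X (Y p))
    (hmet : ∀ Y Z : VField n M, Y.DiffAt p → Z.DiffAt p → ∀ u,
      g (d Y u) (Z p) + g (Y p) (d Z u) = g (d' Y u) (Z p) + g (Y p) (d' Z u))
    {Y : VField n M} (hY : Y.DiffAt p) (u : TangentSpace (𝓡 n) p) : d Y u = d' Y u := by
  have hext : ∀ v : TangentSpace (𝓡 n) p, extVec v p = v := fun v => extVec_self v
  have hsym : ∀ X Y : VField n M, X.DiffAt p → Y.DiffAt p →
      d Y (X p) - d' Y (X p) = d X (Y p) - d' X (Y p) := fun X Y hX hY => by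
    have := htor X Y hX hY
    rw [sub_eq_sub_iff_add_eq_add] at this ⊢
    rw [add_comm (d X _), this, add_comm]
  -- The difference `s` of the two operators is symmetric by the torsion identity and skew for `g`
  -- by the metric identity.
  set s : TangentSpace (𝓡 n) p → TangentSpace (𝓡 n) p → TangentSpace (𝓡 n) p :=
    fun u v => d (extVec v) u - d' (extVec v) u with hs
  have s_comm : ∀ u v, s u v = s v u := fun u v => by
    have := hsym (extVec u) (extVec v) (extVec_diffAt u) (extVec_diffAt v)
    rwa [hext, hext] at this
  have s_anti : ∀ u v w, g (s u v) w = - g v (s u w) := fun u v w => by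
    have := hmet (extVec v) (extVec w) (extVec_diffAt v) (extVec_diffAt w) u
    rw [hext, hext] at this
    rw [hs, hg.sub_left, hg.sub_right]
    linarith
  -- A form `g(s(u,v), w)` symmetric in `u, v` and skew in `v, w` vanishes: permuting the arguments
  -- cyclically returns it with the opposite sign.
  have s_zero : ∀ u v, s u v = 0 := fun u v => by
    refine hg.ext_left fun w => ?_
    rw [hg.zero_left]
    have h1 := s_anti u v w
    have h2 := s_anti w u v
    have h3 := s_anti v w u
    rw [hg.symm v, s_comm u w] at h1
    rw [hg.symm u, s_comm w v] at h2
    rw [hg.symm w, s_comm v u] at h3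
    linarith
  -- Symmetry moves the derivative from `Y` to the extension of `u`, so `Y` may be replaced by the
  -- extension of `Y p`. No Leibniz rule for `d` and `d'` is required.
  have h1 := hsym (extVec u) Y (extVec_diffAt u) hY
  have h2 := hsym (extVec u) (extVec (Y p)) (extVec_diffAt u) (extVec_diffAt _)
  rw [hext] at h1 h2
  rw [hext] at h2
  have h3 := s_zero u (Y p)
  rw [hs] at h3
  rw [← sub_eq_zero, h1, ← h2]
  exact h3

/-- The shape operators of a normal frame applied to a vector field. -/
def frameOps (k : ℝ) (x : M → Amb (n + m)) (ξ : Fin m → M → Amb (n + m)) (Y : VField n M) :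
    Fin m → VField n M :=
  fun j q => shapeOp k x q (ξ j q) (Y q)

/-- The connection on `m`-tuples of vector fields, i.e. on `Hom(NM, TM)` in a normal frame, that is
induced by `∇` and `∇^⊥`. -/
def tupleConn (k : ℝ) (x : M → Amb (n + m)) (ξ : Fin m → M → Amb (n + m)) (s : Fin m → VField n M)
    (j : Fin m) (p : M) (u : TangentSpace (𝓡 n) p) : TangentSpace (𝓡 n) p :=
  inducedConn k x (s j) p u - ∑ i, connForm k ξ i j p u • s i p

/-- The connection `Y ↦ W⁻¹ ∑_j A_j ∇(A_j Y)`. -/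
def frameConn (k : ℝ) (x : M → Amb (n + m)) (ξ : Fin m → M → Amb (n + m)) (Y : VField n M)
    (p : M) (u : TangentSpace (𝓡 n) p) : TangentSpace (𝓡 n) p :=
  Ring.inverse (obata k x p)
    (∑ j, shapeOp k x p (ξ j p) (tupleConn k x ξ (frameOps k x ξ Y) j p u))

lemma connForm_add_dir (ξ : Fin m → M → Amb (n + m)) (i j : Fin m) {p : M}
    (u v : TangentSpace (𝓡 n) p) :
    connForm k ξ i j p (u + v) = connForm k ξ i j p u + connForm k ξ i j p v := by
  simp only [connForm, map_add, ambForm_add_left]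

lemma connForm_smul_dir (ξ : Fin m → M → Amb (n + m)) (i j : Fin m) {p : M} (c : ℝ)
    (u : TangentSpace (𝓡 n) p) :
    connForm k ξ i j p (c • u) = c * connForm k ξ i j p u := by
  simp only [connForm, map_smul, ambForm_smul_left]

variable (hx : IsSpaceFormImmersion k x)
include hx

lemma tupleConn_add_dir (ξ : Fin m → M → Amb (n + m)) (s : Fin m → VField n M) (j : Fin m) {p : M}
    (u v : TangentSpace (𝓡 n) p) :
    tupleConn k x ξ s j p (u + v) = tupleConn k x ξ s j p u + tupleConn k x ξ s j p v := by
  simp only [tupleConn, hx.inducedConn_add_dir, connForm_add_dir, add_smul, Finset.sum_add_distrib]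
  abel

lemma tupleConn_smul_dir (ξ : Fin m → M → Amb (n + m)) (s : Fin m → VField n M) (j : Fin m) {p : M}
    (c : ℝ) (u : TangentSpace (𝓡 n) p) :
    tupleConn k x ξ s j p (c • u) = c • tupleConn k x ξ s j p u := by
  simp only [tupleConn, hx.inducedConn_smul_dir, connForm_smul_dir, smul_sub, Finset.smul_sum,
    smul_smul]

lemma tupleConn_add (ξ : Fin m → M → Amb (n + m)) {s t : Fin m → VField n M} {p : M}
    (hs : ∀ j, (s j).DiffAt p) (ht : ∀ j, (t j).DiffAt p) (j : Fin m) (u : TangentSpace (𝓡 n) p) :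
    tupleConn k x ξ (fun i q => s i q + t i q) j p u =
      tupleConn k x ξ s j p u + tupleConn k x ξ t j p u := by
  simp only [tupleConn, hx.inducedConn_add (hs j) (ht j), smul_add, Finset.sum_add_distrib]
  abel

lemma tupleConn_smul (ξ : Fin m → M → Amb (n + m)) {f : M → ℝ} {s : Fin m → VField n M} {p : M}
    (hf : MDifferentiableAt (𝓡 n) 𝓘(ℝ, ℝ) f p)
    (hs : ∀ j, (s j).DiffAt p) (j : Fin m) (u : TangentSpace (𝓡 n) p) :
    tupleConn k x ξ (fun i q => f q • s i q) j p u =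
      f p • tupleConn k x ξ s j p u + mvfderiv (𝓡 n) f p u • s j p := by
  simp only [tupleConn, hx.inducedConn_smul hf (hs j), smul_sub, Finset.smul_sum]
  rw [Finset.sum_congr rfl fun i _ => smul_comm (connForm k ξ i j p u) (f p) (s i p)]
  abel

variable {U : Set M} (hU : IsOpen U) {ξ : Fin m → M → Amb (n + m)} (hξ : IsNormalFrameOn k x U ξ)
include hU hξ

/-- Each component contributes the metric property of `∇`; the terms with connection forms cancel
because these are antisymmetric. -/
lemma tupleConn_metric {s t : Fin m → VField n M} {p : M} (hp : p ∈ U)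
    (hs : ∀ j, (s j).DiffAt p) (ht : ∀ j, (t j).DiffAt p) (u : TangentSpace (𝓡 n) p) :
    mvfderiv (𝓡 n) (fun q => ∑ j, firstForm k x q (s j q) (t j q)) p u =
      ∑ j, firstForm k x p (tupleConn k x ξ s j p u) (t j p) +
      ∑ j, firstForm k x p (s j p) (tupleConn k x ξ t j p u) := by
  have hI := hx.isInner p
  rw [mvfderiv_sum_apply _ fun j => hx.mdiff_firstForm (hs j) (ht j)]
  simp only [hx.inducedConn_metric (hs _) (ht _), tupleConn, hI.sub_left, hI.sub_right,
    hI.sum_left, hI.sum_right, hI.smul_left, hI.smul_right, Finset.sum_add_distrib,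
    Finset.sum_sub_distrib]
  have h2 : ∑ j, ∑ i, connForm k ξ i j p u * firstForm k x p (s j p) (t i p) =
      - ∑ j, ∑ i, connForm k ξ i j p u * firstForm k x p (s i p) (t j p) := by
    rw [Finset.sum_comm, ← Finset.sum_neg_distrib]
    refine Finset.sum_congr rfl fun i _ => ?_
    rw [← Finset.sum_neg_distrib]
    refine Finset.sum_congr rfl fun j _ => ?_
    rw [connForm_antisymm hU hξ hp]
    ring
  rw [h2]
  ring

lemma diffAt_frameOps {p : M} (hp : p ∈ U) {Y : VField n M} (hY : Y.DiffAt p) (j : Fin m) :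
    (frameOps k x ξ Y j).DiffAt p := hx.diffAt_shapeOp hU (hξ.1 j) hp hY

lemma smoothOn_frameOps {Y : VField n M} (hY : Y.SmoothOn U) (j : Fin m) :
    (frameOps k x ξ Y j).SmoothOn U := hx.smoothOn_shapeOp hU (hξ.1 j) hY

lemma tupleConn_frameOps {p : M} (hp : p ∈ U) (Y : VField n M) (j : Fin m)
    (u : TangentSpace (𝓡 n) p) :
    tupleConn k x ξ (frameOps k x ξ Y) j p u =
      inducedConn k x (fun q => shapeOp k x q (ξ j q) (Y q)) p u
        - shapeOp k x p (normalCov k x (ξ j) p u) (Y p) := by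
  rw [shapeOp_normalCov_frame hx hU hξ hp]
  rfl

/-- The Codazzi equation in the form in which it is used: the tuple-valued one-form `Y ↦ (A_j Y)_j`
is closed for the covariant exterior derivative. -/
lemma tupleConn_torsion {p : M} (hp : p ∈ U) {X Y : VField n M} (hX : X.DiffAt p)
    (hY : Y.DiffAt p) (j : Fin m) :
    tupleConn k x ξ (frameOps k x ξ Y) j p (X p) - tupleConn k x ξ (frameOps k x ξ X) j p (Y p) =
      shapeOp k x p (ξ j p) (VectorField.mlieBracket (𝓡 n) X Y p) := by
  rw [tupleConn_frameOps hx hU hξ hp, tupleConn_frameOps hx hU hξ hp,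
    hx.codazzi hU (hξ.1 j) hp hX hY]

lemma smoothOn_tupleConn {s : Fin m → VField n M} (hs : ∀ j, (s j).SmoothOn U) {X : VField n M}
    (hX : X.SmoothOn U) (j : Fin m) :
    VField.SmoothOn (fun q => tupleConn k x ξ s j q (X q)) U :=
  (hx.smoothOn_inducedConn hU hX (hs j)).sub
    (VField.SmoothOn.sum (s := Finset.univ) fun i => (hs i).smul (smoothOn_connForm hU hξ i j hX))

variable (hν : ∀ p, relativeNullity k x p = 0)
include hν

omit hU hξ in
lemma thirdForm_inverse_sum (p : M) (η : Fin m → Amb (n + m)) (s : Fin m → TangentSpace (𝓡 n) p)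
    (v : TangentSpace (𝓡 n) p) :
    thirdForm k x p (Ring.inverse (obata k x p) (∑ j, shapeOp k x p (η j) (s j))) v =
      ∑ j, firstForm k x p (s j) (shapeOp k x p (η j) v) := by
  rw [hx.thirdForm_inverse (hν p), (hx.isInner p).sum_left]
  exact Finset.sum_congr rfl fun j _ => hx.shapeOp_symm p _ _ _

-- Characterizes `frameConn` as the orthogonal projection of `tupleConn` to the tuples `(A_j v)_j`.
omit hU hξ in
lemma thirdForm_frameConn (Y : VField n M) (p : M) (u v : TangentSpace (𝓡 n) p) :
    thirdForm k x p (frameConn k x ξ Y p u) v =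
      ∑ j, firstForm k x p (tupleConn k x ξ (frameOps k x ξ Y) j p u) (shapeOp k x p (ξ j p) v) :=
  thirdForm_inverse_sum hx hν p _ _ v

/-- The torsion expression upstairs is `(A_j [X,Y])_j`, which lies in the image and is unaffected by
the projection. -/
lemma frameConn_torsion {p : M} (hp : p ∈ U) {X Y : VField n M} (hX : X.DiffAt p)
    (hY : Y.DiffAt p) :
    frameConn k x ξ Y p (X p) - frameConn k x ξ X p (Y p) =
      VectorField.mlieBracket (𝓡 n) X Y p := by
  refine (hx.isInner_third (hν p)).ext_left fun v => ?_
  rw [(hx.isInner_third (hν p)).sub_left, thirdForm_frameConn hx hν, thirdForm_frameConn hx hν,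
    ← Finset.sum_sub_distrib, hx.thirdForm_eq_sum (hξ.2 p hp)]
  refine Finset.sum_congr rfl fun j _ => ?_
  rw [← (hx.isInner p).sub_left, tupleConn_torsion hx hU hξ hp hX hY]

/-- The projection may be dropped whenever the other factor lies in the image, so the metric
property descends from `tupleConn`. -/
lemma frameConn_metric {p : M} (hp : p ∈ U) {Y Z : VField n M} (hY : Y.DiffAt p)
    (hZ : Z.DiffAt p) (u : TangentSpace (𝓡 n) p) :
    mvfderiv (𝓡 n) (fun q => thirdForm k x q (Y q) (Z q)) p u =
      thirdForm k x p (frameConn k x ξ Y p u) (Z p) +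
        thirdForm k x p (Y p) (frameConn k x ξ Z p u) := by
  have h : (fun q => thirdForm k x q (Y q) (Z q)) =ᶠ[𝓝 p] fun q =>
      ∑ j, firstForm k x q (frameOps k x ξ Y j q) (frameOps k x ξ Z j q) :=
    Filter.eventually_of_mem (hU.mem_nhds hp) fun q hq => hx.thirdForm_eq_sum (hξ.2 q hq) _ _
  rw [mvfderiv_congr h, tupleConn_metric hx hU hξ hp (diffAt_frameOps hx hU hξ hp hY)
    (diffAt_frameOps hx hU hξ hp hZ), thirdForm_frameConn hx hν,
    (hx.isInner_third (hν p)).symm (Y p), thirdForm_frameConn hx hν]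
  refine congrArg _ (Finset.sum_congr rfl fun j _ => (hx.isInner p).symm _ _)

omit hν in
lemma frameConn_add {p : M} (hp : p ∈ U) {Y Z : VField n M} (hY : Y.DiffAt p)
    (hZ : Z.DiffAt p) (u : TangentSpace (𝓡 n) p) :
    frameConn k x ξ (fun q => Y q + Z q) p u = frameConn k x ξ Y p u + frameConn k x ξ Z p u := by
  have h : frameOps k x ξ (fun q => Y q + Z q) = fun j q =>
      frameOps k x ξ Y j q + frameOps k x ξ Z j q := by
    funext j q
    simp only [frameOps, map_add]
  simp only [frameConn, h, tupleConn_add hx ξ (diffAt_frameOps hx hU hξ hp hY)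
    (diffAt_frameOps hx hU hξ hp hZ), map_add, Finset.sum_add_distrib]

lemma frameConn_smul {p : M} (hp : p ∈ U) {f : M → ℝ} {Y : VField n M}
    (hf : MDifferentiableAt (𝓡 n) 𝓘(ℝ, ℝ) f p) (hY : Y.DiffAt p) (u : TangentSpace (𝓡 n) p) :
    frameConn k x ξ (fun q => f q • Y q) p u =
      f p • frameConn k x ξ Y p u + mvfderiv (𝓡 n) f p u • Y p := by
  have h : frameOps k x ξ (fun q => f q • Y q) = fun j q => f q • frameOps k x ξ Y j q := by
    funext j q
    simp only [frameOps, map_smul]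
  -- The derivative of `f` multiplies `∑ A_j² Y = W Y`, and `W⁻¹` turns this into the Leibniz term.
  have hW : ∑ j, shapeOp k x p (ξ j p) (frameOps k x ξ Y j p) = obata k x p (Y p) := by
    rw [hx.obata_eq_sum (hξ.2 p hp), LinearMap.sum_apply]
    exact Finset.sum_congr rfl fun j _ => by rw [pow_two, Module.End.mul_apply]; rfl
  simp only [frameConn, h, tupleConn_smul hx ξ hf (diffAt_frameOps hx hU hξ hp hY),
    map_add, map_smul, Finset.sum_add_distrib, ← Finset.smul_sum, hW]
  rw [← Module.End.mul_apply (Ring.inverse (obata k x p)),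
    Ring.inverse_mul_cancel _ (hx.isUnit_obata (hν p)), Module.End.one_apply]

omit hU hξ hν in
lemma frameConn_add_dir (Y : VField n M) {p : M} (u v : TangentSpace (𝓡 n) p) :
    frameConn k x ξ Y p (u + v) = frameConn k x ξ Y p u + frameConn k x ξ Y p v := by
  simp only [frameConn, tupleConn_add_dir hx, map_add, Finset.sum_add_distrib]

omit hU hξ hν in
lemma frameConn_smul_dir (Y : VField n M) {p : M} (c : ℝ) (u : TangentSpace (𝓡 n) p) :
    frameConn k x ξ Y p (c • u) = c • frameConn k x ξ Y p u := by
  simp only [frameConn, tupleConn_smul_dir hx, map_smul, ← Finset.smul_sum]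

/-- Smoothness of `W⁻¹` is avoided: the `III`-pairings of the vector with a smooth frame do not
contain `W⁻¹`, and the vector is recovered from them by the inverse Gram matrix of `III`. -/
lemma smoothOn_inverse_obata {s : Fin m → VField n M} (hs : ∀ j, (s j).SmoothOn U) :
    VField.SmoothOn (fun q => Ring.inverse (obata k x q) (∑ j, shapeOp k x q (ξ j q) (s j q))) U := by
  refine VField.SmoothOn.of_locally fun p hp => ?_
  have hV := hU.inter (isOpen_extDomain (n := n) p)
  have hl : U ∩ extDomain n p ⊆ U := Set.inter_subset_left
  have hr : U ∩ extDomain n p ⊆ extDomain n p := Set.inter_subset_right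
  refine ⟨U ∩ extDomain n p, hV, ⟨hp, mem_extDomain p⟩, ?_⟩
  have hb : ∀ a, (stdFrame p a).SmoothOn (U ∩ extDomain n p) := fun a =>
    (smoothOn_stdFrame p a).mono hr
  have hAb : ∀ a j, VField.SmoothOn (fun q => shapeOp k x q (ξ j q) (stdFrame p a q))
      (U ∩ extDomain n p) := fun a j => hx.smoothOn_shapeOp hV ((hξ.1 j).mono hl) (hb a)
  have hI : ∀ {Y Z : VField n M}, Y.SmoothOn (U ∩ extDomain n p) → Z.SmoothOn (U ∩ extDomain n p) →
      ContMDiffOn (𝓡 n) 𝓘(ℝ, ℝ) ∞ (fun q => firstForm k x q (Y q) (Z q)) (U ∩ extDomain n p) :=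
    fun hY hZ => ContMDiffOn.ambForm k (hx.smooth_mvfderiv_apply hV hY)
      (hx.smooth_mvfderiv_apply hV hZ)
  have hgram : ∀ a b, ContMDiffOn (𝓡 n) 𝓘(ℝ, ℝ) ∞ (fun q => (Matrix.of fun a b =>
      thirdForm k x q (stdFrame p a q) (stdFrame p b q)) a b) (U ∩ extDomain n p) := fun a b =>
    (contMDiffOn_finsetSum (t := Finset.univ) fun j _ => hI (hAb a j) (hAb b j)).congr
      fun q hq => hx.thirdForm_eq_sum (hξ.2 q hq.1) _ _
  have hinv := contMDiffOn_inv_apply hgram fun q hq => by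
    simpa only [frameBasis_apply] using
      (hx.isInner_third (hν q)).det_gram_ne_zero (frameBasis (n := n) hq.2)
  refine VField.SmoothOn.congr (VField.SmoothOn.sum (s := Finset.univ) fun a =>
    VField.SmoothOn.sum (s := Finset.univ) fun b => VField.SmoothOn.smul ((hinv a b).mul
      (contMDiffOn_finsetSum (t := Finset.univ) fun j _ => hI ((hs j).mono hl) (hAb b j))) (hb a))
    fun q hq => ?_
  refine (hx.isInner_third (hν q)).ext_left fun v => ?_
  have h := (hx.isInner_third (hν q)).sum_inv_gram_left (frameBasis (n := n) hq.2)
    ((hx.isInner_third (hν q)).toBilin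
      (Ring.inverse (obata k x q) (∑ j, shapeOp k x q (ξ j q) (s j q)))) v
  have hφ : ∀ w, (hx.isInner_third (hν q)).toBilin
      (Ring.inverse (obata k x q) (∑ j, shapeOp k x q (ξ j q) (s j q))) w =
      ∑ j, firstForm k x q (s j q) (shapeOp k x q (ξ j q) w) := fun w =>
    thirdForm_inverse_sum hx hν q _ _ w
  rw [hφ v] at h
  simp only [hφ, frameBasis_apply] at h
  rw [thirdForm_inverse_sum hx hν]
  exact h.symm

lemma smoothOn_frameConn {X Y : VField n M} (hX : X.SmoothOn U) (hY : Y.SmoothOn U) :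
    VField.SmoothOn (fun q => frameConn k x ξ Y q (X q)) U :=
  smoothOn_inverse_obata hx hU hξ hν (s := fun j q => tupleConn k x ξ (frameOps k x ξ Y) j q (X q))
    fun j => smoothOn_tupleConn hx hU hξ (smoothOn_frameOps hx hU hξ hY) hX j

end FrameConnection

/-! ### Existence, identification and difference of the two Levi-Civita connections. -/

section LeviCivita

variable {n m : ℕ} {M : Type*} [TopologicalSpace M] [ChartedSpace (EuclideanSpace ℝ (Fin n)) M]
  [IsManifold (𝓡 n) ∞ M] {k : ℝ} {x : M → Amb (n + m)}

/-! ### The Levi-Civita connections -/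

/-- A connection from its pointwise values. -/
def connectionOfPointwise (d : VField n M → ∀ p : M, TangentSpace (𝓡 n) p → TangentSpace (𝓡 n) p)
    (hadd : ∀ Y p u v, d Y p (u + v) = d Y p u + d Y p v)
    (hsmul : ∀ Y p (c : ℝ) u, d Y p (c • u) = c • d Y p u)
    (hfadd : ∀ (Y Z : VField n M) (p : M), Y.DiffAt p → Z.DiffAt p → ∀ u,
      d (fun q => Y q + Z q) p u = d Y p u + d Z p u)
    (hfsmul : ∀ (f : M → ℝ) (Y : VField n M) (p : M), MDifferentiableAt (𝓡 n) 𝓘(ℝ, ℝ) f p →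
      Y.DiffAt p → ∀ u,
      d (fun q => f q • Y q) p u = f p • d Y p u + mvfderiv (𝓡 n) f p u • Y p) :
    Connection n M where
  toFun Y p :=
    haveI : FiniteDimensional ℝ (TangentSpace (𝓡 n) p) :=
      inferInstanceAs (FiniteDimensional ℝ (EuclideanSpace ℝ (Fin n)))
    haveI : T2Space (TangentSpace (𝓡 n) p) :=
      inferInstanceAs (T2Space (EuclideanSpace ℝ (Fin n)))
    LinearMap.toContinuousLinearMap
      { toFun := d Y p, map_add' := hadd Y p, map_smul' := hsmul Y p }
  isCovariantDerivativeOnUniv :=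
    { add := fun {Y Z p} hY hZ _ => ContinuousLinearMap.ext fun u => hfadd Y Z p hY hZ u
      leibniz := fun {Y f p} hY hf _ => ContinuousLinearMap.ext fun u => hfsmul f Y p hf hY u }

section Uniqueness

variable {g : FormField n M} {D : Connection n M}

lemma IsLeviCivita.apply_eq (hD : IsLeviCivita g D) {p : M} (hg : IsInnerProduct (g p))
    {d : VField n M → TangentSpace (𝓡 n) p → TangentSpace (𝓡 n) p}
    (htor : ∀ X Y : VField n M, X.DiffAt p → Y.DiffAt p →
      d Y (X p) - d X (Y p) = VectorField.mlieBracket (𝓡 n) X Y p)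
    (hmet : ∀ Y Z : VField n M, Y.DiffAt p → Z.DiffAt p → ∀ u,
      mvfderiv (𝓡 n) (fun q => g q (Y q) (Z q)) p u = g p (d Y u) (Z p) + g p (Y p) (d Z u))
    {Y : VField n M} (hY : Y.DiffAt p) (u : TangentSpace (𝓡 n) p) : D Y p u = d Y u := by
  refine leviCivita_unique_at hg (d := fun Y u => D Y p u)
    (fun X Y hX hY => (hD.torsion_free X Y p hX hY).trans (htor X Y hX hY).symm)
    (fun Y Z hY hZ u => ?_) hY u
  have h := hD.metric (extVec u) Y Z p hY hZ
  have hu : extVec u p = u := extVec_self u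
  rw [hu] at h
  exact h.symm.trans (hmet Y Z hY hZ u)

end Uniqueness

variable (hx : IsSpaceFormImmersion k x)
include hx

namespace IsSpaceFormImmersion

lemma exists_leviCivita_first : ∃ D : Connection n M, IsLeviCivita (firstForm k x) D :=
  ⟨connectionOfPointwise (inducedConn k x) (fun Y _ => hx.inducedConn_add_dir Y)
    (fun Y _ => hx.inducedConn_smul_dir Y) (fun _ _ _ => hx.inducedConn_add)
    (fun _ _ _ => hx.inducedConn_smul),
    fun _ _ _ => hx.inducedConn_torsion, fun X _ _ p hY hZ => hx.inducedConn_metric hY hZ (X p)⟩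

/-- An unrelated normal frame is chosen around every point. Nothing has to be glued, since a
connection consists of its pointwise values and all its axioms are tested at one point. -/
lemma exists_leviCivita_third (hν : ∀ p, relativeNullity k x p = 0) :
    ∃ D : Connection n M, IsLeviCivita (thirdForm k x) D := by
  choose V ξ hV hp hξ using hx.exists_normalFrame
  exact ⟨connectionOfPointwise (fun Y p => frameConn k x (ξ p) Y p)
    (fun Y _ => frameConn_add_dir hx Y)
    (fun Y _ => frameConn_smul_dir hx Y) (fun _ _ p => frameConn_add hx (hV p) (hξ p) (hp p))
    (fun _ _ p => frameConn_smul hx (hV p) (hξ p) hν (hp p)),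
    fun _ _ p => frameConn_torsion hx (hV p) (hξ p) hν (hp p),
    fun X _ _ p hY hZ => frameConn_metric hx (hV p) (hξ p) hν (hp p) hY hZ (X p)⟩

lemma leviCivita_first_eq {D : Connection n M} (hD : IsLeviCivita (firstForm k x) D) {Y : VField n M}
    {p : M} (hY : Y.DiffAt p) (u : TangentSpace (𝓡 n) p) : D Y p u = inducedConn k x Y p u :=
  hD.apply_eq (hx.isInner p) (fun _ _ => hx.inducedConn_torsion) (fun _ _ => hx.inducedConn_metric)
    hY u

lemma leviCivita_third_eq (hν : ∀ p, relativeNullity k x p = 0) {D : Connection n M}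
    (hD : IsLeviCivita (thirdForm k x) D) {U : Set M} (hU : IsOpen U)
    {ξ : Fin m → M → Amb (n + m)} (hξ : IsNormalFrameOn k x U ξ) {Y : VField n M}
    {p : M} (hp : p ∈ U) (hY : Y.DiffAt p) (u : TangentSpace (𝓡 n) p) :
    D Y p u = frameConn k x ξ Y p u :=
  hD.apply_eq (hx.isInner_third (hν p)) (fun _ _ => frameConn_torsion hx hU hξ hν hp)
    (fun _ _ => frameConn_metric hx hU hξ hν hp) hY u

/-! ### The covariant derivative of the shape operators -/

omit hx in
/-- The covariant derivative `(∇_u A_ξ) Y` at a point, for the induced connection. -/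
def _root_.covShapeAt (k : ℝ) (x : M → Amb (n + m)) (ξ : M → Amb (n + m)) (Y : VField n M) (p : M)
    (u : TangentSpace (𝓡 n) p) : TangentSpace (𝓡 n) p :=
  inducedConn k x (fun q => shapeOp k x q (ξ q) (Y q)) p u
    - shapeOp k x p (ξ p) (inducedConn k x Y p u)
    - shapeOp k x p (normalCov k x ξ p u) (Y p)

variable {U : Set M} (hU : IsOpen U)
include hU

lemma covShape_eq {D : Connection n M} (hD : IsLeviCivita (firstForm k x) D)
    {ξ : M → Amb (n + m)} (hξ : IsNormalFieldOn k x U ξ) {Y : VField n M}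
    {p : M} (hp : p ∈ U) (hY : Y.DiffAt p) (X : VField n M) :
    covShape k x D ξ X Y p = covShapeAt k x ξ Y p (X p) := by
  rw [covShape, covShapeAt, hx.leviCivita_first_eq hD (hx.diffAt_shapeOp hU hξ hp hY),
    hx.leviCivita_first_eq hD hY]

/-- `∇_u A_ξ` is self-adjoint. -/
lemma covShapeAt_symm {ξ : M → Amb (n + m)} (hξ : IsNormalFieldOn k x U ξ) {Y Z : VField n M}
    {p : M} (hp : p ∈ U) (hY : Y.DiffAt p) (hZ : Z.DiffAt p) (u : TangentSpace (𝓡 n) p) :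
    firstForm k x p (covShapeAt k x ξ Y p u) (Z p) =
      firstForm k x p (Y p) (covShapeAt k x ξ Z p u) := by
  have hI := hx.isInner p
  -- Both sides of `⟨A_ξ Y, Z⟩ = ⟨Y, A_ξ Z⟩` are differentiated and compared.
  have h1 := hx.inducedConn_metric (hx.diffAt_shapeOp hU hξ hp hY) hZ u
  have h2 := hx.inducedConn_metric hY (hx.diffAt_shapeOp hU hξ hp hZ) u
  simp only [hx.shapeOp_symm] at h1
  rw [h1] at h2
  simp only [covShapeAt, hI.sub_left, hI.sub_right, hx.shapeOp_symm]
  rw [← hx.shapeOp_symm p (ξ p) (Y p)]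
  rw [← hx.shapeOp_symm p (ξ p) (Y p)] at h2
  linarith

/-- The summand with `∇_u Y` lies in the image of `v ↦ (A_j v)_j`; the deviation from the image is
therefore governed by the derivatives of the `A_j`. -/
lemma tupleConn_frameOps_eq {ξ : Fin m → M → Amb (n + m)} (hξ : IsNormalFrameOn k x U ξ)
    {p : M} (hp : p ∈ U) (Y : VField n M) (j : Fin m) (u : TangentSpace (𝓡 n) p) :
    tupleConn k x ξ (frameOps k x ξ Y) j p u =
      covShapeAt k x (ξ j) Y p u + shapeOp k x p (ξ j p) (inducedConn k x Y p u) := by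
  rw [tupleConn_frameOps hx hU hξ hp, covShapeAt]
  abel

lemma smoothOn_covShapeAt {ξ : Fin m → M → Amb (n + m)} (hξ : IsNormalFrameOn k x U ξ)
    {X Y : VField n M} (hX : X.SmoothOn U) (hY : Y.SmoothOn U) (j : Fin m) :
    VField.SmoothOn (fun q => covShapeAt k x (ξ j) Y q (X q)) U :=
  ((smoothOn_tupleConn hx hU hξ (smoothOn_frameOps hx hU hξ hY) hX j).sub
    (hx.smoothOn_shapeOp hU (hξ.1 j) (hx.smoothOn_inducedConn hU hX hY))).congr fun q hq => by
      rw [hx.tupleConn_frameOps_eq hU hξ hq, add_sub_cancel_right]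

omit hx hU in
/-- The difference tensor `W⁻¹ ∑_j A_j (∇_u A_j) Y` at a point. -/
def _root_.shapeTensor (k : ℝ) (x : M → Amb (n + m)) (ξ : Fin m → M → Amb (n + m)) (Y : VField n M)
    (p : M) (u : TangentSpace (𝓡 n) p) : TangentSpace (𝓡 n) p :=
  Ring.inverse (obata k x p) (∑ j, shapeOp k x p (ξ j p) (covShapeAt k x (ξ j) Y p u))

omit hU in
lemma thirdForm_shapeTensor (hν : ∀ p, relativeNullity k x p = 0) (ξ : Fin m → M → Amb (n + m))
    (Y : VField n M) {p : M} (u v : TangentSpace (𝓡 n) p) :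
    thirdForm k x p (shapeTensor k x ξ Y p u) v =
      ∑ j, firstForm k x p (covShapeAt k x (ξ j) Y p u) (shapeOp k x p (ξ j p) v) :=
  thirdForm_inverse_sum hx hν p _ _ v

variable {ξ : Fin m → M → Amb (n + m)} (hξ : IsNormalFrameOn k x U ξ)
include hξ

lemma tensorT_eq {D : Connection n M} (hD : IsLeviCivita (firstForm k x) D) {p : M} (hp : p ∈ U)
    (X : VField n M) {Y : VField n M} (hY : Y.DiffAt p) :
    tensorT k x D ξ X Y p = shapeTensor k x ξ Y p (X p) := by
  simp only [tensorT, hx.covShape_eq hU hD (hξ.1 _) hp hY X, shapeTensor]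

variable (hν : ∀ p, relativeNullity k x p = 0)
include hν

/-- The projection sends `(A_j ∇_u Y)_j` back to `∇_u Y`, because `∑ A_j² = W`, and the rest is the
tensor `T`. -/
lemma frameConn_eq {p : M} (hp : p ∈ U) (Y : VField n M) (u : TangentSpace (𝓡 n) p) :
    frameConn k x ξ Y p u = inducedConn k x Y p u + shapeTensor k x ξ Y p u := by
  have hW : ∀ v, ∑ j, shapeOp k x p (ξ j p) (shapeOp k x p (ξ j p) v) = obata k x p v := fun v => by
    rw [hx.obata_eq_sum (hξ.2 p hp), LinearMap.sum_apply]
    exact Finset.sum_congr rfl fun j _ => by rw [pow_two, Module.End.mul_apply]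
  rw [shapeTensor, frameConn]
  simp only [hx.tupleConn_frameOps_eq hU hξ hp, map_add, Finset.sum_add_distrib, hW]
  rw [← Module.End.mul_apply (Ring.inverse (obata k x p)) (obata k x p),
    Ring.inverse_mul_cancel _ (hx.isUnit_obata (hν p)), Module.End.one_apply, add_comm]

/-- The difference of the Levi-Civita connections of the third and first fundamental forms. -/
lemma leviCivita_third_sub_first {D D' : Connection n M} (hD : IsLeviCivita (firstForm k x) D)
    (hD' : IsLeviCivita (thirdForm k x) D') {p : M} (hp : p ∈ U)
    (X : VField n M) {Y : VField n M} (hY : Y.DiffAt p) :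
    D' Y p (X p) - D Y p (X p) = tensorT k x D ξ X Y p := by
  rw [hx.leviCivita_third_eq hν hD' hU hξ hp hY, hx.leviCivita_first_eq hD hY,
    hx.frameConn_eq hU hξ hν hp, hx.tensorT_eq hU hξ hD hp X hY, add_sub_cancel_left]

end IsSpaceFormImmersion

end LeviCivita

/-! ### The curvature of the connection on tuples. -/

section Egregium

variable {n m : ℕ} {M : Type*} [TopologicalSpace M] [ChartedSpace (EuclideanSpace ℝ (Fin n)) M]
  [IsManifold (𝓡 n) ∞ M] {k : ℝ} {x : M → Amb (n + m)}

/-! ### Flatness of the normal connection in terms of connection forms -/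

lemma normalPart_sum {ι : Type*} (s : Finset ι) (p : M) (w : ι → Amb (n + m)) :
    normalPart k x p (∑ i ∈ s, w i) = ∑ i ∈ s, normalPart k x p (w i) :=
  map_sum (IsLinearMap.mk' (normalPart k x p) ⟨normalPart_add k x p, normalPart_smul k x p⟩) w s

lemma normalCov_congr {ξ ζ : M → Amb (n + m)} {p : M} (h : ξ =ᶠ[𝓝 p] ζ)
    (u : TangentSpace (𝓡 n) p) : normalCov k x ξ p u = normalCov k x ζ p u := by
  rw [normalCov, normalCov, ambCov, ambCov, mvfderiv_congr h, h.eq_of_nhds]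

lemma frameConn_congr (ξ : Fin m → M → Amb (n + m)) {Y Y' : VField n M} {p : M}
    (h : ∀ᶠ q in 𝓝 p, Y q = Y' q) (u : TangentSpace (𝓡 n) p) :
    frameConn k x ξ Y p u = frameConn k x ξ Y' p u := by
  have h1 : ∀ j, inducedConn k x (frameOps k x ξ Y j) p u =
      inducedConn k x (frameOps k x ξ Y' j) p u := fun j =>
    inducedConn_congr (h.mono fun q hq => by simp only [frameOps, hq]) u
  simp only [frameConn, tupleConn, h1]
  simp only [frameOps, h.self_of_nhds]

/-- The curvature of the induced connection. -/
def inducedCurv (k : ℝ) (x : M → Amb (n + m)) (X Y Z : VField n M) : VField n M := fun p =>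
  inducedConn k x (fun q => inducedConn k x Z q (Y q)) p (X p)
    - inducedConn k x (fun q => inducedConn k x Z q (X q)) p (Y p)
    - inducedConn k x Z p (VectorField.mlieBracket (𝓡 n) X Y p)

variable (hx : IsSpaceFormImmersion k x)
include hx
namespace IsSpaceFormImmersion

variable {U : Set M} (hU : IsOpen U) {ξ : Fin m → M → Amb (n + m)} (hξ : IsNormalFrameOn k x U ξ)
include hU hξ

lemma ambForm_normalCov_frame {p : M} (hp : p ∈ U) (i j : Fin m) (u : TangentSpace (𝓡 n) p) :
    ambForm k (normalCov k x (ξ j) p u) (ξ i p) = connForm k ξ i j p u := by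
  rw [normalCov_frame hx hU hξ hp, ambForm_sum_left]
  simp [ambForm_smul_left, (hξ.2 p hp).2]

lemma ambForm_normalCov_sum {p : M} (hp : p ∈ U) {f : Fin m → M → ℝ}
    (hf : ∀ i, MDifferentiableAt (𝓡 n) 𝓘(ℝ, ℝ) (f i) p) (l : Fin m) (u : TangentSpace (𝓡 n) p) :
    ambForm k (normalCov k x (fun q => ∑ i, f i q • ξ i q) p u) (ξ l p) =
      mvfderiv (𝓡 n) (f l) p u + ∑ i, f i p * connForm k ξ l i p u := by
  have hN : ∀ i, IsNormalAt k x p (ξ i p) := (hξ.2 p hp).1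
  have hd : ∀ i, MDifferentiableAt (𝓡 n) 𝓘(ℝ, Amb (n + m)) (ξ i) p :=
    mdifferentiableAt_frame hU hξ hp
  have hs : IsNormalAt k x p (∑ i, f i p • ξ i p) := hx.mem_ker_conormal.1
    (Submodule.sum_mem _ fun i _ => Submodule.smul_mem _ _ (hx.mem_ker_conormal.2 (hN i)))
  have h1 : ∀ i, mvfderiv (𝓡 n) (fun q => f i q • ξ i q) p u =
      f i p • mvfderiv (𝓡 n) (ξ i) p u + mvfderiv (𝓡 n) (f i) p u • ξ i p := fun i => by
    rw [mvfderiv_fun_smul (hf i) (hd i)]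
    rfl
  rw [hx.normalCov_eq (ξ := fun q => ∑ i, f i q • ξ i q) hs,
    mvfderiv_sum_apply (f := fun i q => f i q • ξ i q) _ (fun i => (hf i).smul (hd i))]
  simp only [h1, normalPart_sum, normalPart_add, normalPart_smul,
    hx.normalPart_of_normal (hN _), ← hx.normalCov_eq (hN _), ambForm_sum_left, ambForm_add_left,
    ambForm_smul_left, hx.ambForm_normalCov_frame hU hξ hp, Finset.sum_add_distrib]
  rw [add_comm]
  simp [(hξ.2 p hp).2]

variable (hflat : IsNormallyFlat k x)
include hflat

/-- The `ξ_l`-component of `R^⊥(X,Y) ξ_j = 0`, which is Cartan's equation `dω + ω ∧ ω = 0`. -/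
lemma connForm_flat {X Y : VField n M} (hX : X.SmoothOn U) (hY : Y.SmoothOn U) {p : M} (hp : p ∈ U)
    (l j : Fin m) :
    mvfderiv (𝓡 n) (fun q => connForm k ξ l j q (Y q)) p (X p)
      - mvfderiv (𝓡 n) (fun q => connForm k ξ l j q (X q)) p (Y p)
      - connForm k ξ l j p (VectorField.mlieBracket (𝓡 n) X Y p)
      + (∑ i, connForm k ξ i j p (Y p) * connForm k ξ l i p (X p)
        - ∑ i, connForm k ξ i j p (X p) * connForm k ξ l i p (Y p)) = 0 := by
  have hmem := hU.mem_nhds hp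
  have h := congrArg (fun w => ambForm k w (ξ l p)) (hflat U hU X Y hX hY (ξ j) (hξ.1 j) p hp)
  have hc : ∀ {X : VField n M}, X.SmoothOn U → ∀ i, MDifferentiableAt (𝓡 n) 𝓘(ℝ, ℝ)
      (fun q => connForm k ξ i j q (X q)) p := fun hX i =>
    ((smoothOn_connForm hU hξ i j hX).contMDiffAt hmem).mdifferentiableAt (by simp)
  have hn : ∀ X : VField n M, (fun q => normalCov k x (ξ j) q (X q)) =ᶠ[𝓝 p]
      fun q => ∑ i, connForm k ξ i j q (X q) • ξ i q := fun X =>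
    Filter.eventually_of_mem hmem fun q hq => normalCov_frame hx hU hξ hq j (X q)
  simp only [normalCov_congr (hn _), ambForm_sub_left] at h
  rw [hx.ambForm_normalCov_sum hU hξ hp (hc hY), hx.ambForm_normalCov_sum hU hξ hp (hc hX),
    hx.ambForm_normalCov_frame hU hξ hp] at h
  have h0 : ambForm k (0 : Amb (n + m)) (ξ l p) = 0 := by simp [ambForm]
  rw [h0] at h
  linarith

/-- For a flat normal bundle the curvature of `tupleConn` acts componentwise as the curvature of
the first fundamental form. -/
lemma tupleConn_curvature {s : Fin m → VField n M} (hs : ∀ j, (s j).SmoothOn U) {X Y : VField n M}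
    (hX : X.SmoothOn U) (hY : Y.SmoothOn U) {p : M} (hp : p ∈ U) (j : Fin m) :
    tupleConn k x ξ (fun i q => tupleConn k x ξ s i q (Y q)) j p (X p)
      - tupleConn k x ξ (fun i q => tupleConn k x ξ s i q (X q)) j p (Y p)
      - tupleConn k x ξ s j p (VectorField.mlieBracket (𝓡 n) X Y p) =
    inducedCurv k x X Y (s j) p := by
  have hmem := hU.mem_nhds hp
  -- In the second derivative the mixed terms `ω ∇s` are symmetric in the two directions and cancel
  -- in the commutator.
  have key : ∀ {X : VField n M}, X.SmoothOn U → ∀ u,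
      tupleConn k x ξ (fun i q => tupleConn k x ξ s i q (X q)) j p u =
        inducedConn k x (fun q => inducedConn k x (s j) q (X q)) p u
        - ∑ i, (connForm k ξ i j p (X p) • inducedConn k x (s i) p u
          + connForm k ξ i j p u • inducedConn k x (s i) p (X p))
        - ∑ l, mvfderiv (𝓡 n) (fun q => connForm k ξ l j q (X q)) p u • s l p
        + ∑ l, (∑ i, connForm k ξ i j p u * connForm k ξ l i p (X p)) • s l p := by
    intro X hX u
    have hc : ∀ i, MDifferentiableAt (𝓡 n) 𝓘(ℝ, ℝ) (fun q => connForm k ξ i j q (X q)) p :=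
      fun i => ((smoothOn_connForm hU hξ i j hX).contMDiffAt hmem).mdifferentiableAt (by simp)
    have hsp : ∀ i, (s i).DiffAt p := fun i => (hs i).diffAt hU hp
    have hE : inducedConn k x (fun q => tupleConn k x ξ s j q (X q)) p u =
        inducedConn k x (fun q => inducedConn k x (s j) q (X q)) p u
        - ∑ i, (connForm k ξ i j p (X p) • inducedConn k x (s i) p u
          + mvfderiv (𝓡 n) (fun q => connForm k ξ i j q (X q)) p u • s i p) := by
      simp only [tupleConn]
      rw [hx.inducedConn_sub ((hx.smoothOn_inducedConn hU hX (hs j)).diffAt hU hp)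
        (VField.DiffAt.sum fun i => (hsp i).smul (hc i)),
        hx.inducedConn_sum _ fun i => (hsp i).smul (hc i)]
      simp only [fun i => hx.inducedConn_smul (hc i) (hsp i) u]
    have hS : ∑ i, connForm k ξ i j p u • ∑ l, connForm k ξ l i p (X p) • s l p =
        ∑ l, (∑ i, connForm k ξ i j p u * connForm k ξ l i p (X p)) • s l p := by
      simp only [Finset.smul_sum, Finset.sum_smul, smul_smul]
      exact Finset.sum_comm
    rw [tupleConn, hE]
    simp only [tupleConn, smul_sub, Finset.sum_sub_distrib, Finset.sum_add_distrib, hS]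
    abel
  -- The remaining terms without derivatives of `s` form the curvature matrix of the normal
  -- connection; this is where flatness enters.
  have hz : ∑ l, (mvfderiv (𝓡 n) (fun q => connForm k ξ l j q (Y q)) p (X p)
      - mvfderiv (𝓡 n) (fun q => connForm k ξ l j q (X q)) p (Y p)
      - connForm k ξ l j p (VectorField.mlieBracket (𝓡 n) X Y p)
      + (∑ i, connForm k ξ i j p (Y p) * connForm k ξ l i p (X p)
        - ∑ i, connForm k ξ i j p (X p) * connForm k ξ l i p (Y p))) • s l p = 0 :=
    Finset.sum_eq_zero fun l _ => by rw [hx.connForm_flat hU hξ hflat hX hY hp, zero_smul]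
  simp only [add_smul, sub_smul, Finset.sum_add_distrib, Finset.sum_sub_distrib] at hz
  rw [key hX, key hY, inducedCurv, tupleConn, ← sub_eq_zero, ← neg_eq_zero, ← hz]
  simp only [Finset.sum_add_distrib]
  abel

end IsSpaceFormImmersion

end Egregium

/-! ### The generalized Theorema Egregium. -/

section Theorema

variable {n m : ℕ} {M : Type*} [TopologicalSpace M] [ChartedSpace (EuclideanSpace ℝ (Fin n)) M]
  [IsManifold (𝓡 n) ∞ M] {k : ℝ} {x : M → Amb (n + m)}

variable (hx : IsSpaceFormImmersion k x)
include hx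
namespace IsSpaceFormImmersion

/-! ### The curvature of the third fundamental form -/

variable {U : Set M} (hU : IsOpen U)
include hU

lemma curvature_first_eq {D : Connection n M} (hD : IsLeviCivita (firstForm k x) D)
    {X Y Z : VField n M} (hX : X.SmoothOn U) (hY : Y.SmoothOn U) (hZ : Z.SmoothOn U) {p : M}
    (hp : p ∈ U) : curvature D X Y Z p = inducedCurv k x X Y Z p := by
  have h1 : ∀ {X : VField n M}, X.SmoothOn U → ∀ u, D (fun q => D Z q (X q)) p u =
      inducedConn k x (fun q => inducedConn k x Z q (X q)) p u := fun {X} hX u => by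
    have he : ∀ᶠ q in 𝓝 p, D Z q (X q) = inducedConn k x Z q (X q) :=
      Filter.eventually_of_mem (hU.mem_nhds hp) fun q hq =>
        hx.leviCivita_first_eq hD (hZ.diffAt hU hq) _
    rw [hx.leviCivita_first_eq hD (((hx.smoothOn_inducedConn hU hX hZ).diffAt hU hp).congr he),
      inducedConn_congr he]
  rw [curvature, h1 hX, h1 hY, hx.leviCivita_first_eq hD (hZ.diffAt hU hp), inducedCurv]

variable {ξ : Fin m → M → Amb (n + m)} (hξ : IsNormalFrameOn k x U ξ)
  (hν : ∀ p, relativeNullity k x p = 0)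
include hξ hν

lemma curvature_third_eq {D' : Connection n M} (hD' : IsLeviCivita (thirdForm k x) D')
    {X Y Z : VField n M} (hX : X.SmoothOn U) (hY : Y.SmoothOn U) (hZ : Z.SmoothOn U) {p : M}
    (hp : p ∈ U) : curvature D' X Y Z p =
      frameConn k x ξ (fun q => frameConn k x ξ Z q (Y q)) p (X p)
        - frameConn k x ξ (fun q => frameConn k x ξ Z q (X q)) p (Y p)
        - frameConn k x ξ Z p (VectorField.mlieBracket (𝓡 n) X Y p) := by
  have h1 : ∀ {X : VField n M}, X.SmoothOn U → ∀ u, D' (fun q => D' Z q (X q)) p u =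
      frameConn k x ξ (fun q => frameConn k x ξ Z q (X q)) p u := fun {X} hX u => by
    have he : ∀ᶠ q in 𝓝 p, D' Z q (X q) = frameConn k x ξ Z q (X q) :=
      Filter.eventually_of_mem (hU.mem_nhds hp) fun q hq =>
        hx.leviCivita_third_eq hν hD' hU hξ hq (hZ.diffAt hU hq) _
    rw [hx.leviCivita_third_eq hν hD' hU hξ hp
      (((smoothOn_frameConn hx hU hξ hν hX hZ).diffAt hU hp).congr he), frameConn_congr ξ he]
  rw [curvature, h1 hX, h1 hY, hx.leviCivita_third_eq hν hD' hU hξ hp (hZ.diffAt hU hp)]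

/-- The second derivatives of `frameConn`, paired with a third field. -/
lemma thirdForm_frameConn_frameConn {Y Z V : VField n M} (hY : Y.SmoothOn U) (hZ : Z.SmoothOn U)
    (hV : V.SmoothOn U) {p : M} (hp : p ∈ U) (u : TangentSpace (𝓡 n) p) :
    thirdForm k x p (frameConn k x ξ (fun q => frameConn k x ξ Z q (Y q)) p u) (V p) =
      ∑ j, firstForm k x p (tupleConn k x ξ
          (fun i q => tupleConn k x ξ (frameOps k x ξ Z) i q (Y q)) j p u)
            (shapeOp k x p (ξ j p) (V p))
      + (∑ j, firstForm k x p (tupleConn k x ξ (frameOps k x ξ Z) j p (Y p))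
          (tupleConn k x ξ (frameOps k x ξ V) j p u)
        - thirdForm k x p (frameConn k x ξ Z p (Y p)) (frameConn k x ξ V p u)) := by
  -- The function `III(∇'_Y Z, V)`, with `∇'` the projected connection, is differentiated twice: as
  -- an `III`-product, and as a sum of `I`-products of tuples.
  have h1 := frameConn_metric hx hU hξ hν hp ((smoothOn_frameConn hx hU hξ hν hY hZ).diffAt hU hp)
    (hV.diffAt hU hp) u
  have h2 := tupleConn_metric hx hU hξ hp
    (s := fun i q => tupleConn k x ξ (frameOps k x ξ Z) i q (Y q)) (t := frameOps k x ξ V)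
    (fun j => (smoothOn_tupleConn hx hU hξ (smoothOn_frameOps hx hU hξ hZ) hY j).diffAt hU hp)
    (diffAt_frameOps hx hU hξ hp (hV.diffAt hU hp)) u
  simp only [thirdForm_frameConn hx hν Z] at h1
  have h3 := h1.symm.trans h2
  simp only [frameOps] at h3
  rw [thirdForm_frameConn hx hν Z]
  linarith

/-- Both sides pair the components orthogonal to the subbundle of tuples `(A_j v)_j`. Passing from
`∇(A_j Z)` to `(∇A_j) Z` changes a tuple only by an element of the subbundle, which these pairings
do not see. -/
lemma sum_tupleConn_sub_thirdForm {p : M} (hp : p ∈ U) (Z V : VField n M)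
    (u w : TangentSpace (𝓡 n) p) :
    ∑ j, firstForm k x p (tupleConn k x ξ (frameOps k x ξ Z) j p u)
        (tupleConn k x ξ (frameOps k x ξ V) j p w)
      - thirdForm k x p (frameConn k x ξ Z p u) (frameConn k x ξ V p w) =
    ∑ j, firstForm k x p (covShapeAt k x (ξ j) Z p u) (covShapeAt k x (ξ j) V p w)
      - thirdForm k x p (shapeTensor k x ξ Z p u) (shapeTensor k x ξ V p w) := by
  have hI := hx.isInner p
  have hG := hx.isInner_third (hν p)
  rw [hx.frameConn_eq hU hξ hν hp, hx.frameConn_eq hU hξ hν hp]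
  simp only [hx.tupleConn_frameOps_eq hU hξ hp, hI.add_left, hI.add_right, hG.add_left,
    hG.add_right, Finset.sum_add_distrib]
  rw [hG.symm (inducedConn k x Z p u) (shapeTensor k x ξ V p w),
    hx.thirdForm_shapeTensor hν, hx.thirdForm_shapeTensor hν, hx.thirdForm_eq_sum (hξ.2 p hp),
    Finset.sum_congr rfl fun j _ => hI.symm (shapeOp k x p (ξ j p) (inducedConn k x Z p u))
      (covShapeAt k x (ξ j) V p w)]
  ring

/-- The Gauss equation of the subbundle: the first sum is the curvature of the surrounding bundle,
componentwise that of `I` by flatness, and the rest comes from the second fundamental form of the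
subbundle. -/
lemma thirdForm_curvature (hflat : IsNormallyFlat k x) {D' : Connection n M}
    (hD' : IsLeviCivita (thirdForm k x) D') {X Y Z V : VField n M} (hX : X.SmoothOn U)
    (hY : Y.SmoothOn U) (hZ : Z.SmoothOn U) (hV : V.SmoothOn U) {p : M} (hp : p ∈ U) :
    thirdForm k x p (curvature D' X Y Z p) (V p) =
      ∑ j, firstForm k x p (inducedCurv k x X Y (frameOps k x ξ Z j) p)
        (shapeOp k x p (ξ j p) (V p))
      + (∑ j, firstForm k x p (covShapeAt k x (ξ j) Z p (Y p)) (covShapeAt k x (ξ j) V p (X p))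
        - ∑ j, firstForm k x p (covShapeAt k x (ξ j) Z p (X p)) (covShapeAt k x (ξ j) V p (Y p)))
      + (thirdForm k x p (shapeTensor k x ξ Z p (X p)) (shapeTensor k x ξ V p (Y p))
        - thirdForm k x p (shapeTensor k x ξ V p (X p)) (shapeTensor k x ξ Z p (Y p))) := by
  have hI := hx.isInner p
  have hG := hx.isInner_third (hν p)
  have h1 := hx.sum_tupleConn_sub_thirdForm hU hξ hν hp Z V (Y p) (X p)
  have h2 := hx.sum_tupleConn_sub_thirdForm hU hξ hν hp Z V (X p) (Y p)
  rw [hx.curvature_third_eq hU hξ hν hD' hX hY hZ hp, hG.sub_left, hG.sub_left,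
    hx.thirdForm_frameConn_frameConn hU hξ hν hY hZ hV hp,
    hx.thirdForm_frameConn_frameConn hU hξ hν hX hZ hV hp, h1, h2, thirdForm_frameConn hx hν,
    hG.symm (shapeTensor k x ξ V p (X p))]
  simp only [← hx.tupleConn_curvature hU hξ hflat (smoothOn_frameOps hx hU hξ hZ) hX hY hp,
    hI.sub_left, Finset.sum_sub_distrib]
  ring

variable {D : Connection n M} (hD : IsLeviCivita (firstForm k x) D)
include hD

/-- `W⁻¹` is absorbed by `III`, and self-adjointness moves one factor of each product onto `V`, so
that the commutators become the pairings in `thirdForm_curvature`. -/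
lemma thirdForm_tensorP {X Y Z V : VField n M} (hX : X.SmoothOn U)
    (hY : Y.SmoothOn U) (hZ : Z.SmoothOn U) (hV : V.SmoothOn U) {p : M} (hp : p ∈ U) :
    thirdForm k x p (tensorP k x D ξ X Y Z p) (V p) =
      ∑ j, firstForm k x p (inducedCurv k x X Y (frameOps k x ξ Z j) p)
        (shapeOp k x p (ξ j p) (V p))
      - thirdForm k x p (inducedCurv k x X Y Z p) (V p)
      + (∑ j, firstForm k x p (covShapeAt k x (ξ j) Z p (Y p)) (covShapeAt k x (ξ j) V p (X p))
        - ∑ j, firstForm k x p (covShapeAt k x (ξ j) Z p (X p))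
          (covShapeAt k x (ξ j) V p (Y p))) := by
  have hI := hx.isInner p
  have hcov : ∀ {X Y : VField n M}, X.SmoothOn U → Y.SmoothOn U → ∀ j,
      firstForm k x p (covShape k x D (ξ j) X (covShape k x D (ξ j) Y Z) p) (V p) =
        firstForm k x p (covShapeAt k x (ξ j) Z p (Y p)) (covShapeAt k x (ξ j) V p (X p)) := by
    intro X Y hX hY j
    -- The inner derivative must be known as a smooth field near `p`, since the outer one
    -- differentiates it; after the use of self-adjointness only its value at `p` remains.
    have he : ∀ q ∈ U, covShape k x D (ξ j) Y Z q = covShapeAt k x (ξ j) Z q (Y q) := fun q hq =>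
      hx.covShape_eq hU hD (hξ.1 j) hq (hZ.diffAt hU hq) Y
    have hd := ((hx.smoothOn_covShapeAt hU hξ hY hZ j).congr he).diffAt hU hp
    rw [hx.covShape_eq hU hD (hξ.1 j) hp hd, hx.covShapeAt_symm hU (hξ.1 j) hp hd (hV.diffAt hU hp),
      he p hp]
  have hR : ∀ j, firstForm k x p (shapeOp k x p (ξ j p) (curvatureShape k x D (ξ j) X Y Z p)) (V p) =
      firstForm k x p (inducedCurv k x X Y (frameOps k x ξ Z j) p) (shapeOp k x p (ξ j p) (V p))
      - firstForm k x p (shapeOp k x p (ξ j p) (inducedCurv k x X Y Z p))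
        (shapeOp k x p (ξ j p) (V p)) := fun j => by
    rw [hx.shapeOp_symm, curvatureShape, hI.sub_left, hx.curvature_first_eq hU hD hX hY hZ hp,
      show curvature D X Y (fun q => shapeOp k x q (ξ j q) (Z q)) p = _ from
        hx.curvature_first_eq hU hD hX hY (smoothOn_frameOps hx hU hξ hZ j) hp]
  rw [tensorP, hx.thirdForm_inverse (hν p), hI.sum_left, hx.thirdForm_eq_sum (hξ.2 p hp)]
  simp only [hI.add_left, hI.sub_left, hR, hcov hX hY, hcov hY hX, Finset.sum_add_distrib,
    Finset.sum_sub_distrib]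

/-- The generalized Theorema Egregium. -/
lemma thirdForm_curvature_sub (hflat : IsNormallyFlat k x) {D' : Connection n M}
    (hD' : IsLeviCivita (thirdForm k x) D') {X Y Z V : VField n M} (hX : X.SmoothOn U)
    (hY : Y.SmoothOn U) (hZ : Z.SmoothOn U) (hV : V.SmoothOn U) {p : M} (hp : p ∈ U) :
    thirdForm k x p (curvature D' X Y Z p - curvature D X Y Z p) (V p) =
      thirdForm k x p (tensorP k x D ξ X Y Z p) (V p)
      + thirdForm k x p (tensorT k x D ξ X Z p) (tensorT k x D ξ Y V p)
      - thirdForm k x p (tensorT k x D ξ X V p) (tensorT k x D ξ Y Z p) := by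
  rw [(hx.isInner_third (hν p)).sub_left, hx.curvature_first_eq hU hD hX hY hZ hp,
    hx.thirdForm_curvature hU hξ hν hflat hD' hX hY hZ hV hp,
    hx.thirdForm_tensorP hU hξ hν hD hX hY hZ hV hp,
    hx.tensorT_eq hU hξ hD hp X (hZ.diffAt hU hp), hx.tensorT_eq hU hξ hD hp Y (hZ.diffAt hU hp),
    hx.tensorT_eq hU hξ hD hp X (hV.diffAt hU hp), hx.tensorT_eq hU hξ hD hp Y (hV.diffAt hU hp)]
  ring

end IsSpaceFormImmersion

end Theorema

/-! ### Traces of operators and the double contraction. -/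

section Contractions

/-! ### Contractions of curvature tensors -/

variable {n : ℕ} {g : EuclideanSpace ℝ (Fin n) → EuclideanSpace ℝ (Fin n) → ℝ}

lemma opTrace_add (f h : EuclideanSpace ℝ (Fin n) → EuclideanSpace ℝ (Fin n)) :
    opTrace (fun w => f w + h w) = opTrace f + opTrace h := by
  simp [opTrace, Finset.sum_add_distrib]

lemma opTrace_sub (f h : EuclideanSpace ℝ (Fin n) → EuclideanSpace ℝ (Fin n)) :
    opTrace (fun w => f w - h w) = opTrace f - opTrace h := by
  simp [opTrace, Finset.sum_sub_distrib]

lemma opTrace_smul_self (c : ℝ) : opTrace (fun w : EuclideanSpace ℝ (Fin n) => c • w) = c * n := by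
  simp [opTrace, stdVec_apply, mul_comm]

lemma opTrace_smul_const (φ : EuclideanSpace ℝ (Fin n) →ₗ[ℝ] ℝ) (u : EuclideanSpace ℝ (Fin n)) :
    opTrace (fun w => φ w • u) = φ u := by
  conv_rhs => rw [← sum_smul_stdVec u, map_sum]
  simp [opTrace, mul_comm]

lemma opTrace_eq_trace (f : Module.End ℝ (EuclideanSpace ℝ (Fin n))) :
    opTrace f = LinearMap.trace ℝ _ f := by
  rw [LinearMap.trace_eq_matrix_trace ℝ (EuclideanSpace.basisFun (Fin n) ℝ).toBasis, Matrix.trace]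
  refine Finset.sum_congr rfl fun a _ => ?_
  rw [Matrix.diag_apply, LinearMap.toMatrix_apply, stdVec_toBasis]
  simp

lemma ambForm_metricTrace_right {N : ℕ} {k : ℝ}
    (g : EuclideanSpace ℝ (Fin n) → EuclideanSpace ℝ (Fin n) → ℝ) (w : Amb N)
    (β : EuclideanSpace ℝ (Fin n) → EuclideanSpace ℝ (Fin n) → Amb N) :
    ambForm k w (metricTrace g β) = metricTrace g fun a b => ambForm k w (β a b) := by
  simp only [metricTrace, ambForm_sum_right, ambForm_smul_right, smul_eq_mul]

namespace IsInnerProduct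

variable (hg : IsInnerProduct g)
include hg

lemma opTrace_eq_metricTrace (f : EuclideanSpace ℝ (Fin n) → EuclideanSpace ℝ (Fin n)) :
    opTrace f = metricTrace g fun w z => g (f w) z :=
  hg.opTrace_eq f

lemma metricTrace_left (β : EuclideanSpace ℝ (Fin n) → EuclideanSpace ℝ (Fin n) →
    EuclideanSpace ℝ (Fin n)) (v : EuclideanSpace ℝ (Fin n)) :
    g (metricTrace g β) v = metricTrace g fun a b => g (β a b) v := by
  simp only [metricTrace, hg.sum_left, hg.smul_left, smul_eq_mul]

lemma metricTrace_right (β : EuclideanSpace ℝ (Fin n) → EuclideanSpace ℝ (Fin n) →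
    EuclideanSpace ℝ (Fin n)) (v : EuclideanSpace ℝ (Fin n)) :
    g v (metricTrace g β) = metricTrace g fun a b => g v (β a b) := by
  simp only [metricTrace, hg.sum_right, hg.smul_right, smul_eq_mul]

lemma metricTrace_swap (β : EuclideanSpace ℝ (Fin n) → EuclideanSpace ℝ (Fin n) → ℝ) :
    (metricTrace g fun a b => β b a) = metricTrace g β := by
  simp only [metricTrace]
  rw [Finset.sum_comm]
  simp only [hg.invGram_symm]

/-- The contraction of the generalized Theorema Egregium. -/
lemma scalar_contraction {R' R P : EuclideanSpace ℝ (Fin n) → EuclideanSpace ℝ (Fin n) →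
      EuclideanSpace ℝ (Fin n) → EuclideanSpace ℝ (Fin n)}
    {T : EuclideanSpace ℝ (Fin n) → EuclideanSpace ℝ (Fin n) → EuclideanSpace ℝ (Fin n)}
    (hT : ∀ u v, T u v = T v u)
    (h : ∀ w u v z, g (R' w u v - R w u v) z =
      g (P w u v) z + g (T w v) (T u z) - g (T w z) (T u v)) :
    (metricTrace g fun u v => opTrace fun w => R' w u v) =
      (metricTrace g fun u v => opTrace fun w => R w u v)
      + (metricTrace g fun u u' => metricTrace g fun v v' => g (T u v) (T u' v'))
      - g (metricTrace g T) (metricTrace g T)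
      + metricTrace g fun u v => opTrace fun w => P w u v := by
  -- Symmetry of `T` arranges the mixed term so that contraction over `w, z` and then over `u, v`
  -- yields the squared norm of `T`; the other quadratic term contracts to the squared norm of its
  -- trace.
  have h' : ∀ w u v z, g (R' w u v) z = g (R w u v) z + g (T u z) (T v w)
      - g (T w z) (T u v) + g (P w u v) z := fun w u v z => by
    have := h w u v z
    rw [hg.sub_left, hT w v, hg.symm (T v w)] at this
    linarith
  have h1 : ∀ u v, (metricTrace g fun w z => g (T u z) (T v w)) =
      metricTrace g fun w z => g (T u w) (T v z) := fun u v =>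
    hg.metricTrace_swap fun z w => g (T u z) (T v w)
  simp only [hg.opTrace_eq_metricTrace, h', metricTrace_add, metricTrace_sub, h1,
    ← hg.metricTrace_left, ← hg.metricTrace_right]

end IsInnerProduct

end Contractions

/-! ### Ricci contraction of the Gauss equation and the scalar curvature of `III`. -/

section ScalarCurvature

variable {n m : ℕ} {M : Type*} [TopologicalSpace M] [ChartedSpace (EuclideanSpace ℝ (Fin n)) M]
  [IsManifold (𝓡 n) ∞ M] {k : ℝ} {x : M → Amb (n + m)}

lemma IsNormalFrameOn.mono {ξ : Fin m → M → Amb (n + m)} {U V : Set M}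
    (hξ : IsNormalFrameOn k x U ξ) (h : V ⊆ U) : IsNormalFrameOn k x V ξ :=
  ⟨fun j => (hξ.1 j).mono h, fun q hq => hξ.2 q (h hq)⟩

variable (hx : IsSpaceFormImmersion k x)
include hx
namespace IsSpaceFormImmersion

/-! ### The scalar curvature of the third fundamental form -/

/-- The trace of `A_η` is `⟨η, H⟩`, here with `η = II(u, v)`. -/
lemma opTrace_shapeOp_secondForm (p : M) (u v : TangentSpace (𝓡 n) p) :
    opTrace (fun w => shapeOp k x p (secondForm k x p u v) w) =
      firstForm k x p (shapeOp k x p (meanCurvature k x p) u) v := by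
  refine ((hx.isInner p).opTrace_eq_metricTrace _).trans ?_
  have key : ∀ a b : TangentSpace (𝓡 n) p,
      firstForm k x p (shapeOp k x p (secondForm k x p u v) a) b =
        ambForm k (secondForm k x p u v) (secondForm k x p a b) := fun a b => by
    rw [hx.firstForm_shapeOp, ambForm_comm]
  rw [hx.firstForm_shapeOp]
  exact (congrArg (metricTrace (firstForm k x p)) (funext fun a => funext fun b => key a b)).trans
    (ambForm_metricTrace_right _ _ _).symm

/-- The source of the term `-n`: this part of the Ricci tensor is `III` itself, whose trace with
respect to `III` is `n`. -/
lemma opTrace_shapeOp_secondForm_left (p : M) (u v : TangentSpace (𝓡 n) p) :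
    opTrace (fun w => shapeOp k x p (secondForm k x p w v) u) = thirdForm k x p u v := by
  refine ((hx.isInner p).opTrace_eq_metricTrace _).trans ?_
  have key : ∀ a b : TangentSpace (𝓡 n) p,
      firstForm k x p (shapeOp k x p (secondForm k x p a v) u) b =
        ambForm k (secondForm k x p u b) (secondForm k x p v a) := fun a b => by
    rw [hx.firstForm_shapeOp, hx.secondForm_comm p a v]
  rw [hx.thirdForm_eq_metricTrace]
  exact (congrArg (metricTrace (firstForm k x p)) (funext fun a => funext fun b => key a b)).trans
    ((hx.isInner p).metricTrace_swap fun a b =>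
      ambForm k (secondForm k x p u a) (secondForm k x p v b))

/-- `I(a, b) = III(W⁻¹ a, b)`, so the left side is the trace of `W⁻¹`. -/
lemma metricTrace_third_first (hn : 1 ≤ n) {p : M} (hν : relativeNullity k x p = 0) :
    metricTrace (thirdForm k x p) (firstForm k x p) =
      eigenEsymm (n - 1) (obata k x p) / LinearMap.det (obata k x p) := by
  have hfin : FiniteDimensional ℝ (TangentSpace (𝓡 n) p) :=
    inferInstanceAs (FiniteDimensional ℝ (EuclideanSpace ℝ (Fin n)))
  have h1 := esymm_div_det_eq_trace (hx.isInner p) (obata k x p) (Ring.inverse (obata k x p))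
    (fun u v => by
      have := (hx.isInner_third hν).symm u v
      rwa [thirdForm, thirdForm, (hx.isInner p).symm _ u] at this)
    (fun u hu => (hx.isInner_third hν).pos u hu)
    (fun u => by
      rw [← Module.End.mul_apply, Ring.mul_inverse_cancel _ (hx.isUnit_obata hν),
        Module.End.one_apply]) hn (finrank_euclideanSpace_fin (𝕜 := ℝ) (n := n))
  refine Eq.trans ?_ h1.symm
  refine Eq.trans ?_ (opTrace_eq_trace (n := n) (Ring.inverse (obata k x p)))
  refine Eq.trans ?_ ((hx.isInner_third hν).opTrace_eq_metricTrace _).symm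
  exact congrArg (metricTrace (thirdForm k x p)) (funext fun a => funext fun b =>
    (hx.thirdForm_inverse hν a b).symm)

/-- The Ricci tensor of `I` from the Gauss equation. The constant curvature part is the trace of `w
↦ k⟨u,v⟩ w - k⟨w,v⟩ u`, that is `kn⟨u,v⟩ - k⟨u,v⟩`. -/
lemma opTrace_curvature_first {D : Connection n M} (hD : IsLeviCivita (firstForm k x) D) (p : M)
    (u v : TangentSpace (𝓡 n) p) :
    opTrace (fun w => curvature D (extVec (p := p) w) (extVec u) (extVec v) p) =
      k * (n - 1) * firstForm k x p u v
        + firstForm k x p (shapeOp k x p (meanCurvature k x p) u) v - thirdForm k x p u v := by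
  have key : ∀ w : TangentSpace (𝓡 n) p, curvature D (extVec w) (extVec u) (extVec v) p =
      shapeOp k x p (secondForm k x p u v) w - shapeOp k x p (secondForm k x p w v) u
      + ((k * firstForm k x p u v) • w - (k * firstForm k x p w v) • u) := fun w => by
    have hs : ∀ u : TangentSpace (𝓡 n) p, (extVec u).SmoothOn (extDomain n p) := smoothOn_extVec
    have ho := isOpen_extDomain (n := n) p
    have hp := mem_extDomain (n := n) p
    have he : ∀ v : TangentSpace (𝓡 n) p, extVec v p = v := fun v => extVec_self v
    have h := hx.gauss_equation ho (hs w) (hs u) (hs v) hp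
    rw [hx.curvature_first_eq ho hD (hs w) (hs u) (hs v) hp, inducedCurv, h]
    simp only [he]
  refine (congrArg opTrace (funext key)).trans ?_
  have h3 := opTrace_smul_const (n := n) (k • (hx.isInner p).toBilin v) u
  have h4 : opTrace (fun w : TangentSpace (𝓡 n) p => (k * firstForm k x p w v) • u) =
      k * firstForm k x p u v := by
    refine Eq.trans (congrArg opTrace (funext fun w : TangentSpace (𝓡 n) p => ?_)) (h3.trans ?_)
    · rw [(hx.isInner p).symm w v]; rfl
    · rw [(hx.isInner p).symm u v]; rfl
  refine (opTrace_add _ _).trans ?_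
  refine (congrArg₂ (· + ·) (opTrace_sub _ _) (opTrace_sub _ _)).trans ?_
  refine (congrArg₂ (· + ·) (congrArg₂ (· - ·) (hx.opTrace_shapeOp_secondForm p u v)
    (hx.opTrace_shapeOp_secondForm_left p u v)) (congrArg₂ (· - ·) (opTrace_smul_self _) h4)).trans ?_
  ring

lemma scalarCurvature_third (hn : 1 ≤ n) (hν : ∀ p, relativeNullity k x p = 0)
    (hflat : IsNormallyFlat k x) {D D' : Connection n M} (hD : IsLeviCivita (firstForm k x) D)
    (hD' : IsLeviCivita (thirdForm k x) D') {U : Set M} (hU : IsOpen U)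
    {ξ : Fin m → M → Amb (n + m)} (hξ : IsNormalFrameOn k x U ξ) {p : M} (hp : p ∈ U) :
    scalarCurvature (thirdForm k x) D' p =
      k * (n - 1) * (eigenEsymm (n - 1) (obata k x p) / LinearMap.det (obata k x p))
      + metricTrace (thirdForm k x p)
          (fun u v => firstForm k x p (shapeOp k x p (meanCurvature k x p) u) v)
      - n
      + metricTrace (thirdForm k x p) (fun u u' => metricTrace (thirdForm k x p) (fun v v' =>
          thirdForm k x p (tensorTAt k x D ξ p u v) (tensorTAt k x D ξ p u' v')))
      - thirdForm k x p (metricTrace (thirdForm k x p) (tensorTAt k x D ξ p))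
          (metricTrace (thirdForm k x p) (tensorTAt k x D ξ p))
      + metricTrace (thirdForm k x p) (ricciContraction (tensorP k x D ξ) p) := by
  -- The extensions of tangent vectors at `p` are known to be smooth on `extDomain n p`, so the
  -- curvature identity is applied on a smaller open set.
  have hV := hU.inter (isOpen_extDomain (n := n) p)
  have hpV : p ∈ U ∩ extDomain n p := ⟨hp, mem_extDomain p⟩
  have hs : ∀ u : TangentSpace (𝓡 n) p, (extVec u).SmoothOn (U ∩ extDomain n p) := fun u =>
    (smoothOn_extVec u).mono Set.inter_subset_right
  have he : ∀ v : TangentSpace (𝓡 n) p, extVec v p = v := fun v => extVec_self v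
  -- `T` is the difference of two torsion-free connections, hence symmetric.
  have hT : ∀ u v : TangentSpace (𝓡 n) p, tensorTAt k x D ξ p u v = tensorTAt k x D ξ p v u := by
    intro u v
    have h1 := hD.torsion_free _ _ p (extVec_diffAt u) (extVec_diffAt v)
    have h2 := hD'.torsion_free _ _ p (extVec_diffAt u) (extVec_diffAt v)
    rw [tensorTAt, tensorTAt,
      ← hx.leviCivita_third_sub_first hU hξ hν hD hD' hp _ (extVec_diffAt v),
      ← hx.leviCivita_third_sub_first hU hξ hν hD hD' hp _ (extVec_diffAt u),
      sub_eq_sub_iff_sub_eq_sub, h1, h2]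
  have hR : ∀ w u v z : TangentSpace (𝓡 n) p,
      thirdForm k x p (curvature D' (extVec w) (extVec u) (extVec v) p
        - curvature D (extVec w) (extVec u) (extVec v) p) z =
      thirdForm k x p (tensorP k x D ξ (extVec w) (extVec u) (extVec v) p) z
      + thirdForm k x p (tensorTAt k x D ξ p w v) (tensorTAt k x D ξ p u z)
      - thirdForm k x p (tensorTAt k x D ξ p w z) (tensorTAt k x D ξ p u v) := fun w u v z => by
    have h := hx.thirdForm_curvature_sub hV (hξ.mono Set.inter_subset_left) hν hD hflat hD'
      (hs w) (hs u) (hs v) (hs z) hpV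
    rwa [he z] at h
  have h0 := (hx.isInner_third (hν p)).scalar_contraction (g := thirdForm k x p)
    (R' := fun w u v => curvature D' (extVec (p := p) w) (extVec (p := p) u) (extVec (p := p) v) p)
    (R := fun w u v => curvature D (extVec (p := p) w) (extVec (p := p) u) (extVec (p := p) v) p)
    (P := fun w u v => tensorP k x D ξ (extVec (p := p) w) (extVec (p := p) u) (extVec (p := p) v) p)
    hT hR
  have h1 : metricTrace (thirdForm k x p) (fun u v => opTrace fun w =>
      curvature D (extVec (p := p) w) (extVec (p := p) u) (extVec (p := p) v) p) =
      k * (n - 1) * (eigenEsymm (n - 1) (obata k x p) / LinearMap.det (obata k x p))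
      + metricTrace (thirdForm k x p)
          (fun u v => firstForm k x p (shapeOp k x p (meanCurvature k x p) u) v)
      - n := by
    refine (congrArg (metricTrace (thirdForm k x p)) (funext fun u => funext fun v =>
      hx.opTrace_curvature_first hD p u v)).trans ?_
    refine (metricTrace_sub _ _ _).trans (congrArg₂ (· - ·) ((metricTrace_add _ _ _).trans
      (congrArg (· + _) ((metricTrace_const_mul _ _ _).trans (congrArg _ ?_)))) ?_)
    · exact hx.metricTrace_third_first hn (hν p)
    · exact (hx.isInner_third (hν p)).metricTrace_self
  rw [h1] at h0
  exact h0

end IsSpaceFormImmersion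

end ScalarCurvature

theorem theorem1 {n m : ℕ} (hn : 1 ≤ n) (k : ℝ)
    {M : Type*} [TopologicalSpace M] [ChartedSpace (EuclideanSpace ℝ (Fin n)) M]
    [IsManifold (𝓡 n) ∞ M]
    (x : M → Amb (n + m)) (hx : IsSpaceFormImmersion k x)
    (hflat : IsNormallyFlat k x)
    (hν : ∀ p, relativeNullity k x p = 0) :
    -- `W` is invertible, `III` is a Riemannian metric, the Levi-Civita connections exist
    (∀ p, IsUnit (obata k x p)) ∧
    (∀ p (u v : TangentSpace (𝓡 n) p), thirdForm k x p u v = thirdForm k x p v u) ∧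
    (∀ p (u : TangentSpace (𝓡 n) p), u ≠ 0 → 0 < thirdForm k x p u u) ∧
    (∃ D : Connection n M, IsLeviCivita (firstForm k x) D) ∧
    (∃ D' : Connection n M, IsLeviCivita (thirdForm k x) D') ∧
    ∀ D D' : Connection n M,
      IsLeviCivita (firstForm k x) D → IsLeviCivita (thirdForm k x) D' →
    ∀ U : Set M, IsOpen U → ∀ ξ : Fin m → M → Amb (n + m), IsNormalFrameOn k x U ξ →
      -- the Obata operator
      (∀ p ∈ U, obata k x p = ∑ j, shapeOp k x p (ξ j p) ^ 2) ∧
      -- (i)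
      (∀ X Y : VField n M, X.SmoothOn U → Y.SmoothOn U → ∀ p ∈ U,
        D' Y p (X p) - D Y p (X p) = tensorT k x D ξ X Y p) ∧
      -- (ii)
      (∀ X Y Z V : VField n M, X.SmoothOn U → Y.SmoothOn U → Z.SmoothOn U → V.SmoothOn U →
        ∀ p ∈ U,
        thirdForm k x p (curvature D' X Y Z p - curvature D X Y Z p) (V p) =
          thirdForm k x p (tensorP k x D ξ X Y Z p) (V p)
          + thirdForm k x p (tensorT k x D ξ X Z p) (tensorT k x D ξ Y V p)
          - thirdForm k x p (tensorT k x D ξ X V p) (tensorT k x D ξ Y Z p)) ∧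
      -- (iii)
      (∀ p ∈ U,
        scalarCurvature (thirdForm k x) D' p =
          k * (n - 1) * (eigenEsymm (n - 1) (obata k x p) / LinearMap.det (obata k x p))
          + metricTrace (thirdForm k x p)
              (fun u v => firstForm k x p (shapeOp k x p (meanCurvature k x p) u) v)
          - n
          + metricTrace (thirdForm k x p) (fun u u' => metricTrace (thirdForm k x p) (fun v v' =>
              thirdForm k x p (tensorTAt k x D ξ p u v) (tensorTAt k x D ξ p u' v')))
          - thirdForm k x p (metricTrace (thirdForm k x p) (tensorTAt k x D ξ p))
              (metricTrace (thirdForm k x p) (tensorTAt k x D ξ p))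
          + metricTrace (thirdForm k x p) (ricciContraction (tensorP k x D ξ) p)) := by
  refine ⟨fun p => hx.isUnit_obata (hν p), fun p => (hx.isInner_third (hν p)).symm,
    fun p => (hx.isInner_third (hν p)).pos, hx.exists_leviCivita_first,
    hx.exists_leviCivita_third hν, fun D D' hD hD' U hU ξ hξ =>
    ⟨fun p hp => hx.obata_eq_sum (hξ.2 p hp), fun X Y _ hY p hp =>
      hx.leviCivita_third_sub_first hU hξ hν hD hD' hp X (hY.diffAt hU hp),
    fun X Y Z V hX hY hZ hV p hp =>
      hx.thirdForm_curvature_sub hU hξ hν hD hflat hD' hX hY hZ hV hp,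
    fun p hp => hx.scalarCurvature_third hn hν hflat hD hD' hU hξ hp⟩⟩

end
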